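/- Let $F$ be a $p$-adic field (a finite extension of $\mathbb{Q}_p$) with $p$ odd, ring of integers $\mathcal{O}_F$, maximal ideal $\mathcal{P}_F$ and residue cardinality $q$. Let $D$ be the quaternion division algebra over $F$, with ring of integers $\mathcal{O}_D$, maximal ideal $\mathcal{P}_D$ and reduced trace $\mathrm{Trd}$. Let $K\subset D$ be a ramified quadratic extension of $F$, let $\varpi\in K$ be such that $\varpi^2=\varpi_F$ is a uniformizer of $F$, and let $\zeta\in D^\times$ be a primitive $(q^2-1)$-st root of unity with $\varpi\zeta\varpi^{-1}=\zeta^q$. Thus $K=F(\varpi)$. Put $M=F(\zeta)$ (the unramified quadratic extension) and $L=F(\zeta\varpi)$ (the other ramified quadratic extension), and write $M,K,L$ also for the tori $M^\times,K^\times,L^\times\subset D^\times$. For subgroups $S,T$ of $D^\times$ and a complex representation $\pi$ of $D^\times$ having a $D^\times$-invariant (hermitian, positive definite) inner product and with $\dim\pi^S\le 1$, $\dim\pi^T\le 1$, the correlation coefficient is $c(\pi;S,T)=|\langle v_S,v_T\rangle|^2$, where $v_S\in\pi^S$ and $v_T\in\pi^T$ are unit vectors for such an inner product; it is well defined if this value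 does not depend on the choices. One sets $c(\pi;S,T)=0$ if $\pi^S=0$ or $\pi^T=0$. Let $\psi:K^\times\to\mathbb{C}^\times$ be a smooth character, minimal (its conductor is at most that of $\psi\cdot(\phi\circ \mathrm{Nm}_{K/F})$ for every character $\phi$ of $F^\times$), of even conductor $m+1$ with $m\geq 1$ odd, where the conductor is the least $\nu\ge 0$ with $\psi|_{1+\mathcal{P}_K^{\nu}}=1$ (and $1+\mathcal{P}_K^0$ means $\mathcal{O}_K^\times$). Let $\psi_0$ be an additive character of $F$ trivial on $\mathcal{O}_F$ but not on $\mathcal{P}_F^{-1}$, and let $c\in\mathcal{P}_K^{-m-2}$ satisfy $\psi(1+x)=\psi_0(\mathrm{Tr}_{K/F}(cx))$ for $x\in\mathcal{P}_K^{(m+1)/2}$. Let $\psi^\#$ be the character of $H=K^\times(1+\mathcal{P}_D^{(m+1)/2})$ given by $\psi^\#(y(1+x))=\psi(y)\,\psi_0(\mathrm{Trd}(cx))$ for $y\in K^\times$, $x\in\mathcal{P}_D^{(m+1)/2}$, and let $\pi$ be (isomorphic to) the representation $\mathrm{Ind}_H^{D^\times}\psi^\#$ of $D^\times$, which is the representation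 associated to $\psi$. **Theorem 1.3.** Assume that $\psi$ is trivial on $F^\times$. Then $\psi(\varpi)=\pm 1$, the correlation coefficients $c(\pi;M,K)$ and $c(\pi;M,L)$ are well defined (in particular $\pi$ has an invariant inner product and the spaces of $M$-, $K$- and $L$-fixed vectors in $\pi$ are at most one dimensional), and $$c(\pi;M,K)=\begin{cases}\dfrac{2}{\dim\pi}&\text{if } q\equiv 3 \bmod 4 \text{ and } \psi(\varpi)=1,\\[1ex] 0&\text{otherwise,}\end{cases}\qquad c(\pi;M,L)=\begin{cases}\dfrac{2}{\dim\pi}&\text{if } q\equiv 1 \bmod 4 \text{ and } \psi(\varpi)=1,\\[1ex] 0&\text{otherwise.}\end{cases}$$ -/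

import Mathlib

open scoped ValuativeRel

noncomputable section

namespace ToricPeriods

section Correlation

variable {G V : Type*} [Group G] [AddCommGroup V] [Module ℂ V]

/-- The space of vectors of `V` fixed by a subgroup `H` of `G`. -/
def fixedVectors (ρ : Representation ℂ G V) (H : Subgroup G) : Submodule ℂ V :=
  Representation.invariants (ρ.comp H.subtype)

/-- `B` is a `G`-invariant (hermitian, positive definite) inner product on the complex
representation `ρ`; it is conjugate linear in the first variable. -/
structure IsInvariantInner (ρ : Representation ℂ G V) (B : V →ₗ⋆[ℂ] V →ₗ[ℂ] ℂ) : Prop where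
  conj_symm : ∀ v w, (starRingEnd ℂ) (B v w) = B w v
  pos : ∀ v, v ≠ 0 → 0 < (B v v).re
  invariant : ∀ g v w, B (ρ g v) (ρ g w) = B v w

/-- The correlation coefficient `c(ρ; H, K)` is well defined and equal to `c`: the fixed spaces
`V^H` and `V^K` are at most one dimensional, `V` has an invariant inner product, and for each
invariant inner product and all unit vectors `v ∈ V^H`, `w ∈ V^K` one has `|⟨v, w⟩|² = c`;
when `V^H = 0` or `V^K = 0` the coefficient is `0`. -/
structure IsCorrelationCoefficient (ρ : Representation ℂ G V) (H K : Subgroup G) (c : ℝ) :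
    Prop where
  rank_left : Module.rank ℂ (fixedVectors ρ H) ≤ 1
  rank_right : Module.rank ℂ (fixedVectors ρ K) ≤ 1
  exists_inner : ∃ B, IsInvariantInner ρ B
  eq_of_unit : ∀ B, IsInvariantInner ρ B → ∀ v ∈ fixedVectors ρ H, ∀ w ∈ fixedVectors ρ K,
    B v v = 1 → B w w = 1 → ‖B v w‖ ^ 2 = c
  eq_zero : fixedVectors ρ H = ⊥ ∨ fixedVectors ρ K = ⊥ → c = 0

end Correlation

section Quaternion

variable (F : Type*) [Field F] [ValuativeRel F] {D : Type*} [DivisionRing D] [Algebra F D]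

/-- The residue cardinality `q` of `F`. -/
def residueCard : ℕ := Nat.card 𝓀[F]

/-- The ring of integers `𝒪_D` of `D` (as a set): the elements integral over `𝒪_F`. -/
def integers : Set D := {x | IsIntegral 𝒪[F] x}

/-- The fractional ideal `𝒫_D ^ n = ϖ ^ n 𝒪_D`, for a uniformizer `ϖ` of `D` and `n ∈ ℤ`.
For a subfield `E` containing `ϖ` one has `𝒫_E ^ n = E ∩ 𝒫_D ^ n` if `E / F` is ramified
quadratic. -/
def idealPow (ϖ : Dˣ) (n : ℤ) : Set D := {x | ((ϖ ^ (-n) : Dˣ) : D) * x ∈ integers F}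

/-- The group of units `𝒪_Dˣ` for `n = 0`, and `1 + 𝒫_D ^ n` for `n ≥ 1` (as a set). -/
def higherUnits (ϖ : Dˣ) (n : ℕ) : Set Dˣ :=
  {u | (u : D) ∈ integers F ∧ ((u⁻¹ : Dˣ) : D) ∈ integers F ∧ (u : D) - 1 ∈ idealPow F ϖ n}

/-- The reduced trace of a quaternion algebra `D`: half of the trace of the regular
representation (`F` will not have characteristic two). -/
def reducedTrace (x : D) : F :=
  (2 : F)⁻¹ * LinearMap.trace F D (LinearMap.mulLeft F x)

variable {F}

/-- The inclusion of `Eˣ` into `Dˣ`, for a subalgebra `E` of `D`. -/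
def unitsIncl (E : Subalgebra F D) : Eˣ →* Dˣ := Units.map (E.val : E →* D)

/-- The trace `Tr_{E/F}` of a subfield `E` of `D`: the trace of the multiplication by `x`. -/
def subfieldTrace (E : Subalgebra F D) (x : E) : F := LinearMap.trace F E (LinearMap.mulLeft F x)

/-- The torus `Eˣ`, as a subgroup of `Dˣ`. -/
def torus (E : Subalgebra F D) : Subgroup Dˣ := (unitsIncl E).range

/-- The inclusion of `Fˣ` into `Eˣ`. -/
def scalarUnits (E : Subalgebra F D) : Fˣ →* Eˣ := Units.map (algebraMap F E : F →* E)

/-- The homomorphism `Nm_{E/F} : Eˣ → Fˣ`. -/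
def unitsNorm (E : Subalgebra F D) : Eˣ →* Fˣ := Units.map (Algebra.norm F : E →* F)

/-- The character `χ` of `Eˣ` is trivial on `1 + 𝒫_E ^ n` (on `𝒪_Eˣ` if `n = 0`). Here `E` is a
ramified quadratic subfield of `D` and `ϖ` is a uniformizer of `E`, hence of `D`. -/
def TrivialOnLevel (E : Subalgebra F D) (ϖ : Eˣ) (χ : Eˣ →* ℂˣ) (n : ℕ) : Prop :=
  ∀ y : Eˣ, unitsIncl E y ∈ higherUnits F (unitsIncl E ϖ) n → χ y = 1

/-- `χ` is a smooth character of `Eˣ` with conductor `f(χ) = n`. -/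
def HasConductor (E : Subalgebra F D) (ϖ : Eˣ) (χ : Eˣ →* ℂˣ) (n : ℕ) : Prop :=
  IsLeast {k | TrivialOnLevel E ϖ χ k} n

/-- `χ`, of conductor `n`, is minimal: `f(χ) ≤ f(χ · φ ∘ Nm_{E/F})` for all characters `φ` of `Fˣ`
(if `φ` is not smooth, then neither is `χ · φ ∘ Nm_{E/F}` and the condition is void). -/
def IsMinimalCharacter (E : Subalgebra F D) (ϖ : Eˣ) (χ : Eˣ →* ℂˣ) : Prop :=
  ∀ n, HasConductor E ϖ χ n → ∀ (φ : Fˣ →* ℂˣ) (k : ℕ),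
    HasConductor E ϖ (χ * φ.comp (unitsNorm E)) k → n ≤ k

/-- The additive character `ψ₀` of `F` has conductor `0`: it is trivial on `𝒪_F` and
non-trivial on `𝒫_F⁻¹`. -/
def AddConductorZero (ϖF : 𝒪[F]) (ψ₀ : AddChar F ℂ) : Prop :=
  (∀ x : 𝒪[F], ψ₀ (x : F) = 1) ∧ ∃ x : 𝒪[F], ψ₀ ((x : F) / (ϖF : F)) ≠ 1

/-- The space of the representation induced to `Dˣ` from the character
`ψ^#(y (1 + x)) = ψ(y) ψ₀(Trd(c x))` of `H = Eˣ (1 + 𝒫_D ^ k)`, that is, the functions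
`f : Dˣ → ℂ` with `f(h g) = ψ^#(h) f(g)` for all `h ∈ H`. Smoothness is automatic, since `ψ^#`
is trivial on an open normal subgroup of `Dˣ`. -/
def inducedSpace (E : Subalgebra F D) (ϖ : Eˣ) (ψ : Eˣ →* ℂˣ) (ψ₀ : AddChar F ℂ) (c : E) (k : ℕ) :
    Submodule ℂ (Dˣ → ℂ) where
  carrier := {f | ∀ y : Eˣ, ∀ u ∈ higherUnits F (unitsIncl E ϖ) k, ∀ g : Dˣ,
    f (unitsIncl E y * u * g) =
      (ψ y : ℂ) * ψ₀ (reducedTrace F ((c : D) * ((u : D) - 1))) * f g}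
  add_mem' := by
    intro f₁ f₂ h₁ h₂ y u hu g
    simp only [Pi.add_apply, h₁ y u hu g, h₂ y u hu g, mul_add]
  zero_mem' := by
    intro y u hu g
    simp
  smul_mem' := by
    intro a f h y u hu g
    simp only [Pi.smul_apply, smul_eq_mul, h y u hu g]
    ring

/-- The induced representation of `Dˣ`: the action of `Dˣ` on `inducedSpace` by right
translation, `(g · f)(x) = f(x g)`. -/
def inducedRep (E : Subalgebra F D) (ϖ : Eˣ) (ψ : Eˣ →* ℂˣ) (ψ₀ : AddChar F ℂ) (c : E) (k : ℕ) :
    Representation ℂ Dˣ (inducedSpace E ϖ ψ ψ₀ c k) where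
  toFun g :=
    { toFun := fun f => ⟨fun x => f.1 (x * g), by
        intro y u hu x
        simpa only [mul_assoc] using f.2 y u hu (x * g)⟩
      map_add' := fun _ _ => rfl
      map_smul' := fun _ _ => rfl }
  map_one' := by
    ext f x
    simp
  map_mul' g₁ g₂ := by
    ext f x
    simp [mul_assoc]

/-- The representation `ρ` of `Dˣ` is associated to the character `ψ` of `Eˣ`, where `E / F` is a
ramified quadratic extension in `D` with uniformizer `ϖ`: the character `ψ` is minimal of even
conductor `m + 1` with `m` odd, and `ρ` is isomorphic to the representation `π_ψ` of `Dˣ` induced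
from the character `ψ^#(y (1 + x)) = ψ(y) ψ₀(Trd(c x))` of `H = Eˣ (1 + 𝒫_D ^ ((m + 1) / 2))`,
where `ψ₀` is an additive character of `F` of conductor `0` and `c ∈ 𝒫_E ^ (-m - 2)` satisfies
`ψ(1 + x) = ψ₀(Tr_{E/F}(c x))` for `1 + x ∈ 1 + 𝒫_E ^ ((m + 1) / 2)`. -/
def IsAssociated (ϖF : 𝒪[F]) (E : Subalgebra F D) (ϖ : Eˣ) (ψ : Eˣ →* ℂˣ)
    {V : Type*} [AddCommGroup V] [Module ℂ V] (ρ : Representation ℂ Dˣ V) : Prop :=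
  ∃ (m : ℕ) (ψ₀ : AddChar F ℂ) (c : E),
    Odd m ∧ HasConductor E ϖ ψ (m + 1) ∧ IsMinimalCharacter E ϖ ψ ∧
    AddConductorZero ϖF ψ₀ ∧
    (c : D) ∈ idealPow F (unitsIncl E ϖ) (-(m : ℤ) - 2) ∧
    (∀ y : Eˣ, unitsIncl E y ∈ higherUnits F (unitsIncl E ϖ) ((m + 1) / 2) →
      (ψ y : ℂ) = ψ₀ (subfieldTrace E (c * ((y : E) - 1)))) ∧
    Nonempty (Representation.Equiv ρ (inducedRep E ϖ ψ ψ₀ c ((m + 1) / 2)))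

end Quaternion

end ToricPeriods

end

/-! Put `i = ϖ` and `j = ζ ^ ((q + 1) / 2)`. These anticommute, `j ^ 2 = ε` is a unit of `F` that is
not a square in the residue field, and `D = K ⊕ K j` with `K = F(i)`, `M = F(j)` (`exists_frame`).
The valuation of the reduced norm is a maximum over the four coordinates, so all filtrations become
coordinate conditions. With `m + 1 = 2 k`, the inducing group `H` consists of the `g = α + β j` (`α,
β ∈ K`) whose `β` is smaller than `α` by `k` levels, and `ψ^#(g) = ψ(α)`. Conjugates of `ψ^#` by
elements outside `H` differ from it (`exists_char_conj_ne`), so the invariant inner product is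
unique up to scalars (`eq_smul_stdInner`).

Fixed vectors are found by Mackey theory. Let `T = F(X)ˣ` with `X` of trace zero. A `T`-fixed
function that does not vanish at `g` forces the `i`-coordinate of `g X g⁻¹` to be small
(`val_imI_le_of_ne_zero`). Then `g X g⁻¹` is close to `K j`, and if some `Y ∈ K j` conjugate to `X`
exists, it is conjugate to this `Y` under `H` (`exists_mul_eq`). So the support is one double coset
`H g₀ T` and the fixed line is explicit. For `M` take `Y = j`. For `K` and `L` one looks for `Y = w₀
i j`, and comparing squares asks that `-1 / ε`, respectively `-1`, be a square, that is `q ≡ 3`,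
respectively `q ≡ 1`, modulo 4. In the other residue class there are no fixed vectors
(`eq_zero_of_mem_fixedVectors`).

For the coefficient, `H \ Dˣ` is the projective line over `𝒪_K / 𝒫_K ^ k`: representatives are `1 +
(x + y i) j`, and `(1 + (x + y i) j) j` with `x` a non-unit (`isRepresentativeFamily`). The
`M`-fixed vector lives on `y = 0`; the `T`-fixed vector, translated by `g₀ ∈ M`, lives on `x = 0`.
The squared norms are the number of pairs (`x`, chart) and twice the number of `y`, with product `2
dim π`. The supports meet in the two cosets of `1` and `j`, which contribute `1` and `ψ(ϖ)⁻¹`. Hence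
the coefficient is `|1 + ψ(ϖ)⁻¹| ^ 2 / (2 dim π)`, which is `2 / dim π` or `0` because `ψ(ϖ) = ±1`.
-/

noncomputable section

namespace ToricPeriods

section

/-! ### Representations induced from a unitary character: invariant forms and fixed vectors -/

section InducedModel

variable {G V I : Type*} [Group G] [AddCommGroup V] [Module ℂ V]

/-- `ι` identifies the representation `π` of `G` with the representation induced from the unitary
character `χ` of the subgroup `H`. -/
structure IsInducedModel (π : Representation ℂ G V) (H : Subgroup G) (χ : G → ℂ)
    (ι : V →ₗ[ℂ] (G → ℂ)) : Prop where
  injective : Function.Injective ι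
  mem_range : ∀ f : G → ℂ, (∀ h ∈ H, ∀ g, f (h * g) = χ h * f g) → ∃ v, ι v = f
  equivariant : ∀ v, ∀ h ∈ H, ∀ g, ι v (h * g) = χ h * ι v g
  action : ∀ g v x, ι (π g v) x = ι v (x * g)
  mul : ∀ h ∈ H, ∀ h' ∈ H, χ (h * h') = χ h * χ h'
  norm : ∀ h ∈ H, ‖χ h‖ = 1

/-- `Φ` parametrizes a set of representatives of `H \ G`. -/
structure IsRepresentativeFamily (H : Subgroup G) (Φ : I → G) : Prop where
  exists_mem : ∀ g, ∃ i, g * (Φ i)⁻¹ ∈ H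
  eq_of_mem : ∀ i j, Φ i * (Φ j)⁻¹ ∈ H → i = j

theorem mem_fixedVectors {π : Representation ℂ G V} {T : Subgroup G} {v : V} :
    v ∈ fixedVectors π T ↔ ∀ t ∈ T, π t v = v := by
  simp [fixedVectors, Representation.mem_invariants]

namespace IsRepresentativeFamily

variable {H : Subgroup G} {Φ : I → G} (hΦ : IsRepresentativeFamily H Φ)
include hΦ

/-- Right translation by `g` permutes the cosets of `H`; this is what makes sums over
representatives translation invariant. -/
theorem exists_bijective (g : G) :
    ∃ σ : I → I, Function.Injective σ ∧ ∀ i, Φ i * g * (Φ (σ i))⁻¹ ∈ H := by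
  choose σ hσ using fun i => hΦ.exists_mem (Φ i * g)
  refine ⟨σ, fun i j hij => hΦ.eq_of_mem i j ?_, hσ⟩
  have h1 := hσ i
  have h2 := hσ j
  rw [← hij] at h2
  have h3 := H.mul_mem h1 (H.inv_mem h2)
  have h4 : Φ i * g * (Φ (σ i))⁻¹ * (Φ j * g * (Φ (σ i))⁻¹)⁻¹ = Φ i * (Φ j)⁻¹ := by group
  rwa [h4] at h3

theorem sum_translate [Fintype I] {R : Type*} [AddCommMonoid R] {F : G → R}
    (hF : ∀ h ∈ H, ∀ g, F (h * g) = F g) (g : G) : ∑ i, F (Φ i * g) = ∑ i, F (Φ i) := by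
  obtain ⟨σ, hσ, hσH⟩ := hΦ.exists_bijective g
  refine Fintype.sum_bijective σ (Finite.injective_iff_bijective.1 hσ) _ _ fun i => ?_
  have := hF _ (hσH i) (Φ (σ i))
  rwa [inv_mul_cancel_right] at this

end IsRepresentativeFamily

namespace IsInducedModel

variable {π : Representation ℂ G V} {H : Subgroup G} {χ : G → ℂ} {ι : V →ₗ[ℂ] (G → ℂ)}
  (hι : IsInducedModel π H χ ι)
include hι

theorem map_ne_zero {h : G} (hh : h ∈ H) : χ h ≠ 0 := by
  intro h0
  simpa [h0] using hι.norm h hh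

theorem map_one : χ 1 = 1 := by
  have := hι.mul 1 H.one_mem 1 H.one_mem
  rw [mul_one] at this
  exact (mul_eq_left₀ (hι.map_ne_zero H.one_mem)).1 this.symm

theorem conj_mul_self {h : G} (hh : h ∈ H) : (starRingEnd ℂ) (χ h) * χ h = 1 := by
  rw [mul_comm, Complex.mul_conj, Complex.normSq_eq_norm_sq, hι.norm h hh]
  simp

theorem conj_mul_invariant (v w : V) (h : G) (hh : h ∈ H) (g : G) :
    (starRingEnd ℂ) (ι v (h * g)) * ι w (h * g) = (starRingEnd ℂ) (ι v g) * ι w g := by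
  rw [hι.equivariant v h hh, hι.equivariant w h hh, map_mul]
  linear_combination (starRingEnd ℂ) (ι v g) * ι w g * hι.conj_mul_self hh

section Fintype

variable [Fintype I] {Φ : I → G} (hΦ : IsRepresentativeFamily H Φ)
include hΦ

omit [Fintype I] in
theorem eq_zero_of_forall {v : V} (hv : ∀ i, ι v (Φ i) = 0) : v = 0 := by
  apply hι.injective
  rw [map_zero]
  funext g
  obtain ⟨i, hi⟩ := hΦ.exists_mem g
  have := hι.equivariant v _ hi (Φ i)
  rw [inv_mul_cancel_right] at this
  rw [this, hv i, mul_zero, Pi.zero_apply]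

omit [Fintype I] in
theorem exists_apply_eq (a : I → ℂ) : ∃ v, ∀ i, ι v (Φ i) = a i := by
  choose σ hσ using hΦ.exists_mem
  have hσi : ∀ i, σ (Φ i) = i := fun i => (hΦ.eq_of_mem _ _ (hσ (Φ i))).symm
  have hσh : ∀ h ∈ H, ∀ g, σ (h * g) = σ g := by
    intro h hh g
    apply hΦ.eq_of_mem
    have h3 := H.mul_mem (H.mul_mem (H.inv_mem (hσ (h * g))) hh) (hσ g)
    have h4 : (h * g * (Φ (σ (h * g)))⁻¹)⁻¹ * h * (g * (Φ (σ g))⁻¹) =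
      Φ (σ (h * g)) * (Φ (σ g))⁻¹ := by group
    rwa [h4] at h3
  obtain ⟨v, hv⟩ := hι.mem_range (fun g => χ (g * (Φ (σ g))⁻¹) * a (σ g)) (by
    intro h hh g
    simp only [hσh h hh]
    rw [mul_assoc h, hι.mul h hh _ (hσ g), mul_assoc])
  refine ⟨v, fun i => ?_⟩
  rw [hv]
  simp only [hσi, mul_inv_cancel, hι.map_one, one_mul]

/-- Evaluation at a set of representatives. -/
def evalEquiv : V ≃ₗ[ℂ] (I → ℂ) :=
  LinearEquiv.ofBijective
    { toFun := fun v i => ι v (Φ i)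
      map_add' := fun v w => by ext; simp
      map_smul' := fun a v => by ext; simp }
    ⟨(injective_iff_map_eq_zero _).2 fun v hv => hι.eq_zero_of_forall hΦ fun i => congrFun hv i,
      fun a => (hι.exists_apply_eq hΦ a).imp fun v hv => funext hv⟩

theorem finrank_eq : Module.finrank ℂ V = Fintype.card I := by
  rw [(hι.evalEquiv hΦ).finrank_eq, Module.finrank_fintype_fun_eq_card]

omit hι hΦ in
variable (ι Φ) in
/-- The standard hermitian form on a model of an induced representation. -/
def stdInner : V →ₗ⋆[ℂ] V →ₗ[ℂ] ℂ :=
  LinearMap.mk₂'ₛₗ (starRingEnd ℂ) (RingHom.id ℂ)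
    (fun v w => ∑ i, (starRingEnd ℂ) (ι v (Φ i)) * ι w (Φ i))
    (fun v v' w => by simp [add_mul, Finset.sum_add_distrib])
    (fun a v w => by simp [Finset.mul_sum, mul_assoc])
    (fun v w w' => by simp [mul_add, Finset.sum_add_distrib])
    (fun a v w => by simp [Finset.mul_sum, mul_left_comm])

omit [Group G] hι hΦ in
theorem stdInner_apply (v w : V) :
    stdInner ι Φ v w = ∑ i, (starRingEnd ℂ) (ι v (Φ i)) * ι w (Φ i) := rfl

theorem isInvariantInner_stdInner : IsInvariantInner π (stdInner ι Φ) where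
  conj_symm v w := by simp [stdInner_apply, mul_comm]
  pos v hv := by
    have hne : ∃ i, ι v (Φ i) ≠ 0 := by
      by_contra! h
      exact hv (hι.eq_zero_of_forall hΦ h)
    obtain ⟨i, hi⟩ := hne
    have : ∀ i, ((starRingEnd ℂ) (ι v (Φ i)) * ι v (Φ i)).re = ‖ι v (Φ i)‖ ^ 2 := by
      intro i
      rw [mul_comm, Complex.mul_conj, Complex.normSq_eq_norm_sq, Complex.ofReal_re]
    simp only [stdInner_apply, Complex.re_sum, this]
    exact Finset.sum_pos' (fun _ _ => by positivity) ⟨i, Finset.mem_univ i, by positivity⟩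
  invariant g v w := by
    simp only [stdInner_apply, hι.action]
    exact hΦ.sum_translate (F := fun x => (starRingEnd ℂ) (ι v x) * ι w x)
      (hι.conj_mul_invariant v w) g

/-- If distinct cosets of `H` are separated by the character `χ`, then the invariant inner product
is unique up to scalars. -/
theorem eq_smul_stdInner
    (hsep : ∀ g, g ∉ H → ∃ u ∈ H, g * u * g⁻¹ ∈ H ∧ χ (g * u * g⁻¹) ≠ χ u)
    {B : V →ₗ⋆[ℂ] V →ₗ[ℂ] ℂ} (hB : IsInvariantInner π B) :
    ∃ C : ℂ, ∀ v w, B v w = C * stdInner ι Φ v w := by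
  classical
  -- `e i` is the vector supported on the coset of `Φ i`; conjugates of elements of `H` act on it by
  -- a scalar.
  choose e he using fun i : I => hι.exists_apply_eq hΦ (Pi.single i 1)
  have hev : ∀ v, v = ∑ i, ι v (Φ i) • e i := by
    intro v
    rw [← sub_eq_zero]
    refine hι.eq_zero_of_forall hΦ fun j => ?_
    simp [map_sub, map_sum, he, Pi.single_apply]
  have hact : ∀ i n, Φ i * n * (Φ i)⁻¹ ∈ H → π n (e i) = χ (Φ i * n * (Φ i)⁻¹) • e i := by
    intro i n hn
    rw [← sub_eq_zero]
    refine hι.eq_zero_of_forall hΦ fun j => ?_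
    rw [map_sub, Pi.sub_apply, hι.action, map_smul, Pi.smul_apply, he, smul_eq_mul, sub_eq_zero]
    by_cases hij : j = i
    · subst hij
      have := hι.equivariant (e j) _ hn (Φ j)
      rwa [inv_mul_cancel_right, he] at this
    · obtain ⟨l, hl⟩ := hΦ.exists_mem (Φ j * n)
      have h1 := hι.equivariant (e i) _ hl (Φ l)
      rw [inv_mul_cancel_right, he] at h1
      rw [h1]
      have hli : l ≠ i := by
        rintro rfl
        apply hij
        apply hΦ.eq_of_mem
        have h3 := H.mul_mem hl (H.inv_mem hn)
        have h4 : Φ j * n * (Φ l)⁻¹ * (Φ l * n * (Φ l)⁻¹)⁻¹ = Φ j * (Φ l)⁻¹ := by group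
        rwa [h4] at h3
      simp [hli, hij]
  -- The element `(Φ j)⁻¹ u Φ j` acts on `e i` and `e j` by two different scalars of absolute value
  -- one, so invariance forces orthogonality.
  have horth : ∀ i j, i ≠ j → B (e i) (e j) = 0 := by
    intro i j hij
    obtain ⟨u, hu, hgu, hne⟩ := hsep (Φ i * (Φ j)⁻¹) fun h => hij (hΦ.eq_of_mem i j h)
    have h1 : Φ j * ((Φ j)⁻¹ * u * Φ j) * (Φ j)⁻¹ = u := by group
    have h2 : Φ i * ((Φ j)⁻¹ * u * Φ j) * (Φ i)⁻¹ = Φ i * (Φ j)⁻¹ * u * (Φ i * (Φ j)⁻¹)⁻¹ := by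
      group
    have h3 := hB.invariant ((Φ j)⁻¹ * u * Φ j) (e i) (e j)
    rw [hact i _ (by rwa [h2]), hact j _ (by rwa [h1]), h1, h2] at h3
    simp only [LinearMap.map_smulₛₗ, LinearMap.smul_apply, smul_eq_mul, RingHom.id_apply] at h3
    by_contra h0
    apply hne
    have h4 := hι.conj_mul_self hgu
    have h5 : (starRingEnd ℂ) (χ (Φ i * (Φ j)⁻¹ * u * (Φ i * (Φ j)⁻¹)⁻¹)) * χ u = 1 := by
      apply mul_right_cancel₀ h0
      linear_combination h3
    have h6 : (starRingEnd ℂ) (χ (Φ i * (Φ j)⁻¹ * u * (Φ i * (Φ j)⁻¹)⁻¹)) ≠ 0 :=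
      fun h => by rw [h, zero_mul] at h4; exact zero_ne_one h4
    exact mul_left_cancel₀ h6 (h4.trans h5.symm)
  -- The group permutes the lines `ℂ e i` transitively, and `(Φ j)⁻¹ Φ i` carries `e i` exactly to
  -- `e j`.
  have hdiag : ∀ i j, B (e i) (e i) = B (e j) (e j) := by
    intro i j
    have : π ((Φ j)⁻¹ * Φ i) (e i) = e j := by
      rw [← sub_eq_zero]
      refine hι.eq_zero_of_forall hΦ fun l => ?_
      rw [map_sub, Pi.sub_apply, hι.action, he, sub_eq_zero]
      by_cases hl : l = j
      · subst hl
        rw [mul_inv_cancel_left, he]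
        simp
      · obtain ⟨a, ha⟩ := hΦ.exists_mem (Φ l * ((Φ j)⁻¹ * Φ i))
        have h1 := hι.equivariant (e i) _ ha (Φ a)
        rw [inv_mul_cancel_right, he] at h1
        rw [h1]
        have hai : a ≠ i := by
          rintro rfl
          apply hl
          apply hΦ.eq_of_mem
          have h4 : Φ l * ((Φ j)⁻¹ * Φ a) * (Φ a)⁻¹ = Φ l * (Φ j)⁻¹ := by group
          rwa [h4] at ha
        simp [hl, hai]
    rw [← hB.invariant ((Φ j)⁻¹ * Φ i), this]
  have hC : ∃ C, ∀ i, B (e i) (e i) = C := by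
    rcases isEmpty_or_nonempty I with h | ⟨⟨i₀⟩⟩
    · exact ⟨0, fun i => (h.false i).elim⟩
    · exact ⟨_, fun i => hdiag i i₀⟩
  obtain ⟨C, hC⟩ := hC
  refine ⟨C, fun v w => ?_⟩
  conv_lhs => rw [hev v, hev w]
  simp only [map_sum, LinearMap.map_smulₛₗ, LinearMap.sum_apply, LinearMap.smul_apply, smul_eq_mul,
    RingHom.id_apply, stdInner_apply, Finset.mul_sum]
  rw [Finset.sum_comm]
  refine Finset.sum_congr rfl fun i _ => ?_
  rw [Finset.sum_eq_single i]
  · rw [hC]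
    ring
  · intro j _ hj
    rw [horth i j hj.symm]
    ring
  · simp

end Fintype

/-- If the `T`-invariant functions are supported on `H g₀ T` and `χ` is trivial on
`H ∩ g₀ T g₀⁻¹`, then the `T`-fixed vectors are the multiples of one vector, described by a function
of absolute value one on `H g₀ T`. -/
theorem exists_fixed_generator {T : Subgroup G} {g₀ : G}
    (htriv : ∀ t ∈ T, g₀ * t * g₀⁻¹ ∈ H → χ (g₀ * t * g₀⁻¹) = 1)
    (hsupp : ∀ v ∈ fixedVectors π T, ∀ g, ι v g ≠ 0 → ∃ h ∈ H, ∃ t ∈ T, g = h * g₀ * t) :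
    ∃ v₀ ∈ fixedVectors π T, (∀ h ∈ H, ∀ t ∈ T, ι v₀ (h * g₀ * t) = χ h) ∧
      (∀ g, ι v₀ g ≠ 0 → ∃ h ∈ H, ∃ t ∈ T, g = h * g₀ * t) ∧
      ∀ v ∈ fixedVectors π T, ∃ a : ℂ, v = a • v₀ := by
  classical
  let f : G → ℂ := fun g =>
    if hg : ∃ h ∈ H, ∃ t ∈ T, g = h * g₀ * t then χ hg.choose else 0
  -- Two factorizations of the same element differ by an element of `H ∩ g₀ T g₀⁻¹`, where `χ` is
  -- trivial; so the choice made in `f` is harmless.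
  have hf : ∀ h ∈ H, ∀ t ∈ T, f (h * g₀ * t) = χ h := by
    intro h hh t ht
    have hg : ∃ h' ∈ H, ∃ t' ∈ T, h * g₀ * t = h' * g₀ * t' := ⟨h, hh, t, ht, rfl⟩
    have hfg : f (h * g₀ * t) = χ hg.choose := dif_pos hg
    rw [hfg]
    obtain ⟨h1, t', ht', he⟩ := hg.choose_spec
    set h' := hg.choose
    have h2 : g₀ * (t * t'⁻¹) * g₀⁻¹ = h⁻¹ * h' := by
      have : h * (g₀ * (t * t'⁻¹) * g₀⁻¹) = h * g₀ * t * t'⁻¹ * g₀⁻¹ := by group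
      rw [eq_inv_mul_iff_mul_eq, this, he]
      group
    have h3 : h⁻¹ * h' ∈ H := H.mul_mem (H.inv_mem hh) h1
    have h4 := htriv _ (T.mul_mem ht (T.inv_mem ht')) (by rwa [h2])
    rw [h2] at h4
    have h5 := hι.mul h hh _ h3
    rw [mul_inv_cancel_left, h4, mul_one] at h5
    exact h5
  have hf0 : ∀ g, (¬ ∃ h ∈ H, ∃ t ∈ T, g = h * g₀ * t) → f g = 0 := fun g hg => dif_neg hg
  obtain ⟨v₀, hv₀⟩ := hι.mem_range f (by
    intro h hh g
    by_cases hg : ∃ h ∈ H, ∃ t ∈ T, g = h * g₀ * t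
    · obtain ⟨h', hh', t, ht, rfl⟩ := hg
      rw [hf h' hh' t ht, ← hι.mul h hh h' hh', ← hf _ (H.mul_mem hh hh') t ht]
      simp only [mul_assoc]
    · rw [hf0 g hg, hf0, mul_zero]
      rintro ⟨h', hh', t, ht, he⟩
      refine hg ⟨h⁻¹ * h', H.mul_mem (H.inv_mem hh) hh', t, ht, ?_⟩
      simp only [mul_assoc] at he ⊢
      rw [← he, inv_mul_cancel_left])
  have hfix : v₀ ∈ fixedVectors π T := by
    rw [mem_fixedVectors]
    intro s hs
    apply hι.injective
    funext g
    rw [hι.action, hv₀]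
    by_cases hg : ∃ h ∈ H, ∃ t ∈ T, g = h * g₀ * t
    · obtain ⟨h', hh', t, ht, rfl⟩ := hg
      rw [hf h' hh' t ht, mul_assoc, hf h' hh' _ (T.mul_mem ht hs)]
    · rw [hf0 g hg, hf0]
      rintro ⟨h', hh', t, ht, he⟩
      refine hg ⟨h', hh', t * s⁻¹, T.mul_mem ht (T.inv_mem hs), ?_⟩
      rw [← mul_assoc, ← he, mul_inv_cancel_right]
  refine ⟨v₀, hfix, fun h hh t ht => by rw [hv₀, hf h hh t ht], hsupp v₀ hfix, fun v hv =>
    ⟨ι v g₀, hι.injective ?_⟩⟩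
  funext g
  rw [map_smul, Pi.smul_apply, smul_eq_mul]
  by_cases hg : ∃ h ∈ H, ∃ t ∈ T, g = h * g₀ * t
  · obtain ⟨h', hh', t, ht, rfl⟩ := hg
    rw [hv₀, hf h' hh' t ht, mul_assoc, hι.equivariant v h' hh', ← hι.action,
      mem_fixedVectors.1 hv t ht, mul_comm]
  · have h1 : ι v g = 0 := by
      by_contra h
      exact hg (hsupp v hv g h)
    rw [h1, hv₀, hf0 g hg, mul_zero]

end IsInducedModel

theorem rank_le_one_of_forall_smul {W : Submodule ℂ V} (v₀ : V)
    (h : ∀ v ∈ W, ∃ a : ℂ, v = a • v₀) : Module.rank ℂ W ≤ 1 := by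
  have : W ≤ Submodule.span ℂ {v₀} := by
    intro v hv
    obtain ⟨a, rfl⟩ := h v hv
    exact Submodule.smul_mem _ _ (Submodule.mem_span_singleton_self v₀)
  exact (Submodule.rank_mono this).trans (by
    simpa using (rank_span_le (R := ℂ) ({v₀} : Set V)))

/-- The correlation coefficient vanishes when there are no vectors fixed by the second group. -/
theorem isCorrelationCoefficient_zero {π : Representation ℂ G V} {S T : Subgroup G}
    (hB : ∃ B, IsInvariantInner π B) {v₀ : V} (hS : ∀ v ∈ fixedVectors π S, ∃ a : ℂ, v = a • v₀)
    (hT : ∀ v ∈ fixedVectors π T, v = 0) : IsCorrelationCoefficient π S T 0 where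
  rank_left := rank_le_one_of_forall_smul v₀ hS
  rank_right := rank_le_one_of_forall_smul 0 fun v hv => ⟨0, by simp [hT v hv]⟩
  exists_inner := hB
  eq_of_unit B _ v _ w hw _ h1 := by simp [hT w hw] at h1
  eq_zero _ := rfl

/-- The correlation coefficient, computed from generators of the fixed spaces. -/
theorem isCorrelationCoefficient_of_generators {π : Representation ℂ G V} {S T : Subgroup G}
    {B₀ : V →ₗ⋆[ℂ] V →ₗ[ℂ] ℂ} (hB₀ : IsInvariantInner π B₀)
    (huniq : ∀ B, IsInvariantInner π B → ∃ C : ℂ, ∀ v w, B v w = C * B₀ v w)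
    {v₀ w₀ : V} (hv₀ : v₀ ∈ fixedVectors π S) (hw₀ : w₀ ∈ fixedVectors π T)
    (hv₀0 : v₀ ≠ 0) (hw₀0 : w₀ ≠ 0)
    (hS : ∀ v ∈ fixedVectors π S, ∃ a : ℂ, v = a • v₀)
    (hT : ∀ w ∈ fixedVectors π T, ∃ a : ℂ, w = a • w₀) :
    IsCorrelationCoefficient π S T
      (‖B₀ v₀ w₀‖ ^ 2 / (‖B₀ v₀ v₀‖ * ‖B₀ w₀ w₀‖)) where
  rank_left := rank_le_one_of_forall_smul v₀ hS
  rank_right := rank_le_one_of_forall_smul w₀ hT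
  exists_inner := ⟨B₀, hB₀⟩
  eq_of_unit B hB v hv w hw h1 h2 := by
    obtain ⟨C, hC⟩ := huniq B hB
    obtain ⟨a, rfl⟩ := hS v hv
    obtain ⟨b, rfl⟩ := hT w hw
    simp only [hC, LinearMap.map_smulₛₗ, LinearMap.smul_apply, smul_eq_mul,
      RingHom.id_apply] at h1 h2 ⊢
    have h1' := congrArg norm h1
    have h2' := congrArg norm h2
    simp only [norm_mul, RCLike.norm_conj, norm_one] at h1' h2' ⊢
    have e1 : ‖B₀ v₀ v₀‖ ≠ 0 := fun h => by simp [h] at h1'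
    have e2 : ‖B₀ w₀ w₀‖ ≠ 0 := fun h => by simp [h] at h2'
    rw [eq_div_iff (mul_ne_zero e1 e2)]
    -- The scalars `‖C‖ ^ 2 ‖a‖ ^ 2 ‖b‖ ^ 2` are eliminated by multiplying the two normalizations.
    linear_combination ‖B₀ v₀ w₀‖ ^ 2 * (‖C‖ * (‖b‖ * (‖b‖ * ‖B₀ w₀ w₀‖)) * h1' + h2')
  eq_zero h := by
    rcases h with h | h
    · rw [h, Submodule.mem_bot] at hv₀
      exact (hv₀0 hv₀).elim
    · rw [h, Submodule.mem_bot] at hw₀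
      exact (hw₀0 hw₀).elim

end InducedModel

end

section

/-! ### Discrete valuations and characters of the additive group -/

section Uniformized

variable {F Γ₀ : Type*} [Field F] [LinearOrderedCommGroupWithZero Γ₀]

/-- `v` is a discrete valuation with uniformizer `ϖ`. -/
structure IsUniformizer (v : Valuation F Γ₀) (ϖ : F) : Prop where
  ne_zero : ϖ ≠ 0
  lt_one : v ϖ < 1
  exists_zpow : ∀ x, x ≠ 0 → ∃ n : ℤ, v x = v ϖ ^ n

/-- `S` is a set of representatives of the valuation ring modulo the `n`-th power of its maximal
ideal. -/
structure IsResidueSystem (v : Valuation F Γ₀) (ϖ : F) (n : ℕ) (S : Finset F) : Prop where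
  zero_mem : 0 ∈ S
  le_one : ∀ x ∈ S, v x ≤ 1
  eq_of_le : ∀ x ∈ S, ∀ y ∈ S, v (x - y) ≤ v ϖ ^ n → x = y
  exists_le : ∀ x, v x ≤ 1 → ∃ y ∈ S, v (x - y) ≤ v ϖ ^ n

namespace IsUniformizer

variable {v : Valuation F Γ₀} {ϖ : F} (h : IsUniformizer v ϖ)
include h

theorem pos : 0 < v ϖ := by
  rw [zero_lt_iff, Valuation.ne_zero_iff]
  exact h.ne_zero

theorem zpow_le_zpow {m n : ℤ} : v ϖ ^ m ≤ v ϖ ^ n ↔ n ≤ m :=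
  zpow_le_zpow_iff_right_of_lt_one₀ h.pos h.lt_one

theorem zpow_lt_zpow {m n : ℤ} : v ϖ ^ m < v ϖ ^ n ↔ n < m :=
  zpow_lt_zpow_iff_right_of_lt_one₀ h.pos h.lt_one

theorem pow_le_pow {m n : ℕ} : v ϖ ^ m ≤ v ϖ ^ n ↔ n ≤ m := by
  have := h.zpow_le_zpow (m := m) (n := n)
  simpa using this

theorem le_of_lt_one {x : F} (hx : v x < 1) : v x ≤ v ϖ := by
  rcases eq_or_ne x 0 with rfl | hx0
  · simp
  · obtain ⟨n, hn⟩ := h.exists_zpow x hx0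
    rw [hn] at hx ⊢
    rw [← zpow_zero (v ϖ), h.zpow_lt_zpow] at hx
    conv_rhs => rw [← zpow_one (v ϖ)]
    rw [h.zpow_le_zpow]
    lia

theorem zpow_succ_le_of_lt {x : F} {n : ℤ} (hx : ¬ v x ≤ v ϖ ^ n) : v ϖ ^ (n - 1) ≤ v x := by
  rcases eq_or_ne x 0 with rfl | hx0
  · simp at hx
  · obtain ⟨m, hm⟩ := h.exists_zpow x hx0
    rw [hm, h.zpow_le_zpow] at hx ⊢
    lia

/-- Here `k - k / 2` is the ceiling of `k / 2`. In `mul_sq_le_iff` the additional factor `ϖ` turns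
it into the floor. Together they describe `𝒫_D ^ k` in coordinates. -/
theorem sq_le_iff {x : F} {k : ℕ} : v x ^ 2 ≤ v ϖ ^ k ↔ v x ≤ v ϖ ^ (k - k / 2) := by
  rcases eq_or_ne x 0 with rfl | hx0
  · simp
  · obtain ⟨n, hn⟩ := h.exists_zpow x hx0
    rw [hn, ← zpow_natCast, ← zpow_natCast, ← zpow_natCast, ← zpow_mul, h.zpow_le_zpow,
      h.zpow_le_zpow]
    lia

theorem mul_sq_le_iff {x : F} {k : ℕ} :
    v ϖ * v x ^ 2 ≤ v ϖ ^ k ↔ v x ≤ v ϖ ^ (k / 2) := by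
  rcases eq_or_ne x 0 with rfl | hx0
  · simp
  · obtain ⟨n, hn⟩ := h.exists_zpow x hx0
    have h1 : v ϖ * v x ^ 2 = v ϖ ^ (1 + n * 2) := by
      rw [hn, zpow_add₀ h.pos.ne', zpow_mul, zpow_one]
      norm_cast
    rw [h1, hn, ← zpow_natCast, ← zpow_natCast, h.zpow_le_zpow, h.zpow_le_zpow]
    lia

/-- Parity of the valuation: for nonzero entries the left side has odd exponent and the right side
an even one. -/
theorem eq_zero_of_mul_sq_eq {x y : F} (hxy : v ϖ * v y ^ 2 = v x ^ 2) : y = 0 := by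
  by_contra hy
  have hx : x ≠ 0 := by
    rintro rfl
    simp [h.ne_zero, hy] at hxy
  obtain ⟨n, hn⟩ := h.exists_zpow x hx
  obtain ⟨m, hm⟩ := h.exists_zpow y hy
  have h1 : v ϖ * v y ^ 2 = v ϖ ^ (1 + m * 2) := by
    rw [hm, zpow_add₀ h.pos.ne', zpow_mul, zpow_one]
    norm_cast
  have h2 : v x ^ 2 = v ϖ ^ (n * 2) := by
    rw [hn, zpow_mul]
    norm_cast
  rw [h1, h2] at hxy
  have h3 := h.zpow_le_zpow.1 hxy.le
  have h4 := h.zpow_le_zpow.1 hxy.ge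
  lia

/-- If `z` were larger, `z 𝒫 ^ n` would contain `𝒫⁻¹`, in particular `x₀ / ϖ`, where `ψ₀` is not
trivial. -/
theorem le_zpow_of_forall {ψ₀ : AddChar F ℂ} {x₀ : F} (hx₀ : v x₀ ≤ 1) (hψ : ψ₀ (x₀ / ϖ) ≠ 1)
    {z : F} {n : ℤ} (hz : ∀ x, v x ≤ v ϖ ^ n → ψ₀ (z * x) = 1) : v z ≤ v ϖ ^ (-n) := by
  by_contra hlt
  have h1 := h.zpow_succ_le_of_lt hlt
  have hz0 : z ≠ 0 := by
    rintro rfl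
    simp at hlt
  have hvz : 0 < v z := zero_lt_iff.2 ((Valuation.ne_zero_iff v).2 hz0)
  apply hψ
  have h2 := hz (x₀ / ϖ / z) (by
    rw [map_div₀, map_div₀, div_le_iff₀ hvz, div_le_iff₀ h.pos]
    refine hx₀.trans ?_
    calc (1 : Γ₀) = v ϖ ^ n * v ϖ ^ (-n - 1) * v ϖ := by
          rw [← zpow_add₀ h.pos.ne', ← zpow_add_one₀ h.pos.ne',
            show n + (-n - 1) + 1 = 0 by ring, zpow_zero]
      _ ≤ v ϖ ^ n * v z * v ϖ := by gcongr)
  rwa [mul_div_cancel₀ _ hz0] at h2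

end IsUniformizer

end Uniformized

/-! ### Arithmetic of the local field: uniformizers, residue systems -/

section LocalField

variable {F : Type*} [Field F] [ValuativeRel F] [TopologicalSpace F] [IsNonarchimedeanLocalField F]

open ValuativeRel

theorem isUniformizer_of_irreducible {ϖF : 𝒪[F]} (hϖF : Irreducible ϖF) :
    IsUniformizer (valuation F) (ϖF : F) where
  ne_zero := by simpa using hϖF.ne_zero
  lt_one := Valuation.integer.v_irreducible_lt_one hϖF
  exists_zpow x hx := by
    have key : ∀ y : 𝒪[F], y ≠ 0 → ∃ n : ℕ, valuation F (y : F) = valuation F (ϖF : F) ^ n := by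
      intro y hy
      obtain ⟨n, u, hu⟩ := IsDiscreteValuationRing.eq_unit_mul_pow_irreducible hy hϖF
      refine ⟨n, ?_⟩
      have h1 : valuation F ((u : 𝒪[F]) : F) = 1 :=
        (Valuation.integer.integers (valuation F)).one_of_isUnit u.isUnit
      rw [hu]
      push_cast
      rw [map_mul, h1, one_mul, map_pow]
    by_cases hx1 : valuation F x ≤ 1
    · obtain ⟨n, hn⟩ := key ⟨x, hx1⟩ (by simpa [Subtype.ext_iff] using hx)
      exact ⟨n, by simpa using hn⟩
    · have hx1' : valuation F x⁻¹ ≤ 1 := by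
        rw [map_inv₀]
        exact inv_le_one_of_one_le₀ (not_le.1 hx1).le
      obtain ⟨n, hn⟩ := key ⟨x⁻¹, hx1'⟩ (by simpa [Subtype.ext_iff] using hx)
      refine ⟨-n, ?_⟩
      rw [zpow_neg, zpow_natCast, ← hn, map_inv₀, inv_inv]

theorem valuation_residueCard_lt_one : valuation F (residueCard F : F) < 1 := by
  have h1 : ((residueCard F : ℕ) : 𝓀[F]) = 0 := by
    have : Fintype 𝓀[F] := Fintype.ofFinite _
    rw [residueCard, Nat.card_eq_fintype_card]
    exact Nat.cast_card_eq_zero 𝓀[F]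
  have h2 : ((residueCard F : ℕ) : 𝒪[F]) ∈ IsLocalRing.maximalIdeal 𝒪[F] := by
    rw [← IsLocalRing.residue_eq_zero_iff, map_natCast, h1]
  rw [IsLocalRing.mem_maximalIdeal, mem_nonunits_iff,
    Valuation.Integer.not_isUnit_iff_valuation_lt_one] at h2
  simpa using h2

/-- The odd number `q = 2 m + 1` lies in the maximal ideal; if `2` did as well, so would `1 = q - 2
m`. -/
theorem valuation_two_eq_one (hodd : Odd (residueCard F)) : valuation F (2 : F) = 1 := by
  have hle : ∀ n : ℕ, valuation F (n : F) ≤ 1 := by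
    intro n
    have : (n : F) = ((n : 𝒪[F]) : F) := by simp
    rw [this]
    exact (n : 𝒪[F]).2
  refine le_antisymm (by simpa using hle 2) ?_
  by_contra! hlt
  obtain ⟨m, hm⟩ := hodd
  have h1 : (1 : F) = (residueCard F : F) - 2 * m := by
    rw [hm]
    push_cast
    ring
  have h2 : valuation F (1 : F) < 1 := by
    rw [h1]
    refine Valuation.map_sub_lt _ valuation_residueCard_lt_one ?_
    rw [map_mul]
    exact mul_lt_one_of_lt_of_le hlt (hle m)
  simp at h2

theorem exists_isResidueSystem {ϖF : 𝒪[F]} (hϖF : Irreducible ϖF) (n : ℕ) :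
    ∃ S : Finset F, IsResidueSystem (valuation F) (ϖF : F) n S := by
  classical
  have hdvd : ∀ x : 𝒪[F], x ∈ Ideal.span {ϖF} ^ n ↔
      valuation F (x : F) ≤ valuation F (ϖF : F) ^ n := by
    intro x
    rw [Ideal.span_singleton_pow, Ideal.mem_span_singleton,
      (Valuation.integer.integers (valuation F)).dvd_iff_le]
    change valuation F (x : F) ≤ valuation F ((ϖF ^ n : 𝒪[F]) : F) ↔ _
    push_cast
    rw [map_pow]
  have hfin : Finite (𝒪[F] ⧸ Ideal.span {ϖF} ^ n) := by
    have h1 : Finite (𝒪[F] ⧸ Ideal.span {ϖF}) := by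
      rw [← hϖF.maximalIdeal_eq]
      exact inferInstanceAs (Finite 𝓀[F])
    exact Ideal.finite_quotient_pow (Submodule.fg_span_singleton ϖF) n
  have := Fintype.ofFinite (𝒪[F] ⧸ Ideal.span {ϖF} ^ n)
  -- The zero class must be represented by `0` itself: the supports of the fixed vectors are later
  -- cut out by the exact conditions `y = 0` and `x = 0`.
  let s : 𝒪[F] ⧸ Ideal.span {ϖF} ^ n → 𝒪[F] := fun a => if a = 0 then 0 else a.out
  have hs : ∀ a, Ideal.Quotient.mk _ (s a) = a := by
    intro a
    by_cases ha : a = 0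
    · simp [s, ha]
    · simp only [s, ha, if_false]
      exact Quotient.out_eq' a
  refine ⟨Finset.univ.image fun a => ((s a : 𝒪[F]) : F), ⟨?_, ?_, ?_, ?_⟩⟩
  · exact Finset.mem_image.2 ⟨0, Finset.mem_univ _, by simp [s]⟩
  · intro x hx
    obtain ⟨a, -, rfl⟩ := Finset.mem_image.1 hx
    exact (s a).2
  · intro x hx y hy hxy
    obtain ⟨a, -, rfl⟩ := Finset.mem_image.1 hx
    obtain ⟨b, -, rfl⟩ := Finset.mem_image.1 hy
    have h1 : s a - s b ∈ Ideal.span {ϖF} ^ n := (hdvd _).2 (by push_cast; exact hxy)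
    rw [← Ideal.Quotient.eq, hs, hs] at h1
    rw [h1]
  · intro x hx
    refine ⟨_, Finset.mem_image.2 ⟨Ideal.Quotient.mk _ ⟨x, hx⟩, Finset.mem_univ _, rfl⟩, ?_⟩
    have h1 : (⟨x, hx⟩ : 𝒪[F]) - s (Ideal.Quotient.mk _ ⟨x, hx⟩) ∈ Ideal.span {ϖF} ^ n := by
      rw [← Ideal.Quotient.eq, hs]
    have := (hdvd _).1 h1
    push_cast at this
    exact this

end LocalField

end

section

open scoped Quaternion

/-! ### Quaternionic coordinates and the norm valuation of `D` -/

section Frame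

variable {F Γ₀ D : Type*} [Field F] [LinearOrderedCommGroupWithZero Γ₀] [DivisionRing D]
  [Algebra F D] {ϖ ε : F}

/-- The reduced norm, in quaternionic coordinates. -/
def nrd (e : D ≃ₐ[F] ℍ[F,ϖ,0,ε]) (x : D) : F :=
  (e x).re ^ 2 - ϖ * (e x).imI ^ 2 - ε * (e x).imJ ^ 2 + ϖ * ε * (e x).imK ^ 2

/-- The standard involution, in quaternionic coordinates. -/
def conj (e : D ≃ₐ[F] ℍ[F,ϖ,0,ε]) (x : D) : D := e.symm (star (e x))

theorem nrd_mul (e : D ≃ₐ[F] ℍ[F,ϖ,0,ε]) (x y : D) : nrd e (x * y) = nrd e x * nrd e y := by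
  simp only [nrd, map_mul, QuaternionAlgebra.re_mul, QuaternionAlgebra.imI_mul,
    QuaternionAlgebra.imJ_mul, QuaternionAlgebra.imK_mul]
  ring

theorem mul_conj (e : D ≃ₐ[F] ℍ[F,ϖ,0,ε]) (x : D) : x * conj e x = algebraMap F D (nrd e x) := by
  apply e.injective
  rw [map_mul, conj, AlgEquiv.apply_symm_apply, AlgEquiv.commutes]
  ext <;> simp [nrd, QuaternionAlgebra.algebraMap_eq] <;> ring

theorem conj_eq (e : D ≃ₐ[F] ℍ[F,ϖ,0,ε]) (x : D) :
    conj e x = algebraMap F D (2 * (e x).re) - x := by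
  apply e.injective
  rw [map_sub, conj, AlgEquiv.apply_symm_apply, AlgEquiv.commutes]
  ext <;> simp [QuaternionAlgebra.algebraMap_eq]
  ring

theorem nrd_algebraMap (e : D ≃ₐ[F] ℍ[F,ϖ,0,ε]) (a : F) : nrd e (algebraMap F D a) = a ^ 2 := by
  simp [nrd, QuaternionAlgebra.algebraMap_eq]

/-- Quaternionic coordinates on a division quaternion algebra, adapted to a uniformizer `ϖ` and a
unit `ε` which is not a square in the residue field. -/
structure IsFrame (v : Valuation F Γ₀) (e : D ≃ₐ[F] ℍ[F,ϖ,0,ε]) : Prop extends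
    IsUniformizer v ϖ where
  two : v 2 = 1
  unit : v ε = 1
  aniso : ∀ a b, v (a ^ 2 - ε * b ^ 2) = max (v a ^ 2) (v b ^ 2)

namespace IsFrame

variable {v : Valuation F Γ₀} {e : D ≃ₐ[F] ℍ[F,ϖ,0,ε]} (h : IsFrame v e)
include h

theorem two_ne_zero : (2 : F) ≠ 0 := by
  intro h0
  simpa [h0] using h.two

theorem eps_ne_zero : ε ≠ 0 := by
  intro h0
  simpa [h0] using h.unit

/-- The components in `F ⊕ F j` and in `F i ⊕ F i j` have reduced norms of even and odd valuation,
so they cannot cancel each other; inside each component `aniso` excludes cancellation. -/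
theorem v_nrd (x : D) : v (nrd e x) =
    max (max (v (e x).re ^ 2) (v (e x).imJ ^ 2))
      (max (v ϖ * v (e x).imI ^ 2) (v ϖ * v (e x).imK ^ 2)) := by
  have h1 : nrd e x = ((e x).re ^ 2 - ε * (e x).imJ ^ 2) -
      ϖ * ((e x).imI ^ 2 - ε * (e x).imK ^ 2) := by
    rw [nrd]
    ring
  have h2 := h.aniso (e x).re (e x).imJ
  have h3 : v (ϖ * ((e x).imI ^ 2 - ε * (e x).imK ^ 2)) =
      max (v ϖ * v (e x).imI ^ 2) (v ϖ * v (e x).imK ^ 2) := by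
    rw [map_mul, h.aniso, mul_max]
  rw [← h2, ← h3, h1]
  by_cases hne : v ((e x).re ^ 2 - ε * (e x).imJ ^ 2) = v (ϖ * ((e x).imI ^ 2 - ε * (e x).imK ^ 2))
  · have h4 : v (e x).imI ^ 2 = 0 ∧ v (e x).imK ^ 2 = 0 := by
      rw [h2, h3] at hne
      have key : ∀ a b, v ϖ * v b ^ 2 = v a ^ 2 → v ϖ * v b ^ 2 = 0 := by
        intro a b hab
        simp [h.eq_zero_of_mul_sq_eq hab]
      have h5 : max (v ϖ * v (e x).imI ^ 2) (v ϖ * v (e x).imK ^ 2) = 0 := by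
        rcases max_choice (v (e x).re ^ 2) (v (e x).imJ ^ 2) with h6 | h6 <;>
        rcases max_choice (v ϖ * v (e x).imI ^ 2) (v ϖ * v (e x).imK ^ 2) with h7 | h7 <;>
        rw [h6, h7] at hne <;> rw [h7] <;> exact key _ _ hne.symm
      have h8 := (le_max_left _ _).trans h5.le
      have h9 := (le_max_right _ _).trans h5.le
      simp only [le_zero_iff, mul_eq_zero, h.pos.ne', false_or] at h8 h9
      exact ⟨h8, h9⟩
    have h5 : (e x).imI ^ 2 - ε * (e x).imK ^ 2 = 0 := by
      simp only [ne_eq, OfNat.ofNat_ne_zero, not_false_eq_true, pow_eq_zero_iff, map_eq_zero] at h4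
      rw [h4.1, h4.2]
      ring
    rw [h5]
    simp
  · rw [sub_eq_add_neg, Valuation.map_add_of_distinct_val _ (by rwa [Valuation.map_neg]),
      Valuation.map_neg]

/-- The valuation of a division quaternion algebra given by the reduced norm. -/
def normVal : Valuation D Γ₀ where
  toFun x := v (nrd e x)
  map_zero' := by simp [nrd]
  map_one' := by simp [nrd]
  map_mul' x y := by rw [nrd_mul, map_mul]
  map_add_le_max' x y := by
    have sq : ∀ a b : F, v (a + b) ^ 2 ≤ max (v a ^ 2) (v b ^ 2) := by
      intro a b
      rcases le_total (v a) (v b) with hab | hab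
      · exact le_max_of_le_right (pow_le_pow_left₀ zero_le
          ((v.map_add a b).trans (max_le hab le_rfl)) 2)
      · exact le_max_of_le_left (pow_le_pow_left₀ zero_le
          ((v.map_add a b).trans (max_le le_rfl hab)) 2)
    have sqm : ∀ a b : F, v ϖ * v (a + b) ^ 2 ≤ max (v ϖ * v a ^ 2) (v ϖ * v b ^ 2) := by
      intro a b
      rw [← mul_max]
      exact mul_le_mul_right (sq a b) _
    -- Since the valuation is a maximum over coordinates, the ultrametric inequality can be checked
    -- coordinate by coordinate.
    rw [h.v_nrd x, h.v_nrd y, h.v_nrd (x + y), map_add]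
    simp only [QuaternionAlgebra.re_add, QuaternionAlgebra.imI_add, QuaternionAlgebra.imJ_add,
      QuaternionAlgebra.imK_add]
    refine max_le (max_le ?_ ?_) (max_le ?_ ?_)
    · exact (sq _ _).trans (max_le_max (by simp) (by simp))
    · exact (sq _ _).trans (max_le_max (by simp) (by simp))
    · exact (sqm _ _).trans (max_le_max (by simp) (by simp))
    · exact (sqm _ _).trans (max_le_max (by simp) (by simp))

theorem normVal_apply (x : D) : h.normVal x = v (nrd e x) := rfl

theorem normVal_eq (x : D) : h.normVal x =
    max (max (v (e x).re ^ 2) (v (e x).imJ ^ 2))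
      (max (v ϖ * v (e x).imI ^ 2) (v ϖ * v (e x).imK ^ 2)) := h.v_nrd x

theorem normVal_algebraMap (a : F) : h.normVal (algebraMap F D a) = v a ^ 2 := by
  rw [normVal_apply, nrd_algebraMap, map_pow]

theorem normVal_smul (a : F) (x : D) : h.normVal (a • x) = v a ^ 2 * h.normVal x := by
  rw [Algebra.smul_def, map_mul, normVal_algebraMap]

theorem normVal_conj (x : D) : h.normVal (conj e x) = h.normVal x := by
  simp [normVal_eq, conj]

theorem normVal_le_of_lt_one {x : D} (hx : h.normVal x < 1) : h.normVal x ≤ v ϖ :=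
  h.le_of_lt_one hx

theorem normVal_le_pow_iff {x : D} {k : ℕ} : h.normVal x ≤ v ϖ ^ k ↔
    (v (e x).re ≤ v ϖ ^ (k - k / 2) ∧ v (e x).imJ ≤ v ϖ ^ (k - k / 2)) ∧
      v (e x).imI ≤ v ϖ ^ (k / 2) ∧ v (e x).imK ≤ v ϖ ^ (k / 2) := by
  rw [normVal_eq, max_le_iff, max_le_iff, max_le_iff, h.sq_le_iff, h.sq_le_iff,
    h.mul_sq_le_iff, h.mul_sq_le_iff]

/-- For an element of valuation above one, the leading term of a monic equation dominates strictly;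
conversely, `x` is a root of its reduced characteristic polynomial `X ^ 2 - Trd(x) X + Nrd(x)`,
which is integral. -/
theorem isIntegral_iff {x : D} : IsIntegral v.integer x ↔ h.normVal x ≤ 1 := by
  have hmap : ∀ a : v.integer, algebraMap v.integer D a = algebraMap F D (a : F) := fun a => rfl
  constructor
  · rintro ⟨P, hP, hx⟩
    by_contra! hlt
    rw [Polynomial.eval₂_eq_sum_range, Finset.sum_range_succ, hP.coeff_natDegree, map_one,
      one_mul] at hx
    have h1 : x ^ P.natDegree = -∑ i ∈ Finset.range P.natDegree,
        algebraMap v.integer D (P.coeff i) * x ^ i := by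
      rw [eq_neg_iff_add_eq_zero, add_comm]
      exact hx
    have h2 : h.normVal (x ^ P.natDegree) < h.normVal (x ^ P.natDegree) := by
      conv_lhs => rw [h1, Valuation.map_neg]
      refine Valuation.map_sum_lt _ ?_ fun i hi => ?_
      · rw [map_pow]
        exact pow_ne_zero _ (zero_lt_one.trans hlt).ne'
      · rw [map_mul, map_pow, map_pow, hmap, normVal_algebraMap]
        calc v (P.coeff i : F) ^ 2 * h.normVal x ^ i ≤ 1 * h.normVal x ^ i := by
              gcongr
              exact pow_le_one₀ zero_le (P.coeff i).2
          _ = h.normVal x ^ i := one_mul _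
          _ < _ := pow_lt_pow_right₀ hlt (Finset.mem_range.1 hi)
    exact lt_irrefl _ h2
  · intro hx
    have hn : v (nrd e x) ≤ 1 := hx
    have ht : v (2 * (e x).re) ≤ 1 := by
      rw [normVal_eq] at hx
      rw [map_mul, h.two, one_mul]
      exact (pow_le_one_iff_of_nonneg zero_le (by norm_num)).1
        ((le_max_left _ _).trans ((le_max_left _ _).trans hx))
    refine ⟨Polynomial.X ^ 2 + (Polynomial.C (-(⟨_, ht⟩ : v.integer)) * Polynomial.X +
      Polynomial.C (⟨_, hn⟩ : v.integer)), ?_, ?_⟩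
    · apply Polynomial.monic_X_pow_add
      exact Polynomial.degree_linear_lt
    · have h1 := mul_conj e x
      rw [conj_eq, mul_sub, ← Algebra.commutes] at h1
      rw [Polynomial.eval₂_add, Polynomial.eval₂_add, Polynomial.eval₂_X_pow,
        Polynomial.eval₂_mul_X, Polynomial.eval₂_C, Polynomial.eval₂_C, hmap, hmap, ← h1, sq]
      rw [NegMemClass.coe_neg, map_neg]
      noncomm_ring

end IsFrame

end Frame

end

section

open scoped Quaternion
open ValuativeRel

/-! ### Recognizing the standard quaternion algebra -/

section Coordinates

variable {F D : Type*} [Field F] [DivisionRing D] [Algebra F D]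

/-- A relation would place `d` in the field `F(t)` unless its coefficients vanish; then `d` would
commute with `t`, against anticommutation. The element `z` only serves to show that `t` is not a
scalar. -/
theorem linearIndependent_quaternion (h2 : (2 : F) ≠ 0) {t d z : D} (ht : t ≠ 0) (hd : d ≠ 0)
    (hdt : t * d = -(d * t)) (hz : t * z ≠ z * t) {a b c f : F}
    (h : algebraMap F D a + b • t + c • d + f • (t * d) = 0) :
    a = 0 ∧ b = 0 ∧ c = 0 ∧ f = 0 := by
  have key : ∀ x y : F, algebraMap F D x + y • t = 0 → x = 0 ∧ y = 0 := by
    intro x y hxy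
    have hy : y = 0 := by
      by_contra hy
      apply hz
      have h1 : t = algebraMap F D (-(y⁻¹ * x)) := by
        have h3 : y • t = -algebraMap F D x := eq_neg_of_add_eq_zero_right hxy
        rw [map_neg, map_mul, ← Algebra.smul_def, ← smul_neg, ← h3, smul_smul, inv_mul_cancel₀ hy,
          one_smul]
      rw [h1]
      exact Algebra.commutes _ _
    subst hy
    rw [zero_smul, add_zero] at hxy
    exact ⟨(map_eq_zero _).1 hxy, rfl⟩
  have hct : ∀ x y : F, Commute t (algebraMap F D x + y • t) := fun x y =>
    (show Commute t (algebraMap F D x) from (Algebra.commutes x t).symm).add_right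
      ((Commute.refl t).smul_right y)
  have h1 : (algebraMap F D c + f • t) * d = -(algebraMap F D a + b • t) := by
    rw [eq_neg_iff_add_eq_zero, ← h, add_mul, Algebra.smul_mul_assoc, Algebra.smul_def c d]
    abel
  have h3 : algebraMap F D c + f • t = 0 := by
    by_contra h0
    have h4 : d = (algebraMap F D c + f • t)⁻¹ * -(algebraMap F D a + b • t) := by
      rw [← h1, inv_mul_cancel_left₀ h0]
    have h5 : t * d = d * t := by
      rw [h4]
      exact ((hct c f).inv_right₀).mul_right (hct a b).neg_right
    rw [h5, eq_neg_iff_add_eq_zero, ← two_smul F, smul_eq_zero] at hdt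
    exact hdt.elim h2 (mul_ne_zero hd ht)
  rw [h3, zero_mul, eq_comm, neg_eq_zero] at h1
  exact ⟨(key a b h1).1, (key a b h1).2, (key c f h3).1, (key c f h3).2⟩

/-- A quaternion division algebra with two anticommuting elements, the first of which has its square
in the base field, is a standard quaternion algebra. -/
theorem exists_quaternion_coordinates [Algebra.IsCentral F D] (hD : Module.finrank F D = 4)
    (h2 : (2 : F) ≠ 0) {t d z : D} {ϖ : F} (ht : t ≠ 0) (hd : d ≠ 0) (hdt : t * d = -(d * t))
    (hz : t * z ≠ z * t) (htt : t * t = algebraMap F D ϖ) :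
    ∃ (ε : F) (e : D ≃ₐ[F] ℍ[F,ϖ,0,ε]), e t = ⟨0, 1, 0, 0⟩ ∧ e d = ⟨0, 0, 1, 0⟩ ∧
      d * d = algebraMap F D ε := by
  have : FiniteDimensional F D := Module.finite_of_finrank_pos (by lia)
  -- `d ^ 2` commutes with `t` and `d`, which generate `D` by the dimension count; so it is central
  -- and hence a scalar.
  have hcomm : ∀ x, Commute (d * d) x := by
    let φ : (F × F) × (F × F) →ₗ[F] D :=
      ((Algebra.linearMap F D).coprod (LinearMap.toSpanSingleton F D t)).coprod
        ((LinearMap.toSpanSingleton F D d).coprod (LinearMap.toSpanSingleton F D (t * d)))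
    have hφ : ∀ a b c f, φ ((a, b), (c, f)) = algebraMap F D a + b • t + c • d + f • (t * d) := by
      intro a b c f
      simp [φ, add_assoc]
    have hinj : Function.Injective φ := by
      rw [injective_iff_map_eq_zero]
      rintro ⟨⟨a, b⟩, ⟨c, f⟩⟩ hx
      rw [hφ] at hx
      obtain ⟨rfl, rfl, rfl, rfl⟩ := linearIndependent_quaternion h2 ht hd hdt hz hx
      rfl
    have hsurj := (LinearMap.injective_iff_surjective_of_finrank_eq_finrank
      (by simp [hD])).1 hinj
    have hct : Commute (d * d) t := by
      have h1 : d * t = -(t * d) := by rw [hdt, neg_neg]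
      have h3 : d * d * t = t * (d * d) := by
        rw [mul_assoc, h1, mul_neg, ← mul_assoc, h1, neg_mul, neg_neg, mul_assoc]
      exact h3
    have hcd : Commute (d * d) d := (mul_assoc d d d)
    intro x
    obtain ⟨⟨⟨a, b⟩, ⟨c, f⟩⟩, rfl⟩ := hsurj x
    rw [hφ]
    exact (((show Commute (d * d) (algebraMap F D a) from
      (Algebra.commutes a (d * d)).symm).add_right (hct.smul_right b)).add_right
      (hcd.smul_right c)).add_right ((hct.mul_right hcd).smul_right f)
  obtain ⟨ε, hε⟩ : ∃ ε : F, algebraMap F D ε = d * d := by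
    have h1 : d * d ∈ Subalgebra.center F D := by
      rw [Subalgebra.mem_center_iff]
      exact fun x => (hcomm x).eq.symm
    have h3 := Algebra.IsCentral.out (K := F) (D := D) h1
    rwa [Algebra.mem_bot] at h3
  let b : QuaternionAlgebra.Basis D ϖ 0 ε :=
    { i := t
      j := d
      k := t * d
      i_mul_i := by rw [htt, zero_smul, add_zero, Algebra.algebraMap_eq_smul_one]
      j_mul_j := by rw [← hε, Algebra.algebraMap_eq_smul_one]
      i_mul_j := rfl
      j_mul_i := by rw [zero_smul, zero_sub, hdt, neg_neg] }
  have hb : ∀ x, b.liftHom x = algebraMap F D x.re + x.imI • t + x.imJ • d + x.imK • (t * d) :=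
    fun x => rfl
  have hinj : Function.Injective b.liftHom := by
    rw [injective_iff_map_eq_zero]
    intro x hx
    rw [hb] at hx
    obtain ⟨h3, h4, h5, h6⟩ := linearIndependent_quaternion h2 ht hd hdt hz hx
    ext <;> assumption
  have hbij : Function.Bijective b.liftHom := ⟨hinj,
    (LinearMap.injective_iff_surjective_of_finrank_eq_finrank (f := b.liftHom.toLinearMap)
      (by rw [hD, QuaternionAlgebra.finrank_eq_four])).1 hinj⟩
  refine ⟨ε, (AlgEquiv.ofBijective b.liftHom hbij).symm, ?_, ?_, hε.symm⟩
  · rw [AlgEquiv.symm_apply_eq, AlgEquiv.ofBijective_apply, hb]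
    simp
  · rw [AlgEquiv.symm_apply_eq, AlgEquiv.ofBijective_apply, hb]
    simp

end Coordinates

/-! ### Euler's criterion and the frame attached to `ϖ` and `ζ` -/

section LocalField

variable {F : Type*} [Field F] [ValuativeRel F] [TopologicalSpace F] [IsNonarchimedeanLocalField F]

theorem valuation_pow_residueCard_sub_one_lt_one {c : F} (hc : valuation F c = 1) :
    valuation F (c ^ (residueCard F - 1) - 1) < 1 := by
  have : Fintype 𝓀[F] := Fintype.ofFinite _
  let c' : 𝒪[F] := ⟨c, hc.le⟩
  have h0 : IsLocalRing.residue 𝒪[F] c' ≠ 0 := by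
    rw [Ne, IsLocalRing.residue_eq_zero_iff, IsLocalRing.mem_maximalIdeal, mem_nonunits_iff,
      Valuation.Integer.not_isUnit_iff_valuation_lt_one]
    exact hc.not_lt
  have h1 : c' ^ (residueCard F - 1) - 1 ∈ IsLocalRing.maximalIdeal 𝒪[F] := by
    rw [← IsLocalRing.residue_eq_zero_iff, map_sub, map_pow, map_one, residueCard,
      Nat.card_eq_fintype_card, FiniteField.pow_card_sub_one_eq_one _ h0, sub_self]
  rw [IsLocalRing.mem_maximalIdeal, mem_nonunits_iff,
    Valuation.Integer.not_isUnit_iff_valuation_lt_one] at h1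
  simpa [c'] using h1

/-- Euler's criterion: if `c ^ 2 ≡ ε` for a unit `c`, raising to the power `n = (q - 1) / 2` gives
`1 ≡ -1`, impossible since `2` is a unit. So `a ^ 2 - ε b ^ 2` is anisotropic modulo the maximal
ideal. -/
theorem valuation_sq_sub_mul_sq {n : ℕ} (hq : residueCard F = 2 * n + 1) (hn : n ≠ 0) {ε : F}
    (hε : ε ^ n = -1) (a b : F) : valuation F (a ^ 2 - ε * b ^ 2) =
      max (valuation F a ^ 2) (valuation F b ^ 2) := by
  have h2 := valuation_two_eq_one (F := F) ⟨n, hq⟩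
  have hvε : valuation F ε = 1 := by
    have h1 : valuation F ε ^ n = 1 := by rw [← map_pow, hε, Valuation.map_neg, map_one]
    exact (pow_eq_one_iff_of_nonneg zero_le hn).1 h1
  have key : ∀ c, valuation F c = 1 → valuation F (c ^ 2 - ε) = 1 := by
    intro c hc
    refine le_antisymm (Valuation.map_sub_le _ (by simp [hc]) hvε.le) ?_
    by_contra! hlt
    have h3 : valuation F ((c ^ 2) ^ n - ε ^ n) < 1 := by
      rw [← (Commute.all (c ^ 2) ε).geom_sum₂_mul, map_mul]
      refine (mul_le_of_le_one_left' (Valuation.map_sum_le _ fun i _ => ?_)).trans_lt hlt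
      simp [hc, hvε]
    have h4 := valuation_pow_residueCard_sub_one_lt_one hc
    rw [hq, Nat.add_sub_cancel] at h4
    have h5 : (2 : F) = ((c ^ 2) ^ n - ε ^ n) - (c ^ (2 * n) - 1) := by
      rw [hε]
      ring
    have h6 := Valuation.map_sub_lt _ h3 h4
    rw [← h5, h2] at h6
    exact lt_irrefl _ h6
  by_cases hab : valuation F a = valuation F b
  · rcases eq_or_ne b 0 with rfl | hb
    · simp
    · have hb' := (Valuation.ne_zero_iff (valuation F)).2 hb
      have h3 : a ^ 2 - ε * b ^ 2 = ((a / b) ^ 2 - ε) * b ^ 2 := by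
        field_simp
      rw [h3, map_mul, key _ (by rw [map_div₀, hab, div_self hb']), hab, max_self, one_mul, map_pow]
  · have h3 : valuation F (ε * b ^ 2) = valuation F b ^ 2 := by
      rw [map_mul, map_pow, hvε, one_mul]
    rw [sub_eq_add_neg, Valuation.map_add_of_distinct_val, Valuation.map_neg, h3, map_pow]
    rw [Valuation.map_neg, h3, map_pow]
    exact fun h => hab ((pow_left_inj₀ zero_le zero_le two_ne_zero).1 h)

end LocalField

section Setup

variable {F : Type*} [Field F] [ValuativeRel F] [TopologicalSpace F] [IsNonarchimedeanLocalField F]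
  {D : Type*} [DivisionRing D] [Algebra F D]

/-- Conjugation by `t` raises `ζ` to the power `q`, and `ζ ^ ((q ^ 2 - 1) / 2) = -1`; therefore `j =
ζ ^ ((q + 1) / 2)` anticommutes with `t`, and `ε = j ^ 2` satisfies `ε ^ ((q - 1) / 2) = -1`. -/
theorem exists_frame [Algebra.IsCentral F D] (hodd : Odd (residueCard F))
    (hD : Module.finrank F D = 4) {ϖF : 𝒪[F]} (hϖF : Irreducible ϖF) {t : Dˣ}
    (ht : (t : D) * t = algebraMap F D (ϖF : F)) {ζ : Dˣ}
    (hζ : orderOf ζ = residueCard F ^ 2 - 1) (htζ : t * ζ * t⁻¹ = ζ ^ residueCard F) :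
    ∃ (ε : F) (e : D ≃ₐ[F] ℍ[F,(ϖF : F),0,ε]), IsFrame (valuation F) e ∧
      e t = ⟨0, 1, 0, 0⟩ ∧ e (ζ ^ ((residueCard F + 1) / 2) : Dˣ) = ⟨0, 0, 1, 0⟩ ∧
      (∃ z₀ z₂, e ζ = ⟨z₀, 0, z₂, 0⟩ ∧ z₀ ≠ 0 ∧ z₀ ^ 2 - ε * z₂ ^ 2 = ε) ∧
      (residueCard F ≡ 1 [MOD 4] → ∃ c : F, c ^ 2 = -1) ∧
      (residueCard F ≡ 3 [MOD 4] → ∃ c : F, ε * c ^ 2 = -1) := by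
  obtain ⟨n, hq⟩ := hodd
  have hn : n ≠ 0 := by
    rintro rfl
    have : 1 < Nat.card 𝓀[F] := Finite.one_lt_card
    rw [residueCard] at hq
    lia
  have hord : orderOf ζ = 4 * n * (n + 1) := by
    rw [hζ, hq]
    apply Nat.sub_eq_of_eq_add
    ring
  have h2 : (2 : F) ≠ 0 := by
    intro h0
    simpa [h0] using valuation_two_eq_one (F := F) ⟨n, hq⟩
  have hhalf : (residueCard F + 1) / 2 = n + 1 := by lia
  have hneg : ((ζ ^ (2 * n * (n + 1)) : Dˣ) : D) = -1 := by
    have h1 : ((ζ ^ (2 * n * (n + 1)) : Dˣ) : D) ^ 2 = 1 := by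
      rw [← Units.val_pow_eq_pow_val, ← pow_mul,
        show 2 * n * (n + 1) * 2 = orderOf ζ by rw [hord]; ring, pow_orderOf_eq_one, Units.val_one]
    refine (sq_eq_one_iff.1 h1).resolve_left ?_
    intro h3
    have h4 := orderOf_dvd_of_pow_eq_one (Units.ext h3)
    have h5 := Nat.le_of_dvd (by positivity) h4
    rw [hord] at h5
    have h6 : 0 < n * (n + 1) := by positivity
    nlinarith
  have hconj : ∀ j : ℕ, t * ζ ^ j = ζ ^ (residueCard F * j) * t := by
    intro j
    rw [pow_mul, ← htζ, conj_pow, inv_mul_cancel_right]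
  have hdt : (t : D) * (ζ ^ (n + 1) : Dˣ) = -((ζ ^ (n + 1) : Dˣ) * t) := by
    rw [← Units.val_mul, hconj, hq,
      show (2 * n + 1) * (n + 1) = 2 * n * (n + 1) + (n + 1) by ring, pow_add, mul_assoc,
      Units.val_mul, hneg, Units.val_mul, neg_one_mul]
  -- Used for exponent `1`, so that `t` is not a scalar, and for exponent `2`: if `z₀ = 0`, then `ζ
  -- ^ 2 = ε z₂ ^ 2` would be central.
  have hpow_ne : ∀ j : ℕ, j ≠ 0 → j < 2 * (n + 1) → t * ζ ^ j ≠ ζ ^ j * t := by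
    intro j hj hj' h1
    rw [hconj] at h1
    have h3 : ζ ^ (2 * n * j) = 1 := by
      have h4 := mul_right_cancel h1
      rw [hq, show (2 * n + 1) * j = 2 * n * j + j by ring, pow_add] at h4
      exact mul_eq_right.1 h4
    have h5 := Nat.le_of_dvd (by positivity) (orderOf_dvd_of_pow_eq_one h3)
    rw [hord] at h5
    have : 0 < n := Nat.pos_of_ne_zero hn
    nlinarith
  have hz : (t : D) * (ζ : D) ≠ (ζ : D) * t := by
    have := hpow_ne 1 one_ne_zero (by lia)
    rw [pow_one] at this
    exact fun h => this (Units.ext h)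
  obtain ⟨ε, e, het, hed, hdd⟩ := exists_quaternion_coordinates hD h2 t.ne_zero
    (ζ ^ (n + 1) : Dˣ).ne_zero hdt hz ht
  have hεn : ε ^ n = -1 := by
    apply (algebraMap F D).injective
    rw [map_pow, ← hdd, map_neg, map_one, ← hneg, ← Units.val_mul, ← Units.val_pow_eq_pow_val,
      ← pow_add, ← pow_mul]
    congr 2
    ring
  have hε0 : ε ≠ 0 := by
    rintro rfl
    rw [zero_pow hn] at hεn
    simp at hεn
  have hframe : IsFrame (valuation F) e :=
    { isUniformizer_of_irreducible hϖF with
      two := valuation_two_eq_one ⟨n, hq⟩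
      unit := by
        have h1 : valuation F ε ^ n = 1 := by rw [← map_pow, hεn, Valuation.map_neg, map_one]
        exact (pow_eq_one_iff_of_nonneg zero_le hn).1 h1
      aniso := valuation_sq_sub_mul_sq hq hn hεn }
  refine ⟨ε, e, hframe, het, by rw [hhalf, hed], ?_, ?_, ?_⟩
  · have hcomm : e ζ * e (ζ ^ (n + 1) : Dˣ) = e (ζ ^ (n + 1) : Dˣ) * e ζ := by
      rw [← map_mul, ← map_mul, ← Units.val_mul, ← Units.val_mul, ← pow_succ, ← pow_succ']
    rw [hed] at hcomm
    have hI := congrArg QuaternionAlgebra.imI hcomm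
    have hK := congrArg QuaternionAlgebra.imK hcomm
    simp only [QuaternionAlgebra.imI_mul, QuaternionAlgebra.imK_mul] at hI hK
    have hI0 : (e (ζ : D)).imI = 0 := by
      have : 2 * (e (ζ : D)).imI = 0 := by linear_combination hK
      exact (mul_eq_zero.1 this).resolve_left h2
    have hK0 : (e (ζ : D)).imK = 0 := by
      have : 2 * ε * (e (ζ : D)).imK = 0 := by linear_combination hI
      exact (mul_eq_zero.1 this).resolve_left (mul_ne_zero h2 hε0)
    have heζ : e ζ = ⟨(e (ζ : D)).re, 0, (e (ζ : D)).imJ, 0⟩ := by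
      ext <;> simp [hI0, hK0]
    refine ⟨_, _, heζ, ?_, ?_⟩
    · intro h0
      apply hpow_ne 2 two_ne_zero (by lia)
      apply Units.ext
      apply e.injective
      push_cast
      rw [sq, map_mul, map_mul, map_mul, map_mul, het, heζ, h0]
      ext <;> simp
    -- On `F(j)` the standard involution is conjugation by `t`, so the reduced norm of `ζ` is `ζ ^
    -- (q + 1) = j ^ 2 = ε`.
    · have h1 : conj e (ζ : D) * t = (ζ ^ residueCard F : Dˣ) * (t : D) := by
        have h3 := hconj 1
        rw [mul_one, pow_one] at h3
        rw [← Units.val_mul, ← h3, Units.val_mul]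
        apply e.injective
        rw [map_mul, map_mul, het, conj, AlgEquiv.apply_symm_apply, heζ]
        ext <;> simp
      have h3 := mul_right_cancel₀ t.ne_zero h1
      have h4 := mul_conj e (ζ : D)
      rw [h3, ← Units.val_mul, ← pow_succ', hq, show 2 * n + 1 + 1 = (n + 1) + (n + 1) by ring,
        pow_add, Units.val_mul, hdd] at h4
      have h5 := (algebraMap F D).injective h4
      rw [nrd, hI0, hK0] at h5
      linear_combination -h5
  -- For even `n` the power `ε ^ (n / 2)` is a square root of `ε ^ n = -1`; for odd `n` the floor `n
  -- / 2` leaves one factor `ε` over.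
  · intro h4
    have hn2 : n = 2 * (n / 2) := by
      have := h4
      rw [hq, Nat.ModEq] at this
      lia
    exact ⟨ε ^ (n / 2), by rw [← pow_mul, mul_comm, ← hn2, hεn]⟩
  · intro h4
    have hn2 : n = 2 * (n / 2) + 1 := by
      have := h4
      rw [hq, Nat.ModEq] at this
      lia
    refine ⟨ε ^ (n / 2), ?_⟩
    rw [← pow_mul, ← pow_succ', mul_comm, ← hn2, hεn]

end Setup

end

section

open scoped Quaternion

/-! ### The decomposition `D = K ⊕ K j` and the level subgroup -/

section Parts

variable {F Γ₀ D : Type*} [Field F] [LinearOrderedCommGroupWithZero Γ₀] [DivisionRing D]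
  [Algebra F D] {ϖ ε : F}

/-- The component in `F(i)` of an element of the quaternion algebra `F(i) ⊕ F(i) j`. -/
def kPart (e : D ≃ₐ[F] ℍ[F,ϖ,0,ε]) (x : D) : D := e.symm ⟨(e x).re, (e x).imI, 0, 0⟩

/-- The coefficient of `j` of an element of the quaternion algebra `F(i) ⊕ F(i) j`. -/
def jPart (e : D ≃ₐ[F] ℍ[F,ϖ,0,ε]) (x : D) : D := e.symm ⟨(e x).imJ, (e x).imK, 0, 0⟩

variable (e : D ≃ₐ[F] ℍ[F,ϖ,0,ε])

/-- This and `jPart_mul` express `j β = conj(β) j` for `β ∈ K` together with `j ^ 2 = ε`. -/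
theorem kPart_mul (x y : D) :
    kPart e (x * y) = kPart e x * kPart e y + ε • (jPart e x * conj e (jPart e y)) := by
  apply e.injective
  simp only [kPart, jPart, conj, map_add, map_mul, map_smul, AlgEquiv.apply_symm_apply]
  ext <;> simp <;> ring

theorem jPart_mul (x y : D) :
    jPart e (x * y) = kPart e x * jPart e y + jPart e x * conj e (kPart e y) := by
  apply e.injective
  simp only [kPart, jPart, conj, map_add, map_mul, AlgEquiv.apply_symm_apply]
  ext <;> simp <;> ring

theorem kPart_sub (x y : D) : kPart e (x - y) = kPart e x - kPart e y := by
  apply e.injective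
  simp only [kPart, map_sub, AlgEquiv.apply_symm_apply]
  ext <;> simp

theorem jPart_sub (x y : D) : jPart e (x - y) = jPart e x - jPart e y := by
  apply e.injective
  simp only [jPart, map_sub, AlgEquiv.apply_symm_apply]
  ext <;> simp

theorem kPart_conj (x : D) : kPart e (conj e x) = conj e (kPart e x) := by
  apply e.injective
  simp only [kPart, conj, AlgEquiv.apply_symm_apply]
  ext <;> simp

theorem jPart_conj (x : D) : jPart e (conj e x) = -jPart e x := by
  apply e.injective
  simp only [jPart, conj, map_neg, AlgEquiv.apply_symm_apply]
  ext <;> simp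

theorem kPart_smul (a : F) (x : D) : kPart e (a • x) = a • kPart e x := by
  apply e.injective
  simp only [kPart, map_smul, AlgEquiv.apply_symm_apply]
  ext <;> simp

theorem jPart_smul (a : F) (x : D) : jPart e (a • x) = a • jPart e x := by
  apply e.injective
  simp only [jPart, map_smul, AlgEquiv.apply_symm_apply]
  ext <;> simp

theorem kPart_algebraMap (a : F) : kPart e (algebraMap F D a) = algebraMap F D a := by
  apply e.injective
  simp only [kPart, AlgEquiv.commutes, AlgEquiv.apply_symm_apply]
  ext <;> simp [QuaternionAlgebra.algebraMap_eq]

theorem jPart_algebraMap (a : F) : jPart e (algebraMap F D a) = 0 := by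
  apply e.injective
  simp only [jPart, AlgEquiv.commutes, AlgEquiv.apply_symm_apply, map_zero]
  ext <;> simp [QuaternionAlgebra.algebraMap_eq]

theorem kPart_one : kPart e 1 = 1 := by
  simpa using kPart_algebraMap e 1

theorem jPart_one : jPart e 1 = 0 := by
  simpa using jPart_algebraMap e 1

theorem jPart_kPart (x : D) : jPart e (kPart e x) = 0 := by
  apply e.injective
  simp only [jPart, kPart, AlgEquiv.apply_symm_apply, map_zero]
  rfl

theorem jPart_eq_zero_iff {x : D} : jPart e x = 0 ↔ (e x).imJ = 0 ∧ (e x).imK = 0 := by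
  rw [jPart, AlgEquiv.symm_apply_eq, map_zero, QuaternionAlgebra.ext_iff]
  simp

theorem kPart_of_jPart_eq_zero {x : D} (hx : jPart e x = 0) : kPart e x = x := by
  rw [jPart_eq_zero_iff] at hx
  apply e.injective
  rw [kPart, AlgEquiv.apply_symm_apply]
  ext <;> simp [hx]

theorem re_mul_comm (x y : D) : (e (x * y)).re = (e (y * x)).re := by
  simp only [map_mul, QuaternionAlgebra.re_mul]
  ring

end Parts

theorem mul_lt_self_of_lt_one {Γ₀ : Type*} [LinearOrderedCommGroupWithZero Γ₀] {a b : Γ₀}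
    (ha : a < 1) (hb : b ≠ 0) : a * b < b := by
  have := mul_lt_mul_of_pos_right ha (zero_lt_iff.2 hb)
  rwa [one_mul] at this

namespace IsFrame

section Level

variable {F Γ₀ D : Type*} [Field F] [LinearOrderedCommGroupWithZero Γ₀] [DivisionRing D]
  [Algebra F D] {ϖ ε : F} {v : Valuation F Γ₀} {e : D ≃ₐ[F] ℍ[F,ϖ,0,ε]} (h : IsFrame v e)
include h

theorem normVal_kPart (x : D) :
    h.normVal (kPart e x) = max (v (e x).re ^ 2) (v ϖ * v (e x).imI ^ 2) := by
  simp [normVal_eq, kPart]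

theorem normVal_jPart (x : D) :
    h.normVal (jPart e x) = max (v (e x).imJ ^ 2) (v ϖ * v (e x).imK ^ 2) := by
  simp [normVal_eq, jPart]

theorem normVal_eq_max (x : D) :
    h.normVal x = max (h.normVal (kPart e x)) (h.normVal (jPart e x)) := by
  rw [normVal_eq, normVal_kPart, normVal_jPart, max_max_max_comm]

theorem normVal_kPart_le (x : D) : h.normVal (kPart e x) ≤ h.normVal x := by
  rw [h.normVal_eq_max x]
  exact le_max_left _ _

theorem normVal_jPart_le (x : D) : h.normVal (jPart e x) ≤ h.normVal x := by
  rw [h.normVal_eq_max x]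
  exact le_max_right _ _

theorem pow_lt_one {k : ℕ} (hk : 1 ≤ k) : v ϖ ^ k < 1 :=
  pow_lt_one₀ zero_le h.lt_one (Nat.one_le_iff_ne_zero.1 hk)

theorem nrd_ne_zero {x : D} (hx : x ≠ 0) : nrd e x ≠ 0 := by
  intro h0
  apply (Valuation.ne_zero_iff h.normVal).2 hx
  rw [normVal_apply, h0, map_zero]

theorem inv_eq {x : D} (hx : x ≠ 0) : x⁻¹ = (nrd e x)⁻¹ • conj e x := by
  rw [inv_eq_iff_eq_inv, eq_comm, inv_eq_of_mul_eq_one_left]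
  rw [mul_smul_comm, mul_conj, Algebra.algebraMap_eq_smul_one, smul_smul,
    inv_mul_cancel₀ (h.nrd_ne_zero hx), one_smul]

theorem normVal_eps_smul (x : D) : h.normVal (ε • x) = h.normVal x := by
  rw [normVal_smul, h.unit, one_pow, one_mul]

theorem kPart_ne_zero_of_le {k : ℕ} {x : D} (hx : x ≠ 0)
    (hxk : h.normVal (jPart e x) ≤ v ϖ ^ k * h.normVal (kPart e x)) : kPart e x ≠ 0 := by
  intro h0
  rw [h0, map_zero, mul_zero, le_zero_iff] at hxk
  have := h.normVal_eq_max x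
  rw [h0, hxk, map_zero, max_self] at this
  exact (Valuation.ne_zero_iff _).2 hx this

/-- The error in multiplicativity of `kPart` is a product of two `j`-parts, each `k` levels down.
The resulting `2 k` is the conductor of `ψ`, which is why `ψ ∘ kPart` is a character of the level
subgroup. -/
theorem normVal_kPart_mul {k : ℕ} (hk : 1 ≤ k) {x y : D} (hx0 : x ≠ 0) (hy0 : y ≠ 0)
    (hx : h.normVal (jPart e x) ≤ v ϖ ^ k * h.normVal (kPart e x))
    (hy : h.normVal (jPart e y) ≤ v ϖ ^ k * h.normVal (kPart e y)) :
    h.normVal (kPart e (x * y) - kPart e x * kPart e y) ≤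
      v ϖ ^ (2 * k) * (h.normVal (kPart e x) * h.normVal (kPart e y)) ∧
    h.normVal (kPart e (x * y)) = h.normVal (kPart e x) * h.normVal (kPart e y) := by
  have h1 : h.normVal (kPart e (x * y) - kPart e x * kPart e y) ≤
      v ϖ ^ (2 * k) * (h.normVal (kPart e x) * h.normVal (kPart e y)) := by
    rw [kPart_mul, add_sub_cancel_left, normVal_eps_smul, map_mul, normVal_conj]
    calc _ ≤ v ϖ ^ k * h.normVal (kPart e x) * (v ϖ ^ k * h.normVal (kPart e y)) :=
          mul_le_mul' hx hy
      _ = _ := by rw [two_mul, pow_add]; ac_rfl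
  refine ⟨h1, ?_⟩
  have hne : h.normVal (kPart e x) * h.normVal (kPart e y) ≠ 0 :=
    mul_ne_zero ((Valuation.ne_zero_iff _).2 (h.kPart_ne_zero_of_le hx0 hx))
      ((Valuation.ne_zero_iff _).2 (h.kPart_ne_zero_of_le hy0 hy))
  rw [← map_mul]
  apply Valuation.map_eq_of_sub_lt
  refine h1.trans_lt ?_
  rw [map_mul]
  exact mul_lt_self_of_lt_one (h.pow_lt_one (by lia)) hne

/-- The subgroup `Eˣ (1 + 𝒫_D ^ k)` of `Dˣ`, for `E = F(i)`. -/
def levelSubgroup {k : ℕ} (hk : 1 ≤ k) : Subgroup Dˣ where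
  carrier := {g | h.normVal (jPart e (g : D)) ≤ v ϖ ^ k * h.normVal (kPart e (g : D))}
  one_mem' := by simp [jPart_one]
  mul_mem' {x y} hx hy := by
    simp only [Set.mem_ofPred_eq] at hx hy ⊢
    rw [Units.val_mul, (h.normVal_kPart_mul hk x.ne_zero y.ne_zero hx hy).2, jPart_mul]
    refine Valuation.map_add_le _ ?_ ?_
    · rw [map_mul, mul_left_comm]
      exact mul_le_mul_right hy _
    · rw [map_mul, normVal_conj, ← mul_assoc]
      exact mul_le_mul_left hx _
  inv_mem' {x} hx := by
    simp only [Set.mem_ofPred_eq] at hx ⊢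
    rw [Units.val_inv_eq_inv_val, h.inv_eq x.ne_zero, kPart_smul, jPart_smul, normVal_smul,
      normVal_smul, kPart_conj, jPart_conj, normVal_conj, Valuation.map_neg, mul_left_comm]
    exact mul_le_mul_right hx _

variable {k : ℕ} (hk : 1 ≤ k)

theorem mem_levelSubgroup {g : Dˣ} : g ∈ h.levelSubgroup hk ↔
    h.normVal (jPart e (g : D)) ≤ v ϖ ^ k * h.normVal (kPart e (g : D)) := Iff.rfl

theorem mem_levelSubgroup_of_jPart_eq_zero {g : Dˣ} (hg : jPart e (g : D) = 0) :
    g ∈ h.levelSubgroup hk := by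
  rw [mem_levelSubgroup, hg, map_zero]
  exact zero_le

theorem mem_levelSubgroup_of_close {g : Dˣ} {x : D} (hx0 : x ≠ 0) (hx : jPart e x = 0)
    (hg : h.normVal (g - x) ≤ v ϖ ^ k * h.normVal x) : g ∈ h.levelSubgroup hk := by
  have h1 : h.normVal (kPart e (g : D)) = h.normVal x := by
    conv_rhs => rw [← kPart_of_jPart_eq_zero e hx]
    apply Valuation.map_eq_of_sub_lt
    rw [← kPart_sub]
    refine ((h.normVal_kPart_le _).trans hg).trans_lt ?_
    rw [kPart_of_jPart_eq_zero e hx]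
    exact mul_lt_self_of_lt_one (h.pow_lt_one hk) ((Valuation.ne_zero_iff _).2 hx0)
  rw [mem_levelSubgroup, h1]
  have h2 := (h.normVal_jPart_le _).trans hg
  rwa [jPart_sub, hx, sub_zero] at h2

theorem mem_levelSubgroup_of_sub_one {g : Dˣ} (hg : h.normVal (g - 1) ≤ v ϖ ^ k) :
    g ∈ h.levelSubgroup hk :=
  h.mem_levelSubgroup_of_close hk one_ne_zero (jPart_one e) (by simpa using hg)

theorem kPart_ne_zero_of_mem {g : Dˣ} (hg : g ∈ h.levelSubgroup hk) : kPart e (g : D) ≠ 0 :=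
  h.kPart_ne_zero_of_le g.ne_zero hg

theorem ne_zero_of_sub_one (hk : 1 ≤ k) {x : D} (hx : h.normVal (x - 1) ≤ v ϖ ^ k) : x ≠ 0 := by
  rintro rfl
  rw [zero_sub, Valuation.map_neg, map_one] at hx
  exact (h.pow_lt_one hk).not_ge hx

end Level

end IsFrame

/-! ### The inducing character and its conjugates -/

section Datum

variable {F Γ₀ D : Type*} [Field F] [LinearOrderedCommGroupWithZero Γ₀] [DivisionRing D]
  [Algebra F D] {ϖ ε : F}

open Classical in
/-- A character of `Kˣ`, extended by zero to `D`. -/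
def extendChar (K : Subalgebra F D) (ψ : Kˣ →* ℂˣ) (x : D) : ℂ :=
  if hx : ∃ y : Kˣ, ((y : K) : D) = x then (ψ hx.choose : ℂ) else 0

theorem extendChar_coe {K : Subalgebra F D} (ψ : Kˣ →* ℂˣ) (y : Kˣ) :
    extendChar K ψ ((y : K) : D) = ψ y := by
  have hx : ∃ y' : Kˣ, ((y' : K) : D) = ((y : K) : D) := ⟨y, rfl⟩
  rw [extendChar, dif_pos hx]
  congr 2
  exact Units.ext (Subtype.ext hx.choose_spec)

/-- A unitary character `ψ` of `Kˣ`, for `K = F(i)`, trivial on `Fˣ`, given on `1 + 𝒫_K ^ k` by the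
element `c` of valuation `-2 k - 1` and the additive character `ψ₀`. -/
structure IsDatum (v : Valuation F Γ₀) (e : D ≃ₐ[F] ℍ[F,ϖ,0,ε]) (K : Subalgebra F D) (ϖK : Kˣ)
    (ψ : Kˣ →* ℂˣ) (ψ₀ : AddChar F ℂ) (c : K) (k : ℕ) : Prop where
  frame : IsFrame v e
  one_le : 1 ≤ k
  map_unif : e ((ϖK : K) : D) = ⟨0, 1, 0, 0⟩
  mem_iff : ∀ x : D, x ∈ K ↔ jPart e x = 0
  map_scalar : ∀ a : Fˣ, ψ (scalarUnits K a) = 1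
  map_eq_one : ∀ y : Kˣ, frame.normVal ((y : K) - 1 : D) ≤ v ϖ ^ (2 * k) → ψ y = 1
  map_eq : ∀ y : Kˣ, frame.normVal ((y : K) - 1 : D) ≤ v ϖ ^ k →
    (ψ y : ℂ) = ψ₀ (2 * (e (c * ((y : K) - 1 : D))).re)
  norm_map : ∀ y, ‖(ψ y : ℂ)‖ = 1
  exists_ne_one : ∃ x, v x ≤ 1 ∧ ψ₀ (x / ϖ) ≠ 1
  val_coeff : v (e (c : D)).imI = v ϖ ^ (-(k : ℤ) - 1)

namespace IsDatum

variable {v : Valuation F Γ₀} {e : D ≃ₐ[F] ℍ[F,ϖ,0,ε]} {K : Subalgebra F D} {ϖK : Kˣ}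
  {ψ : Kˣ →* ℂˣ} {ψ₀ : AddChar F ℂ} {c : K} {k : ℕ} (d : IsDatum v e K ϖK ψ ψ₀ c k)
include d

/-- The group from which the representation is induced. -/
def group : Subgroup Dˣ := d.frame.levelSubgroup d.one_le

omit d in
/-- The character from which the representation is induced. -/
def char (_ : IsDatum v e K ϖK ψ ψ₀ c k) (g : Dˣ) : ℂ := extendChar K ψ (kPart e (g : D))

theorem exists_unit {x : D} (hx0 : x ≠ 0) (hx : jPart e x = 0) : ∃ y : Kˣ, ((y : K) : D) = x := by
  have hinv : jPart e x⁻¹ = 0 := by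
    rw [d.frame.inv_eq hx0, jPart_smul, jPart_conj, hx, neg_zero, smul_zero]
  exact ⟨⟨⟨x, (d.mem_iff x).2 hx⟩, ⟨x⁻¹, (d.mem_iff _).2 hinv⟩, Subtype.ext (mul_inv_cancel₀ hx0),
    Subtype.ext (inv_mul_cancel₀ hx0)⟩, rfl⟩

theorem jPart_coe (y : K) : jPart e (y : D) = 0 := (d.mem_iff _).1 y.2

theorem exists_char_eq {g : Dˣ} (hg : g ∈ d.group) :
    ∃ y : Kˣ, ((y : K) : D) = kPart e (g : D) ∧ d.char g = ψ y := by
  obtain ⟨y, hy⟩ := d.exists_unit (d.frame.kPart_ne_zero_of_mem d.one_le hg) (jPart_kPart e _)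
  exact ⟨y, hy, by rw [char, ← hy, extendChar_coe]⟩

theorem norm_char {g : Dˣ} (hg : g ∈ d.group) : ‖d.char g‖ = 1 := by
  obtain ⟨y, -, hy⟩ := d.exists_char_eq hg
  rw [hy, d.norm_map]

theorem char_mul {g g' : Dˣ} (hg : g ∈ d.group) (hg' : g' ∈ d.group) :
    d.char (g * g') = d.char g * d.char g' := by
  obtain ⟨y, hy, hχ⟩ := d.exists_char_eq hg
  obtain ⟨y', hy', hχ'⟩ := d.exists_char_eq hg'
  obtain ⟨z, hz, hχz⟩ := d.exists_char_eq (d.group.mul_mem hg hg')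
  rw [hχ, hχ', hχz, ← Units.val_mul, ← map_mul]
  congr 1
  have h1 := (d.frame.normVal_kPart_mul d.one_le g.ne_zero g'.ne_zero hg hg').1
  rw [← Units.val_mul, ← hz, ← hy, ← hy'] at h1
  have h2 : ψ (z * (y * y')⁻¹) = 1 := by
    apply d.map_eq_one
    have h3 : ((z * (y * y')⁻¹ : Kˣ) : K) - 1 = ((z : K) - y * y') * ((y * y')⁻¹ : Kˣ) := by
      rw [sub_mul, ← Units.val_mul, ← Units.val_mul, ← Units.val_mul, mul_inv_cancel, Units.val_one]
    have h4 : (((z * (y * y')⁻¹ : Kˣ) : K) : D) - 1 =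
        (((z : K) : D) - (y : K) * (y' : K)) * (((y * y')⁻¹ : Kˣ) : K) := by
      have := congrArg (Subtype.val) h3
      simpa using this
    have h5 : d.frame.normVal ((y : K) * (y' : K) : D) *
        d.frame.normVal (((y * y')⁻¹ : Kˣ) : K) = 1 := by
      rw [← map_mul, ← map_one d.frame.normVal]
      congr 1
      have := congrArg Subtype.val (Units.mul_inv (y * y'))
      simpa using this
    rw [h4, map_mul]
    refine (mul_le_mul_left h1 _).trans ?_
    rw [← map_mul, mul_assoc, h5, mul_one]
  rw [map_mul, map_inv, mul_inv_eq_one] at h2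
  exact h2

theorem char_coe {g : Dˣ} {y : Kˣ} (hg : (g : D) = (y : K)) : d.char g = ψ y := by
  rw [char, hg, kPart_of_jPart_eq_zero e (d.jPart_coe _), extendChar_coe]

theorem char_eq_one {g : Dˣ} (hg : g ∈ d.group) {a : F}
    (ha : kPart e (g : D) = algebraMap F D a) : d.char g = 1 := by
  obtain ⟨y, hy, hχ⟩ := d.exists_char_eq hg
  have ha0 : a ≠ 0 := by
    rintro rfl
    exact d.frame.kPart_ne_zero_of_mem d.one_le hg (by rw [ha, map_zero])
  have : y = scalarUnits K (Units.mk0 a ha0) := by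
    apply Units.ext
    apply Subtype.ext
    rw [hy, ha]
    rfl
  rw [hχ, this, d.map_scalar, Units.val_one]

/-- As `c ∈ K`, the trace of `c x` sees only the `K`-part of `x`; this matches `ψ₀(Trd(c x))` with
`ψ` of the `K`-part. -/
theorem re_coeff_mul (x : D) : (e ((c : D) * x)).re =
    (e (c : D)).re * (e x).re + ϖ * (e (c : D)).imI * (e x).imI := by
  have := (jPart_eq_zero_iff e).1 (d.jPart_coe c)
  rw [map_mul, QuaternionAlgebra.re_mul, this.1, this.2]
  ring

theorem mem_group_of_sub_one {u : Dˣ} (hu : d.frame.normVal (u - 1) ≤ v ϖ ^ k) : u ∈ d.group :=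
  d.frame.mem_levelSubgroup_of_sub_one d.one_le hu

theorem char_of_sub_one {u : Dˣ} (hu : d.frame.normVal (u - 1) ≤ v ϖ ^ k) :
    d.char u = ψ₀ (2 * (e ((c : D) * (u - 1))).re) := by
  obtain ⟨y, hy, hχ⟩ := d.exists_char_eq (d.mem_group_of_sub_one hu)
  have h1 : ((y : K) : D) - 1 = kPart e ((u : D) - 1) := by
    rw [hy, kPart_sub, kPart_one]
  rw [hχ, d.map_eq y (by rw [h1]; exact (d.frame.normVal_kPart_le _).trans hu), h1,
    d.re_coeff_mul, d.re_coeff_mul]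
  simp [kPart]

/-- The factor `2` is a unit and the `i`-coordinate of `c` has valuation exactly `-k - 1`; dividing
it out shifts the bound of `le_zpow_of_forall` by `k + 1`. -/
theorem le_of_forall_coeff {z : F} {n : ℤ}
    (hz : ∀ x, v x ≤ v ϖ ^ n → ψ₀ (2 * (e (c : D)).imI * z * x) = 1) :
    v z ≤ v ϖ ^ ((k : ℤ) + 1 - n) := by
  obtain ⟨x₀, hx₀, hψ⟩ := d.exists_ne_one
  have h1 := d.frame.le_zpow_of_forall hx₀ hψ hz
  rw [map_mul, map_mul, d.frame.two, one_mul, d.val_coeff] at h1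
  have hp := d.frame.pos.ne'
  calc v z = v ϖ ^ ((k : ℤ) + 1) * (v ϖ ^ (-(k : ℤ) - 1) * v z) := by
        rw [← mul_assoc, ← zpow_add₀ hp]
        simp
    _ ≤ v ϖ ^ ((k : ℤ) + 1) * v ϖ ^ (-n) := mul_le_mul_right h1 _
    _ = _ := by rw [← zpow_add₀ hp, sub_eq_add_neg]

/-- The conjugates of the inducing character are distinct. -/
theorem exists_char_conj_ne {g : Dˣ} (hg : g ∉ d.group) :
    ∃ u ∈ d.group, g * u * g⁻¹ ∈ d.group ∧ d.char (g * u * g⁻¹) ≠ d.char u := by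
  by_contra! hcon
  apply hg
  have hp := d.frame.pos.ne'
  set t : D := ((ϖK : K) : D) with ht
  set z : D := (g⁻¹ : Dˣ) * t * g - t with hz
  -- If the two characters agree at `1 + x`, then `ψ₀ ∘ Trd` kills `(g⁻¹ c g - c) x`; the scalar
  -- part of `c` cancels, leaving its `i`-coordinate times `z`.
  have hψ : ∀ x : D, d.frame.normVal x ≤ v ϖ ^ k →
      ψ₀ (2 * (e (c : D)).imI * (e (z * x)).re) = 1 := by
    intro x hx
    have hx' : d.frame.normVal ((1 + x) - 1) ≤ v ϖ ^ k := by rwa [add_sub_cancel_left]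
    let u : Dˣ := Units.mk0 (1 + x) (d.frame.ne_zero_of_sub_one d.one_le hx')
    have hu : (u : D) - 1 = x := add_sub_cancel_left _ _
    have hgu : ((g * u * g⁻¹ : Dˣ) : D) - 1 = g * x * (g⁻¹ : Dˣ) := by
      rw [← hu, mul_sub, sub_mul, mul_one, Units.mul_inv]
      simp
    have hgu' : d.frame.normVal (((g * u * g⁻¹ : Dˣ) : D) - 1) ≤ v ϖ ^ k := by
      rw [hgu, map_mul, map_mul, mul_right_comm, ← map_mul, Units.mul_inv, map_one, one_mul]
      exact hx
    have hu' : d.frame.normVal ((u : D) - 1) ≤ v ϖ ^ k := hx'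
    have h1 := hcon u (d.mem_group_of_sub_one hu') (d.mem_group_of_sub_one hgu')
    rw [d.char_of_sub_one hu', d.char_of_sub_one hgu', hgu, hu] at h1
    have hc : (c : D) = algebraMap F D (e (c : D)).re + (e (c : D)).imI • t := by
      apply e.injective
      have := (jPart_eq_zero_iff e).1 (d.jPart_coe c)
      rw [map_add, map_smul, AlgEquiv.commutes, ht, d.map_unif]
      ext <;> simp [this, QuaternionAlgebra.algebraMap_eq]
    have h2 : (e (c * (g * x * (g⁻¹ : Dˣ)))).re = (e ((g⁻¹ : Dˣ) * c * g * x)).re := by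
      rw [← mul_assoc, re_mul_comm e _ ((g⁻¹ : Dˣ) : D)]
      simp only [mul_assoc]
    have h3 : (g⁻¹ : Dˣ) * (c : D) * g - c = (e (c : D)).imI • z := by
      conv_lhs => rw [hc]
      rw [mul_add, add_mul, ← Algebra.commutes, mul_assoc _ ((g⁻¹ : Dˣ) : D) (g : D),
        Units.inv_mul, mul_one, mul_smul_comm, smul_mul_assoc, hz, smul_sub]
      abel
    have h4 : 2 * (e (c : D)).imI * (e (z * x)).re =
        2 * (e (c * (g * x * (g⁻¹ : Dˣ)))).re - 2 * (e (c * x)).re := by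
      rw [h2, ← mul_sub, ← QuaternionAlgebra.re_sub, ← map_sub, ← sub_mul, h3, smul_mul_assoc,
        map_smul]
      simp
      ring
    rw [h4, sub_eq_add_neg, AddChar.map_add_eq_mul, h1, ← AddChar.map_add_eq_mul,
      add_neg_cancel, AddChar.map_zero_eq_one]
  have hre : (e z).re = 0 := by
    rw [hz, map_sub, QuaternionAlgebra.re_sub, mul_assoc, re_mul_comm, mul_assoc, Units.mul_inv,
      mul_one, sub_self]
  have hzpow : ∀ n : ℕ, v ϖ ^ (n : ℤ) = v ϖ ^ n := fun n => zpow_natCast _ _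
  -- Testing with `x` along `i`, `j` and `i j` bounds the three coordinates of `z`; in these
  -- directions `𝒫_D ^ k` has exponents `k / 2`, `k - k / 2` and `k / 2`. The outcome is `z ∈ 𝒫_D ^
  -- (k + 1)`.
  have hI : v (e z).imI ≤ v ϖ ^ ((k + 1) / 2) := by
    have h1 : v (ϖ * (e z).imI) ≤ v ϖ ^ ((k : ℤ) + 1 - (k / 2 : ℕ)) := by
      refine d.le_of_forall_coeff fun x hx => ?_
      rw [hzpow] at hx
      have h2 := hψ (e.symm ⟨0, x, 0, 0⟩) (by
        rw [d.frame.normVal_le_pow_iff, AlgEquiv.apply_symm_apply]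
        simpa using hx)
      rw [map_mul e z, AlgEquiv.apply_symm_apply, QuaternionAlgebra.re_mul] at h2
      rw [← h2]
      congr 1
      ring
    rw [map_mul] at h1
    rw [← hzpow, ← mul_le_mul_iff_right₀ d.frame.pos]
    refine h1.trans_eq ?_
    rw [← zpow_one_add₀ hp]
    congr 1
    lia
  have hJ : v (e z).imJ ≤ v ϖ ^ (k + 1 - (k + 1) / 2) := by
    have h1 : v (ε * (e z).imJ) ≤ v ϖ ^ ((k : ℤ) + 1 - (k - k / 2 : ℕ)) := by
      refine d.le_of_forall_coeff fun x hx => ?_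
      rw [hzpow] at hx
      have h2 := hψ (e.symm ⟨0, 0, x, 0⟩) (by
        rw [d.frame.normVal_le_pow_iff, AlgEquiv.apply_symm_apply]
        simpa using hx)
      rw [map_mul e z, AlgEquiv.apply_symm_apply, QuaternionAlgebra.re_mul] at h2
      rw [← h2]
      congr 1
      ring
    rw [map_mul, d.frame.unit, one_mul] at h1
    refine h1.trans_eq ?_
    rw [← hzpow]
    congr 1
    lia
  have hK : v (e z).imK ≤ v ϖ ^ ((k + 1) / 2) := by
    have h1 : v (-(ϖ * ε) * (e z).imK) ≤ v ϖ ^ ((k : ℤ) + 1 - (k / 2 : ℕ)) := by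
      refine d.le_of_forall_coeff fun x hx => ?_
      rw [hzpow] at hx
      have h2 := hψ (e.symm ⟨0, 0, 0, x⟩) (by
        rw [d.frame.normVal_le_pow_iff, AlgEquiv.apply_symm_apply]
        simpa using hx)
      rw [map_mul e z, AlgEquiv.apply_symm_apply, QuaternionAlgebra.re_mul] at h2
      rw [← h2]
      congr 1
      ring
    rw [map_mul, Valuation.map_neg, map_mul, d.frame.unit, mul_one] at h1
    rw [← hzpow, ← mul_le_mul_iff_right₀ d.frame.pos]
    refine h1.trans_eq ?_
    rw [← zpow_one_add₀ hp]
    congr 1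
    lia
  have hzn : d.frame.normVal z ≤ v ϖ ^ (k + 1) := by
    rw [d.frame.normVal_le_pow_iff, hre]
    exact ⟨⟨by simp, hJ⟩, hI, hK⟩
  have htt : t * t = algebraMap F D ϖ := by
    apply e.injective
    rw [map_mul, ht, d.map_unif, AlgEquiv.commutes]
    ext <;> simp [QuaternionAlgebra.algebraMap_eq]
  have hnt : d.frame.normVal t = v ϖ := by
    rw [d.frame.normVal_eq, ht, d.map_unif]
    simp
  have hnϖ : d.frame.normVal (algebraMap F D (2 * ϖ)) = v ϖ ^ 2 := by
    rw [d.frame.normVal_algebraMap, map_mul, d.frame.two, one_mul]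
  have h2ϖ : algebraMap F D (2 * ϖ) ≠ 0 := by
    rw [← Valuation.ne_zero_iff d.frame.normVal, hnϖ]
    exact pow_ne_zero _ hp
  -- With `t' = g⁻¹ t g`, the element `s = ϖ + t' t` satisfies `s t = t' s` because `t ^ 2 = t' ^ 2
  -- = ϖ`. As `s = 2 ϖ + z t` is close to a scalar, it lies in the inducing group, while `g s`
  -- centralizes `t` and so lies in `K`.
  set s : D := algebraMap F D ϖ + (g⁻¹ : Dˣ) * t * g * t with hs
  have hs2 : s - algebraMap F D (2 * ϖ) = z * t := by
    rw [hz, sub_mul, htt, hs, two_mul, map_add]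
    abel
  have hsn : d.frame.normVal (s - algebraMap F D (2 * ϖ)) ≤
      v ϖ ^ k * d.frame.normVal (algebraMap F D (2 * ϖ)) := by
    rw [hs2, map_mul, hnt, hnϖ]
    calc _ ≤ v ϖ ^ (k + 1) * v ϖ := mul_le_mul_left hzn _
      _ = _ := by rw [← pow_succ, ← pow_add]
  have hs0 : s ≠ 0 := by
    intro h0
    rw [h0, zero_sub, Valuation.map_neg] at hsn
    exact (mul_lt_self_of_lt_one (d.frame.pow_lt_one d.one_le)
      ((Valuation.ne_zero_iff _).2 h2ϖ)).not_ge hsn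
  have hsH : Units.mk0 s hs0 ∈ d.group :=
    d.frame.mem_levelSubgroup_of_close d.one_le h2ϖ (jPart_algebraMap e _) hsn
  have hcomm : (g * s) * t = t * (g * s) := by
    have h1 : s * t = (g⁻¹ : Dˣ) * t * g * s := by
      have h2 : (g⁻¹ : Dˣ) * t * g * ((g⁻¹ : Dˣ) * t * g * t) = algebraMap F D ϖ * t := by
        calc _ = (g⁻¹ : Dˣ) * t * ((g : D) * (g⁻¹ : Dˣ)) * t * g * t := by simp only [mul_assoc]
          _ = (g⁻¹ : Dˣ) * (t * t) * g * t := by rw [Units.mul_inv, mul_one]; simp only [mul_assoc]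
          _ = _ := by
            rw [htt, ← Algebra.commutes, mul_assoc _ ((g⁻¹ : Dˣ) : D) (g : D), Units.inv_mul,
              mul_one]
      rw [hs, add_mul, mul_add, h2, mul_assoc _ t t, htt, ← Algebra.commutes, add_comm]
    rw [mul_assoc, h1, ← mul_assoc, ← mul_assoc, ← mul_assoc, Units.mul_inv, one_mul, mul_assoc]
  have hgs : jPart e ((g * Units.mk0 s hs0 : Dˣ) : D) = 0 := by
    rw [Units.val_mul, Units.val_mk0, jPart_eq_zero_iff]
    have h1 := congrArg e hcomm
    rw [map_mul e _ t, map_mul e t, ht, d.map_unif] at h1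
    have hK := congrArg QuaternionAlgebra.imK h1
    have hJ := congrArg QuaternionAlgebra.imJ h1
    simp only [QuaternionAlgebra.imJ_mul, QuaternionAlgebra.imK_mul] at hJ hK
    constructor
    · have : 2 * (e (g * s : D)).imJ = 0 := by linear_combination -hK
      exact (mul_eq_zero.1 this).resolve_left d.frame.two_ne_zero
    · have : 2 * ϖ * (e (g * s : D)).imK = 0 := by linear_combination -hJ
      exact (mul_eq_zero.1 this).resolve_left (mul_ne_zero d.frame.two_ne_zero d.frame.ne_zero)
  have := d.group.mul_mem (d.frame.mem_levelSubgroup_of_jPart_eq_zero d.one_le hgs)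
    (d.group.inv_mem hsH)
  rwa [mul_inv_cancel_right] at this

end IsDatum

end Datum

end

section

open scoped Quaternion

/-! ### Conjugacy under the inducing group and fixed vectors of tori -/

section Conjugation

variable {F Γ₀ D : Type*} [Field F] [LinearOrderedCommGroupWithZero Γ₀] [DivisionRing D]
  [Algebra F D] {ϖ ε : F}

/-- `T` is the group of units of the quadratic subfield `F(X)`. -/
def IsTorus (T : Subgroup Dˣ) (X : D) (F : Type*) [Field F] [Algebra F D] : Prop :=
  ∀ t : Dˣ, t ∈ T ↔ ∃ a b : F, (t : D) = algebraMap F D a + b • X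

/-- Commuting means that the two-by-two minors of the imaginary parts of `g` and `X` vanish, so
these vectors are proportional. -/
theorem IsFrame.exists_eq_of_commute {v : Valuation F Γ₀} {e : D ≃ₐ[F] ℍ[F,ϖ,0,ε]}
    (h : IsFrame v e) {X g : D} (hX0 : X ≠ 0) (hX : (e X).re = 0) (hg : g * X = X * g) :
    ∃ a b : F, g = algebraMap F D a + b • X := by
  have h1 := congrArg e hg
  rw [map_mul, map_mul] at h1
  have hI := congrArg QuaternionAlgebra.imI h1
  have hJ := congrArg QuaternionAlgebra.imJ h1
  have hK := congrArg QuaternionAlgebra.imK h1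
  simp only [QuaternionAlgebra.imI_mul, QuaternionAlgebra.imJ_mul, QuaternionAlgebra.imK_mul]
    at hI hJ hK
  have hI' : (e g).imJ * (e X).imK = (e g).imK * (e X).imJ := by
    apply mul_left_cancel₀ (mul_ne_zero h.two_ne_zero h.eps_ne_zero)
    linear_combination -hI
  have hJ' : (e g).imI * (e X).imK = (e g).imK * (e X).imI := by
    apply mul_left_cancel₀ (mul_ne_zero h.two_ne_zero h.ne_zero)
    linear_combination hJ
  have hK' : (e g).imI * (e X).imJ = (e g).imJ * (e X).imI := by
    apply mul_left_cancel₀ h.two_ne_zero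
    linear_combination hK
  have key : ∀ b : F, (e g).imI = b * (e X).imI → (e g).imJ = b * (e X).imJ →
      (e g).imK = b * (e X).imK → ∃ a b : F, g = algebraMap F D a + b • X := by
    intro b h2 h3 h4
    refine ⟨(e g).re, b, e.injective ?_⟩
    rw [map_add, map_smul, AlgEquiv.commutes]
    ext <;> simp [QuaternionAlgebra.algebraMap_eq, hX, h2, h3, h4]
  by_cases h2 : (e X).imI = 0
  · by_cases h3 : (e X).imJ = 0
    · have h4 : (e X).imK ≠ 0 := by
        intro h4
        apply hX0
        apply e.injective
        rw [map_zero]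
        ext <;> simp [hX, h2, h3, h4]
      exact key ((e g).imK / (e X).imK) (by field_simp; linear_combination hJ')
        (by field_simp; linear_combination hI') (by field_simp)
    · exact key ((e g).imJ / (e X).imJ) (by field_simp; linear_combination hK')
        (by field_simp) (by field_simp; linear_combination -hI')
  · exact key ((e g).imI / (e X).imI) (by field_simp) (by field_simp; linear_combination -hK')
      (by field_simp; linear_combination -hJ')

namespace IsDatum

variable {v : Valuation F Γ₀} {e : D ≃ₐ[F] ℍ[F,ϖ,0,ε]} {K : Subalgebra F D} {ϖK : Kˣ}
  {ψ : Kˣ →* ℂˣ} {ψ₀ : AddChar F ℂ} {c : K} {k : ℕ} (d : IsDatum v e K ϖK ψ ψ₀ c k)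
include d

/-- Since `Y ^ 2 = Z ^ 2 = s`, the element `s + Z Y` intertwines `Y` and `Z`. Its `j`-part is
governed by the small `K`-part of `Z`, and its `K`-part by `jPart Z + jPart Y`, which `hle` keeps
from being small. -/
theorem exists_mul_eq_of_le {Y Z : D} {s : F} (hs : s ≠ 0) (hY : kPart e Y = 0)
    (hYY : Y * Y = algebraMap F D s) (hZZ : Z * Z = algebraMap F D s)
    (hZ : d.frame.normVal (kPart e Z) ≤ v ϖ ^ k * d.frame.normVal Y)
    (hle : d.frame.normVal Y ≤ d.frame.normVal (jPart e Z + jPart e Y)) :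
    ∃ h ∈ d.group, (h : D) * Y = Z * h := by
  have hY0 : Y ≠ 0 := by
    rintro rfl
    rw [mul_zero, eq_comm, map_eq_zero] at hYY
    exact hs hYY
  have hnY : d.frame.normVal (jPart e Y) = d.frame.normVal Y := by
    rw [d.frame.normVal_eq_max Y, hY, map_zero, max_eq_right zero_le]
  set s' : D := algebraMap F D s + Z * Y with hs'
  have hk : kPart e s' = ε • ((jPart e Z + jPart e Y) * conj e (jPart e Y)) := by
    have h1 : algebraMap F D s = kPart e (Y * Y) := by rw [hYY, kPart_algebraMap]
    have h2 : s' = algebraMap F D s - -(Z * Y) := by rw [hs', sub_neg_eq_add]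
    rw [h2, kPart_sub, kPart_algebraMap, h1, ← neg_one_smul F, kPart_smul, kPart_mul, kPart_mul, hY,
      mul_zero, mul_zero, zero_add, zero_add, add_mul, smul_add, neg_one_smul, sub_neg_eq_add,
      add_comm]
  have hj : jPart e s' = kPart e Z * jPart e Y := by
    have h2 : s' = algebraMap F D s - -(Z * Y) := by rw [hs', sub_neg_eq_add]
    rw [h2, jPart_sub, jPart_algebraMap, ← neg_one_smul F, jPart_smul, jPart_mul, hY]
    simp [conj]
  have hnk : d.frame.normVal (kPart e s') =
      d.frame.normVal (jPart e Z + jPart e Y) * d.frame.normVal Y := by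
    rw [hk, d.frame.normVal_eps_smul, map_mul, d.frame.normVal_conj, hnY]
  have hs0 : s' ≠ 0 := by
    intro h0
    have hY1 : 0 < d.frame.normVal Y := zero_lt_iff.2 ((Valuation.ne_zero_iff _).2 hY0)
    have : d.frame.normVal (kPart e s') ≤ 0 := by
      refine (d.frame.normVal_kPart_le _).trans ?_
      rw [h0, map_zero]
    rw [hnk] at this
    exact this.not_gt (mul_pos (hY1.trans_le hle) hY1)
  refine ⟨Units.mk0 s' hs0, ?_, ?_⟩
  · change d.frame.normVal (jPart e s') ≤ v ϖ ^ k * d.frame.normVal (kPart e s')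
    rw [hnk, hj, map_mul, hnY, ← mul_assoc]
    exact mul_le_mul_left (hZ.trans (mul_le_mul_right hle _)) _
  · rw [Units.val_mk0, hs', add_mul, mul_add, mul_assoc, hYY, ← mul_assoc, hZZ, add_comm]

/-- An element with the same square as `Y ∈ F(i) j`, which is close to `F(i) j`, is conjugate to `Y`
by the inducing subgroup. -/
theorem exists_mul_eq {Y Z : D} {s : F} (hs : s ≠ 0) (hY : kPart e Y = 0)
    (hYY : Y * Y = algebraMap F D s) (hZZ : Z * Z = algebraMap F D s)
    (hZ : d.frame.normVal (kPart e Z) ≤ v ϖ ^ k * d.frame.normVal Y) :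
    ∃ h ∈ d.group, (h : D) * Y = Z * h := by
  by_cases hle : d.frame.normVal Y ≤ d.frame.normVal (jPart e Z + jPart e Y)
  · exact d.exists_mul_eq_of_le hs hY hYY hZZ hZ hle
  have hnY : d.frame.normVal (jPart e Y) = d.frame.normVal Y := by
    rw [d.frame.normVal_eq_max Y, hY, map_zero, max_eq_right zero_le]
  set t : Dˣ := unitsIncl K ϖK with ht
  have htD : (t : D) = ((ϖK : K) : D) := rfl
  -- Conjugation by `i`, itself in the inducing group, negates the `j`-part of `Z`. The sums for `Z`
  -- and `Z'` add up to `2 jPart Y`, so they cannot both be small.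
  set Z' : D := t * Z * (t⁻¹ : Dˣ) with hZ'
  have htZ : e Z' = ⟨(e Z).re, (e Z).imI, -(e Z).imJ, -(e Z).imK⟩ := by
    have h1 : Z' = e.symm ⟨(e Z).re, (e Z).imI, -(e Z).imJ, -(e Z).imK⟩ := by
      rw [hZ', Units.mul_inv_eq_iff_eq_mul]
      apply e.injective
      rw [map_mul, map_mul, htD, d.map_unif, AlgEquiv.apply_symm_apply]
      ext <;> simp
    rw [h1, AlgEquiv.apply_symm_apply]
  have hk : kPart e Z' = kPart e Z := by rw [kPart, htZ, kPart]
  have hj : jPart e Z' = -jPart e Z := by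
    apply e.injective
    rw [jPart, htZ, jPart, AlgEquiv.apply_symm_apply, map_neg, AlgEquiv.apply_symm_apply]
    ext <;> simp
  have hZZ' : Z' * Z' = algebraMap F D s := by
    calc Z' * Z' = t * (Z * ((t⁻¹ : Dˣ) * t) * Z) * (t⁻¹ : Dˣ) := by
          rw [hZ']
          simp only [mul_assoc]
      _ = _ := by
        rw [Units.inv_mul, mul_one, hZZ, ← Algebra.commutes, mul_assoc, Units.mul_inv, mul_one]
  have hle' : d.frame.normVal Y ≤ d.frame.normVal (jPart e Z' + jPart e Y) := by
    by_contra hlt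
    rw [not_le] at hle hlt
    have h1 := Valuation.map_add_lt _ hle hlt
    have h2 : jPart e Z + jPart e Y + (jPart e Z' + jPart e Y) = (2 : F) • jPart e Y := by
      rw [hj, two_smul]
      abel
    rw [h2, d.frame.normVal_smul, d.frame.two, one_pow, one_mul, hnY] at h1
    exact lt_irrefl _ h1
  obtain ⟨h, hh, hhY⟩ := d.exists_mul_eq_of_le hs hY hYY hZZ' (by rwa [hk]) hle'
  have htH : t ∈ d.group := by
    apply d.frame.mem_levelSubgroup_of_jPart_eq_zero
    rw [htD]
    exact d.jPart_coe _
  refine ⟨t⁻¹ * h, d.group.mul_mem (d.group.inv_mem htH) hh, ?_⟩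
  rw [Units.val_mul, mul_assoc, hhY, hZ']
  simp only [← mul_assoc]
  rw [Units.inv_mul, one_mul]

section Model

variable {V : Type*} [AddCommGroup V] [Module ℂ V] {π : Representation ℂ Dˣ V}
  {ι : V →ₗ[ℂ] (Dˣ → ℂ)} (hι : IsInducedModel π d.group d.char ι) {T : Subgroup Dˣ} {X : D}
  (hT : IsTorus T X F) (hX : (e X).re = 0) {s : F} (hs : s ≠ 0) (hXX : X * X = algebraMap F D s)
  {j n : ℕ} (hnX : d.frame.normVal X = v ϖ ^ j) (hnk : n ≤ k) (hkn : k ≤ 2 * n + j)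
include hι hT hX hnX hnk hkn

/-- For `x ∈ 𝒫 ^ n` the element `1 + x X` of `T` lies in `1 + 𝒫_D ^ k`, as `2 n + j ≥ k`. At a point
`g` of the support the inducing character is therefore trivial on `1 + x g X g⁻¹`, and it reads off
the `i`-coordinate. -/
theorem val_imI_le_of_ne_zero {w : V} (hw : w ∈ fixedVectors π T) {g : Dˣ} (hg : ι w g ≠ 0) :
    v (e (g * X * (g⁻¹ : Dˣ))).imI ≤ v ϖ ^ (k - n) := by
  have h1 : v (ϖ * (e (g * X * (g⁻¹ : Dˣ))).imI) ≤ v ϖ ^ ((k : ℤ) + 1 - n) := by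
    refine d.le_of_forall_coeff fun x hx => ?_
    have hxX : d.frame.normVal ((1 + x • X) - 1) ≤ v ϖ ^ k := by
      rw [add_sub_cancel_left, d.frame.normVal_smul, hnX]
      rw [zpow_natCast] at hx
      calc _ ≤ (v ϖ ^ n) ^ 2 * v ϖ ^ j := mul_le_mul_left (pow_le_pow_left₀ zero_le hx 2) _
        _ = v ϖ ^ (2 * n + j) := by rw [← pow_mul, ← pow_add, mul_comm n]
        _ ≤ _ := d.frame.pow_le_pow.2 hkn
    set t : Dˣ := Units.mk0 _ (d.frame.ne_zero_of_sub_one d.one_le hxX)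
    have ht : t ∈ T := (hT t).2 ⟨1, x, by rw [map_one]; rfl⟩
    have htD : (t : D) - 1 = x • X := add_sub_cancel_left _ _
    have huD : ((g * t * g⁻¹ : Dˣ) : D) - 1 = x • (g * X * (g⁻¹ : Dˣ)) := by
      have : x • (g * X * (g⁻¹ : Dˣ)) = g * (x • X) * (g⁻¹ : Dˣ) := by
        rw [mul_smul_comm, smul_mul_assoc]
      rw [this, ← htD, mul_sub, sub_mul, mul_one, Units.mul_inv]
      simp
    have hu : d.frame.normVal (((g * t * g⁻¹ : Dˣ) : D) - 1) ≤ v ϖ ^ k := by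
      rw [huD, d.frame.normVal_smul, map_mul, map_mul, mul_right_comm (d.frame.normVal (g : D)),
        ← map_mul, Units.mul_inv, map_one, one_mul, ← d.frame.normVal_smul, ← htD]
      exact hxX
    have h2 := hι.equivariant w _ (d.mem_group_of_sub_one hu) g
    rw [inv_mul_cancel_right, ← hι.action, mem_fixedVectors.1 hw t ht] at h2
    have h3 : d.char (g * t * g⁻¹) = 1 := by
      apply mul_right_cancel₀ hg
      rw [one_mul, ← h2]
    rw [d.char_of_sub_one hu, huD, d.re_coeff_mul, map_smul] at h3
    have h4 : (e (g * X * (g⁻¹ : Dˣ))).re = 0 := by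
      rw [re_mul_comm, ← mul_assoc, Units.inv_mul, one_mul, hX]
    rw [← h3, QuaternionAlgebra.re_smul, QuaternionAlgebra.imI_smul, h4]
    congr 1
    simp only [smul_eq_mul]
    ring
  rw [map_mul] at h1
  rw [← zpow_natCast, ← mul_le_mul_iff_right₀ d.frame.pos]
  refine h1.trans_eq ?_
  rw [← zpow_one_add₀ d.frame.pos.ne']
  congr 1
  lia

include hs hXX

/-- `hkj` converts the bound on the `i`-coordinate into closeness to `F(i) j` at level `k` relative
to `Y`. Then `g X g⁻¹ = h Y h⁻¹`, and `g₀⁻¹ h⁻¹ g` centralizes `X`, so it belongs to `T`. -/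
theorem exists_eq_mul_of_ne_zero {Y : D} (hY : kPart e Y = 0) (hYY : Y * Y = algebraMap F D s)
    {g₀ : Dˣ} (hg₀ : g₀ * X = Y * g₀) (hkj : k + j ≤ 2 * (k - n) + 1) {w : V}
    (hw : w ∈ fixedVectors π T) {g : Dˣ} (hg : ι w g ≠ 0) :
    ∃ h ∈ d.group, ∃ t ∈ T, g = h * g₀ * t := by
  have h1 := d.val_imI_le_of_ne_zero hι hT hX hnX hnk hkn hw hg
  set Z : D := g * X * (g⁻¹ : Dˣ) with hZ
  have hZre : (e Z).re = 0 := by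
    rw [hZ, re_mul_comm, ← mul_assoc, Units.inv_mul, one_mul, hX]
  have hZZ : Z * Z = algebraMap F D s := by
    calc Z * Z = g * (X * ((g⁻¹ : Dˣ) * g) * X) * (g⁻¹ : Dˣ) := by
          rw [hZ]
          simp only [mul_assoc]
      _ = _ := by
        rw [Units.inv_mul, mul_one, hXX, ← Algebra.commutes, mul_assoc, Units.mul_inv, mul_one]
  have hnY : d.frame.normVal Y = v ϖ ^ j := by
    have h2 : Y = g₀ * X * (g₀⁻¹ : Dˣ) := by rw [hg₀, mul_assoc, Units.mul_inv, mul_one]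
    rw [h2, map_mul, map_mul, mul_right_comm, ← map_mul, Units.mul_inv, map_one, one_mul, hnX]
  obtain ⟨h, hh, hhY⟩ := d.exists_mul_eq hs hY hYY hZZ (by
    rw [d.frame.normVal_kPart, hZre, hnY, map_zero, zero_pow two_ne_zero, max_eq_right zero_le]
    calc v ϖ * v (e Z).imI ^ 2 ≤ v ϖ * (v ϖ ^ (k - n)) ^ 2 :=
          mul_le_mul_right (pow_le_pow_left₀ zero_le h1 2) _
      _ = v ϖ ^ (2 * (k - n) + 1) := by rw [← pow_mul, ← pow_succ', mul_comm]
      _ ≤ v ϖ ^ (k + j) := d.frame.pow_le_pow.2 hkj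
      _ = _ := pow_add _ _ _)
  have hX0 : X ≠ 0 := by
    rintro rfl
    rw [mul_zero, eq_comm, map_eq_zero] at hXX
    exact hs hXX
  refine ⟨h, hh, g₀⁻¹ * h⁻¹ * g, ?_, by group⟩
  rw [hT]
  apply d.frame.exists_eq_of_commute hX0 hX
  have h2 : (g : D) * X = Z * g := by rw [hZ, mul_assoc, Units.inv_mul, mul_one]
  have h3 : ((h⁻¹ : Dˣ) : D) * Z = Y * (h⁻¹ : Dˣ) := by
    rw [Units.inv_mul_eq_iff_eq_mul, ← mul_assoc, hhY, mul_assoc, Units.mul_inv, mul_one]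
  have h4 : ((g₀⁻¹ : Dˣ) : D) * Y = X * (g₀⁻¹ : Dˣ) := by
    rw [Units.inv_mul_eq_iff_eq_mul, ← mul_assoc, hg₀, mul_assoc, Units.mul_inv, mul_one]
  rw [Units.val_mul, Units.val_mul, mul_assoc, h2, mul_assoc, ← mul_assoc _ Z, h3, ← mul_assoc, ← mul_assoc, h4]
  simp only [mul_assoc]

/-- The vectors fixed by a torus conjugate to a torus `F(Y)ˣ` with `Y ∈ F(i) j`. -/
theorem exists_fixed_generator {Y : D} (hY : kPart e Y = 0) (hYY : Y * Y = algebraMap F D s)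
    {g₀ : Dˣ} (hg₀ : g₀ * X = Y * g₀) (hkj : k + j ≤ 2 * (k - n) + 1) :
    ∃ v₀ ∈ fixedVectors π T, (∀ h ∈ d.group, ∀ t ∈ T, ι v₀ (h * g₀ * t) = d.char h) ∧
      (∀ g, ι v₀ g ≠ 0 → ∃ h ∈ d.group, ∃ t ∈ T, g = h * g₀ * t) ∧
      ∀ w ∈ fixedVectors π T, ∃ a : ℂ, w = a • v₀ := by
  refine hι.exists_fixed_generator ?_ fun w hw g hg =>
    d.exists_eq_mul_of_ne_zero hι hT hX hs hXX hnX hnk hkn hY hYY hg₀ hkj hw hg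
  intro t ht hmem
  obtain ⟨a, b, hab⟩ := (hT t).1 ht
  refine d.char_eq_one hmem (a := a) ?_
  have h1 : ((g₀ * t * g₀⁻¹ : Dˣ) : D) = algebraMap F D a - (-b) • Y := by
    rw [Units.val_mul, Units.val_mul, hab, mul_add, ← Algebra.commutes, mul_smul_comm, hg₀, add_mul, mul_assoc, Units.mul_inv,
      mul_one, smul_mul_assoc, mul_assoc, Units.mul_inv, mul_one, neg_smul, sub_neg_eq_add]
  rw [h1, kPart_sub, kPart_algebraMap, kPart_smul, hY, smul_zero, sub_zero]

omit hs hnk hkn in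
/-- A ramified torus without fixed vectors. -/
theorem eq_zero_of_mem_fixedVectors (hj : j = 1) (hnk : n < k) (hkn : k ≤ 2 * n + 1) {σ : F}
    (hsσ : s = ϖ * σ) (hσ : ∀ x, 1 ≤ v (σ + ε * x ^ 2)) {w : V} (hw : w ∈ fixedVectors π T) :
    w = 0 := by
  subst hj
  apply hι.injective
  rw [map_zero]
  funext g
  by_contra hg
  have h1 := d.val_imI_le_of_ne_zero hι hT hX hnX hnk.le hkn hw hg
  set Z : D := g * X * (g⁻¹ : Dˣ) with hZ
  have hZre : (e Z).re = 0 := by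
    rw [hZ, re_mul_comm, ← mul_assoc, Units.inv_mul, one_mul, hX]
  have hZZ : Z * Z = algebraMap F D s := by
    calc Z * Z = g * (X * ((g⁻¹ : Dˣ) * g) * X) * (g⁻¹ : Dˣ) := by
          rw [hZ]
          simp only [mul_assoc]
      _ = _ := by
        rw [Units.inv_mul, mul_one, hXX, ← Algebra.commutes, mul_assoc, Units.mul_inv, mul_one]
  have hnZ : d.frame.normVal Z ≤ v ϖ ^ 1 := by
    rw [hZ, map_mul, map_mul, mul_right_comm, ← map_mul, Units.mul_inv, map_one, one_mul, hnX]
  have hJ := ((d.frame.normVal_le_pow_iff).1 hnZ).1.2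
  have hI : v (e Z).imI < 1 := h1.trans_lt (d.frame.pow_lt_one (by lia))
  have hre := congrArg (fun x => (e x).re) hZZ
  simp only [map_mul, QuaternionAlgebra.re_mul, AlgEquiv.commutes, hZre,
    QuaternionAlgebra.algebraMap_eq] at hre
  -- The scalar part of `Z ^ 2 = ϖ σ`, divided by `ϖ`. Both terms on the right lie in the maximal
  -- ideal, which contradicts `hσ` at `x = (e Z).imK`.
  have h2 : σ + ε * (e Z).imK ^ 2 = (e Z).imI ^ 2 + ε * (e Z).imJ ^ 2 / ϖ := by
    rw [eq_comm, ← sub_eq_iff_eq_add', ← mul_right_inj' d.frame.ne_zero, mul_sub, mul_add,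
      mul_div_cancel₀ _ d.frame.ne_zero]
    linear_combination hre + hsσ
  refine (hσ (e Z).imK).not_gt ?_
  rw [h2]
  refine Valuation.map_add_lt _ ?_ ?_
  · rw [map_pow]
    exact pow_lt_one₀ zero_le hI two_ne_zero
  · rw [map_div₀, map_mul, map_pow, d.frame.unit, one_mul, div_lt_one₀ d.frame.pos]
    calc v (e Z).imJ ^ 2 ≤ (v ϖ ^ 1) ^ 2 := pow_le_pow_left₀ zero_le (by simpa using hJ) 2
      _ = v ϖ * v ϖ := by rw [pow_one, sq]
      _ < v ϖ := mul_lt_self_of_lt_one d.frame.lt_one d.frame.pos.ne'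

end Model

end IsDatum

end Conjugation

end

section

open scoped Quaternion

/-! ### Coset representatives: the projective line over `𝒪_K / 𝒫_K ^ k` -/

section Representatives

variable {F Γ₀ D : Type*} [Field F] [LinearOrderedCommGroupWithZero Γ₀] [DivisionRing D]
  [Algebra F D] {ϖ ε : F}

/-- The element `1 + (x + y i) j`, as a unit. -/
def baseUnit (e : D ≃ₐ[F] ℍ[F,ϖ,0,ε]) (x y : F) : Dˣ :=
  Units.mk0 (e.symm ⟨1, 0, x, y⟩) fun h0 => by
    have := congrArg (fun z => (e z).re) h0
    simp at this

/-- The element `j`, as a unit. -/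
def jUnit (e : D ≃ₐ[F] ℍ[F,ϖ,0,ε]) : Dˣ :=
  Units.mk0 (e.symm ⟨0, 0, 1, 0⟩) fun h0 => by
    have := congrArg (fun z => (e z).imJ) h0
    simp at this

/-- The elements `1 + (x + y i) j` and `(1 + (x + y i) j) j`. -/
def repUnit (e : D ≃ₐ[F] ℍ[F,ϖ,0,ε]) (p : (F × Bool) × F) : Dˣ :=
  baseUnit e p.1.1 p.2 * (if p.1.2 then jUnit e else 1)

theorem map_baseUnit (e : D ≃ₐ[F] ℍ[F,ϖ,0,ε]) (x y : F) :
    e (baseUnit e x y : D) = ⟨1, 0, x, y⟩ := by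
  rw [baseUnit, Units.val_mk0, AlgEquiv.apply_symm_apply]

theorem map_jUnit (e : D ≃ₐ[F] ℍ[F,ϖ,0,ε]) : e (jUnit e : D) = ⟨0, 0, 1, 0⟩ := by
  rw [jUnit, Units.val_mk0, AlgEquiv.apply_symm_apply]

theorem kPart_baseUnit (e : D ≃ₐ[F] ℍ[F,ϖ,0,ε]) (x y : F) : kPart e (baseUnit e x y : D) = 1 := by
  apply e.injective
  rw [kPart, map_baseUnit, AlgEquiv.apply_symm_apply, map_one]
  rfl

theorem map_jPart_baseUnit (e : D ≃ₐ[F] ℍ[F,ϖ,0,ε]) (x y : F) :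
    e (jPart e (baseUnit e x y : D)) = ⟨x, y, 0, 0⟩ := by
  rw [jPart, map_baseUnit, AlgEquiv.apply_symm_apply]

theorem kPart_jUnit (e : D ≃ₐ[F] ℍ[F,ϖ,0,ε]) : kPart e (jUnit e : D) = 0 := by
  apply e.injective
  rw [kPart, map_jUnit, AlgEquiv.apply_symm_apply, map_zero]
  rfl

theorem jPart_jUnit (e : D ≃ₐ[F] ℍ[F,ϖ,0,ε]) : jPart e (jUnit e : D) = 1 := by
  apply e.injective
  rw [jPart, map_jUnit, AlgEquiv.apply_symm_apply, map_one]
  rfl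

theorem jPart_jPart (e : D ≃ₐ[F] ℍ[F,ϖ,0,ε]) (x : D) : jPart e (jPart e x) = 0 := by
  rw [jPart_eq_zero_iff, jPart, AlgEquiv.apply_symm_apply]
  exact ⟨rfl, rfl⟩

theorem conj_one (e : D ≃ₐ[F] ℍ[F,ϖ,0,ε]) : conj e (1 : D) = 1 := by
  rw [conj, map_one, star_one, map_one]

theorem conj_zero (e : D ≃ₐ[F] ℍ[F,ϖ,0,ε]) : conj e (0 : D) = 0 := by
  rw [conj, map_zero, star_zero, map_zero]

theorem conj_conj (e : D ≃ₐ[F] ℍ[F,ϖ,0,ε]) (x : D) : conj e (conj e x) = x := by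
  rw [conj, conj, AlgEquiv.apply_symm_apply, star_star, AlgEquiv.symm_apply_apply]

namespace IsFrame

variable {v : Valuation F Γ₀} {e : D ≃ₐ[F] ℍ[F,ϖ,0,ε]} (h : IsFrame v e)
include h

theorem normVal_jPart_baseUnit (x y : F) :
    h.normVal (jPart e (baseUnit e x y : D)) = max (v x ^ 2) (v ϖ * v y ^ 2) := by
  rw [normVal_jPart, map_baseUnit]

theorem normVal_jPart_baseUnit_le {x y : F} (hx : v x ≤ 1) (hy : v y ≤ 1) :
    h.normVal (jPart e (baseUnit e x y : D)) ≤ 1 := by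
  rw [normVal_jPart_baseUnit]
  exact max_le (pow_le_one₀ zero_le hx)
    (mul_le_one' h.lt_one.le (pow_le_one₀ zero_le hy))

theorem normVal_jPart_baseUnit_lt {x y : F} (hx : v x < 1) (hy : v y ≤ 1) :
    h.normVal (jPart e (baseUnit e x y : D)) < 1 := by
  rw [normVal_jPart_baseUnit]
  exact max_lt (pow_lt_one₀ zero_le hx _root_.two_ne_zero)
    ((mul_le_of_le_one_right' (pow_le_one₀ zero_le hy)).trans_lt h.lt_one)

theorem normVal_baseUnit {x y : F} (hx : v x ≤ 1) (hy : v y ≤ 1) :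
    h.normVal (baseUnit e x y : D) = 1 := by
  rw [normVal_eq_max, kPart_baseUnit, map_one, max_eq_left (h.normVal_jPart_baseUnit_le hx hy)]

theorem normVal_jUnit : h.normVal (jUnit e : D) = 1 := by
  rw [normVal_eq, map_jUnit]
  simp

variable {k : ℕ} (hk : 1 ≤ k)

/-- The inverse of `b` is a scalar multiple of `conj b`, and the level condition is homogeneous. -/
theorem mul_inv_mem_levelSubgroup {a b : Dˣ} : a * b⁻¹ ∈ h.levelSubgroup hk ↔
    h.normVal (jPart e (a * conj e b)) ≤ v ϖ ^ k * h.normVal (kPart e (a * conj e b)) := by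
  rw [mem_levelSubgroup, Units.val_mul, Units.val_inv_eq_inv_val, h.inv_eq b.ne_zero,
    mul_smul_comm, jPart_smul, kPart_smul, normVal_smul, normVal_smul, mul_left_comm,
    mul_le_mul_iff_right₀]
  rw [zero_lt_iff]
  exact pow_ne_zero 2 ((Valuation.ne_zero_iff v).2 (inv_ne_zero (h.nrd_ne_zero b.ne_zero)))

/-- The two-by-two determinant test for equality of the points `[kPart : jPart]` of the projective
line modulo `𝒫_K ^ k`. -/
theorem normVal_jPart_mul_conj_le {a b : Dˣ} (ha : h.normVal (a : D) = 1)
    (hb : h.normVal (b : D) = 1) (hab : a * b⁻¹ ∈ h.levelSubgroup hk) :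
    h.normVal (jPart e a * kPart e b - kPart e a * jPart e b : D) ≤ v ϖ ^ k := by
  rw [mul_inv_mem_levelSubgroup, jPart_mul, kPart_conj, jPart_conj, conj_conj, mul_neg,
    neg_add_eq_sub] at hab
  refine hab.trans (mul_le_of_le_one_right' ((h.normVal_kPart_le _).trans ?_))
  rw [map_mul, normVal_conj, ha, hb, one_mul]

theorem baseUnit_injective {S₁ S₂ : Finset F} (hS₁ : IsResidueSystem v ϖ (k - k / 2) S₁)
    (hS₂ : IsResidueSystem v ϖ (k / 2) S₂) {x x' y y' : F} (hx : x ∈ S₁) (hx' : x' ∈ S₁)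
    (hy : y ∈ S₂) (hy' : y' ∈ S₂)
    (hmem : baseUnit e x y * (baseUnit e x' y')⁻¹ ∈ h.levelSubgroup hk) : x = x' ∧ y = y' := by
  have h1 := h.normVal_jPart_mul_conj_le hk
    (h.normVal_baseUnit (hS₁.le_one x hx) (hS₂.le_one y hy))
    (h.normVal_baseUnit (hS₁.le_one x' hx') (hS₂.le_one y' hy')) hmem
  rw [kPart_baseUnit, kPart_baseUnit, mul_one, one_mul, normVal_le_pow_iff, map_sub,
    map_jPart_baseUnit, map_jPart_baseUnit] at h1
  exact ⟨hS₁.eq_of_le x hx x' hx' h1.1.1, hS₂.eq_of_le y hy y' hy' h1.2.1⟩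

/-- With `ξ = x + y i` and `ξ' = x' + y' i`, the determinant of the two points is `ε ξ ξ' - 1`, a
unit because `ξ'` is not one; so the two charts are disjoint. -/
theorem baseUnit_mul_inv_notMem {x x' y y' : F} (hx : v x ≤ 1) (hy : v y ≤ 1) (hx' : v x' < 1)
    (hy' : v y' ≤ 1) : baseUnit e x y * (baseUnit e x' y' * jUnit e)⁻¹ ∉ h.levelSubgroup hk := by
  intro hmem
  have h1 := h.normVal_jPart_mul_conj_le hk (h.normVal_baseUnit hx hy)
    (by rw [Units.val_mul, map_mul, h.normVal_baseUnit hx'.le hy', h.normVal_jUnit, one_mul]) hmem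
  rw [Units.val_mul, kPart_mul, jPart_mul, kPart_baseUnit, kPart_baseUnit, kPart_jUnit, jPart_jUnit,
    conj_one, conj_zero, mul_zero, mul_zero, mul_one, mul_one, zero_add, add_zero, one_mul,
    Valuation.map_sub_eq_of_lt_right, map_one] at h1
  · exact (h.pow_lt_one hk).not_ge h1
  · rw [map_one, map_mul, normVal_eps_smul]
    exact (mul_le_of_le_one_left' (h.normVal_jPart_baseUnit_le hx hy)).trans_lt
      (h.normVal_jPart_baseUnit_lt hx' hy')

/-- Write `g = α (1 + ξ j)` with `α, ξ ∈ K` and `ξ` integral, and round `ξ` to `x + y i` modulo `𝒫_K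
^ k`; the quotient of `g` by the rounded unit is then close to `α`. -/
theorem exists_mul_inv_baseUnit_mem {S₁ S₂ : Finset F} (hS₁ : IsResidueSystem v ϖ (k - k / 2) S₁)
    (hS₂ : IsResidueSystem v ϖ (k / 2) S₂) {g : Dˣ}
    (hg : h.normVal (jPart e (g : D)) ≤ h.normVal (kPart e (g : D))) :
    ∃ x ∈ S₁, ∃ y ∈ S₂, g * (baseUnit e x y)⁻¹ ∈ h.levelSubgroup hk ∧
      (h.normVal (jPart e (g : D)) < h.normVal (kPart e (g : D)) → v x < 1) := by
  set α : D := kPart e (g : D) with hα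
  have hα0 : α ≠ 0 := by
    intro h0
    rw [h0, map_zero, le_zero_iff] at hg
    have := h.normVal_eq_max (g : D)
    rw [← hα, h0, hg, map_zero, max_self] at this
    exact (Valuation.ne_zero_iff _).2 g.ne_zero this
  have hαn : 0 < h.normVal α := zero_lt_iff.2 ((Valuation.ne_zero_iff _).2 hα0)
  have hjα : jPart e α = 0 := jPart_kPart e _
  have hkα : kPart e α = α := kPart_of_jPart_eq_zero e hjα
  obtain ⟨ξ, hξ⟩ : ∃ ξ : D, ξ = α⁻¹ * jPart e (g : D) := ⟨_, rfl⟩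
  have hαξ : jPart e (g : D) = α * ξ := by rw [hξ, mul_inv_cancel_left₀ hα0]
  have hjξ : jPart e ξ = 0 := by
    rw [hξ, jPart_mul, h.inv_eq hα0, jPart_smul, jPart_conj, hjα, jPart_jPart]
    simp
  have hnξ : h.normVal ξ * h.normVal α = h.normVal (jPart e (g : D)) := by
    rw [hαξ, map_mul, mul_comm]
  have hξ1 : h.normVal ξ ≤ v ϖ ^ 0 := by
    rw [pow_zero, ← mul_le_mul_iff_left₀ hαn, one_mul, hnξ]
    exact hg
  have hξc := h.normVal_le_pow_iff.1 hξ1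
  simp only [Nat.zero_div, Nat.sub_zero, pow_zero] at hξc
  obtain ⟨x, hx, hx'⟩ := hS₁.exists_le _ hξc.1.1
  obtain ⟨y, hy, hy'⟩ := hS₂.exists_le _ hξc.2.1
  refine ⟨x, hx, y, hy, ?_, fun hlt => ?_⟩
  · refine h.mem_levelSubgroup_of_close hk hα0 hjα ?_
    have hb := h.normVal_baseUnit (e := e) (hS₁.le_one x hx) (hS₂.le_one y hy)
    have h1 : ((g * (baseUnit e x y)⁻¹ : Dˣ) : D) - α =
        (g - α * baseUnit e x y) * ((baseUnit e x y)⁻¹ : Dˣ) := by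
      rw [sub_mul, mul_assoc α, Units.mul_inv, mul_one, Units.val_mul]
    have hb' : h.normVal ((((baseUnit e x y)⁻¹ : Dˣ)) : D) = 1 := by
      have := congrArg h.normVal (Units.mul_inv (baseUnit e x y))
      rwa [map_mul, hb, one_mul, map_one] at this
    rw [h1, map_mul, hb', mul_one, normVal_eq_max, kPart_sub, jPart_sub, kPart_mul, jPart_mul, hjα,
      hkα, kPart_baseUnit, zero_mul, smul_zero, add_zero, mul_one, sub_self, map_zero, zero_mul,
      add_zero, max_eq_right zero_le, hαξ, ← mul_sub, map_mul, mul_comm]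
    refine mul_le_mul_left ?_ _
    rw [normVal_le_pow_iff, map_sub, map_jPart_baseUnit]
    have := (jPart_eq_zero_iff e).1 hjξ
    simp only [QuaternionAlgebra.re_sub, QuaternionAlgebra.imI_sub, QuaternionAlgebra.imJ_sub,
      QuaternionAlgebra.imK_sub, this]
    simpa using ⟨hx', hy'⟩
  · have h1 : h.normVal ξ < 1 := by
      rw [← mul_lt_mul_iff_left₀ hαn, one_mul, hnξ]
      exact hlt
    have h2 : v (e ξ).re < 1 := by
      have h3 := h.normVal_kPart ξ
      have h4 := (le_max_left _ _).trans (h3.symm.le.trans (h.normVal_kPart_le ξ))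
      exact (pow_lt_one_iff_of_nonneg zero_le _root_.two_ne_zero).1 (h4.trans_lt h1)
    have h3 : x = (e ξ).re - ((e ξ).re - x) := by ring
    rw [h3]
    exact Valuation.map_sub_lt _ h2 (hx'.trans_lt (h.pow_lt_one (by lia)))

open Classical in
/-- The index set for a system of representatives of the cosets of the level subgroup. -/
def chartFinset (_ : IsFrame v e) (S₁ : Finset F) : Finset (F × Bool) :=
  (S₁ ×ˢ Finset.univ).filter fun p => p.2 = true → v p.1 < 1

theorem mem_chartFinset {S₁ : Finset F} {p : F × Bool} :
    p ∈ h.chartFinset S₁ ↔ p.1 ∈ S₁ ∧ (p.2 = true → v p.1 < 1) := by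
  simp [chartFinset]

theorem isRepresentativeFamily {S₁ S₂ : Finset F} (hS₁ : IsResidueSystem v ϖ (k - k / 2) S₁)
    (hS₂ : IsResidueSystem v ϖ (k / 2) S₂) :
    IsRepresentativeFamily (h.levelSubgroup hk)
      (fun p : (h.chartFinset S₁ ×ˢ S₂ : Finset _) => repUnit e p) where
  exists_mem g := by
    by_cases hg : h.normVal (jPart e (g : D)) ≤ h.normVal (kPart e (g : D))
    · obtain ⟨x, hx, y, hy, hmem, -⟩ := h.exists_mul_inv_baseUnit_mem hk hS₁ hS₂ hg
      refine ⟨⟨((x, false), y), Finset.mem_product.2 ⟨h.mem_chartFinset.2 ⟨hx, by simp⟩, hy⟩⟩, ?_⟩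
      simpa [repUnit] using hmem
    -- When the `j`-part dominates, dividing by `j` on the right exchanges the two parts up to a
    -- unit; the strict inequality makes `x` a non-unit.
    · rw [not_le] at hg
      have hgj : (g : D) = ((g * (jUnit e)⁻¹ : Dˣ) : D) * jUnit e := by
        rw [← Units.val_mul, inv_mul_cancel_right]
      have hkg : h.normVal (kPart e ((g * (jUnit e)⁻¹ : Dˣ) : D)) =
          h.normVal (jPart e (g : D)) := by
        conv_rhs => rw [hgj, jPart_mul, jPart_jUnit, kPart_jUnit, conj_zero, mul_zero, mul_one,
          add_zero]
      have hjg : h.normVal (jPart e ((g * (jUnit e)⁻¹ : Dˣ) : D)) =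
          h.normVal (kPart e (g : D)) := by
        conv_rhs => rw [hgj, kPart_mul, jPart_jUnit, kPart_jUnit, conj_one, mul_zero, mul_one,
          zero_add, normVal_eps_smul]
      obtain ⟨x, hx, y, hy, hmem, hlt⟩ := h.exists_mul_inv_baseUnit_mem hk hS₁ hS₂
        (g := g * (jUnit e)⁻¹) (by rw [hkg, hjg]; exact hg.le)
      refine ⟨⟨((x, true), y), Finset.mem_product.2 ⟨h.mem_chartFinset.2
        ⟨hx, fun _ => hlt (by rwa [hkg, hjg])⟩, hy⟩⟩, ?_⟩
      simpa [repUnit, mul_assoc] using hmem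
  eq_of_mem := by
    rintro ⟨⟨⟨x, b⟩, y⟩, hp⟩ ⟨⟨⟨x', b'⟩, y'⟩, hp'⟩ hmem
    rw [Finset.mem_product, mem_chartFinset] at hp hp'
    obtain ⟨⟨hx, hb⟩, hy⟩ := hp
    obtain ⟨⟨hx', hb'⟩, hy'⟩ := hp'
    simp only [repUnit] at hx hb hy hx' hb' hy' hmem
    have hx1 := hS₁.le_one x hx
    have hx1' := hS₁.le_one x' hx'
    have hy1 := hS₂.le_one y hy
    have hy1' := hS₂.le_one y' hy'
    have key : b = b' ∧ baseUnit e x y * (baseUnit e x' y')⁻¹ ∈ h.levelSubgroup hk := by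
      cases b <;> cases b'
      · simpa using hmem
      · exact (h.baseUnit_mul_inv_notMem hk hx1 hy1 (hb' rfl) hy1' (by simpa using hmem)).elim
      · refine (h.baseUnit_mul_inv_notMem hk hx1' hy1' (hb rfl) hy1 ?_).elim
        have := (h.levelSubgroup hk).inv_mem hmem
        simpa [mul_assoc] using this
      · simpa [mul_assoc] using hmem
    obtain ⟨rfl, rfl⟩ := h.baseUnit_injective hk hS₁ hS₂ hx hx' hy hy' key.2
    obtain rfl := key.1
    rfl

end IsFrame

end Representatives

end

section

open scoped Quaternion

/-! ### Which representatives lie in the double cosets of the tori -/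

section Intersections

variable {F Γ₀ D : Type*} [Field F] [LinearOrderedCommGroupWithZero Γ₀] [DivisionRing D]
  [Algebra F D] {ϖ ε : F}

namespace IsFrame

variable {v : Valuation F Γ₀} {e : D ≃ₐ[F] ℍ[F,ϖ,0,ε]} (h : IsFrame v e) {k : ℕ} (hk : 1 ≤ k)
include h

/-- In the product the `j`-coordinate `n₂ + x n₀` has to be small, which forces `n₀` to carry the
whole norm of `n`. The `i j`-coordinate is `y n₀`, so its smallness passes to `y`. -/
theorem val_le_of_mul_mem_of_imI_eq_zero {x y n₀ n₂ : F} (hx : v x ≤ 1) (hy : v y ≤ 1) {n : Dˣ}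
    (hn : e (n : D) = ⟨n₀, 0, n₂, 0⟩) (hmem : baseUnit e x y * n ∈ h.levelSubgroup hk) :
    v y ≤ v ϖ ^ (k / 2) := by
  have hA0 : h.normVal (n : D) ≠ 0 := (Valuation.ne_zero_iff _).2 n.ne_zero
  have hA : h.normVal (n : D) = max (v n₀ ^ 2) (v n₂ ^ 2) := by
    rw [normVal_eq, hn]
    simp
  set A := h.normVal (n : D) with hAdef
  have hN : max (v (n₀ + ε * x * n₂) ^ 2) (v (n₂ + x * n₀) ^ 2) = A := by
    have h1 : h.normVal ((baseUnit e x 0 : D) * n) = A := by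
      rw [map_mul, h.normVal_baseUnit hx (by simp), one_mul]
    rw [normVal_eq, map_mul, map_baseUnit, hn] at h1
    rw [← h1]
    simp [mul_assoc]
  rw [mem_levelSubgroup, normVal_kPart, normVal_jPart, Units.val_mul, map_mul, map_baseUnit, hn]
    at hmem
  simp only [QuaternionAlgebra.re_mul, QuaternionAlgebra.imI_mul, QuaternionAlgebra.imJ_mul,
    QuaternionAlgebra.imK_mul, max_le_iff] at hmem
  obtain ⟨hm1, hm2⟩ := hmem
  have hpk := h.pow_lt_one hk
  have hbound : max (v (n₀ + ε * x * n₂) ^ 2) (v ϖ * v (ε * y * n₂) ^ 2) ≤ A := by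
    refine max_le ((le_max_left _ _).trans hN.le) ?_
    rw [map_mul, map_mul, h.unit, one_mul]
    calc v ϖ * (v y * v n₂) ^ 2 ≤ 1 * (1 * v n₂) ^ 2 := by
          gcongr
          exact h.lt_one.le
      _ ≤ A := by
          rw [one_mul, one_mul, hA]
          exact le_max_right _ _
  have hm1' : v (n₂ + x * n₀) ^ 2 ≤ v ϖ ^ k * A := by
    refine le_trans (le_of_eq ?_) (hm1.trans (mul_le_mul_right (le_trans (le_of_eq ?_) hbound) _))
    · congr 2
      ring
    · congr 4 <;> ring
  have hm2' : v ϖ * (v y * v n₀) ^ 2 ≤ v ϖ ^ k * A := by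
    refine le_trans (le_of_eq ?_) (hm2.trans (mul_le_mul_right (le_trans (le_of_eq ?_) hbound) _))
    · rw [← map_mul]
      congr 3
      ring
    · congr 4 <;> ring
  have hlt : v (n₂ + x * n₀) ^ 2 < A := hm1'.trans_lt (mul_lt_self_of_lt_one hpk hA0)
  have hN0 : v (n₀ + ε * x * n₂) ^ 2 = A := by
    rcases max_choice (v (n₀ + ε * x * n₂) ^ 2) (v (n₂ + x * n₀) ^ 2) with h1 | h1
    · rw [← h1, hN]
    · rw [h1] at hN
      exact (hlt.ne hN).elim
  have hn0 : v n₀ ^ 2 = A := by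
    have h1 : (n₀ + ε * x * n₂) - ε * x * (n₂ + x * n₀) = n₀ * (1 ^ 2 - ε * x ^ 2) := by ring
    have h2 : v (ε * x * (n₂ + x * n₀)) < v (n₀ + ε * x * n₂) := by
      rw [map_mul, map_mul, h.unit, one_mul]
      refine (mul_le_of_le_one_left' hx).trans_lt ?_
      rw [← hN0] at hlt
      exact lt_of_pow_lt_pow_left₀ 2 zero_le hlt
    have h3 := congrArg v h1
    rw [Valuation.map_sub_eq_of_lt_left _ h2, map_mul, h.aniso, map_one, one_pow,
      max_eq_left (pow_le_one₀ zero_le hx), mul_one] at h3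
    rw [← h3, hN0]
  rw [mul_pow, hn0, ← mul_assoc, mul_le_mul_iff_left₀ (zero_lt_iff.2 hA0), h.mul_sq_le_iff] at hm2'
  exact hm2'

/-- The counterpart for `F(i j)`: now the `j`-coordinate is `x n₀`. That `n₀` carries the whole norm
follows from parity of valuations. -/
theorem val_le_of_mul_mem_of_imJ_eq_zero {x y n₀ n₃ : F} (hx : v x ≤ 1) (hy : v y ≤ 1) {n : Dˣ}
    (hn : e (n : D) = ⟨n₀, 0, 0, n₃⟩) (hmem : baseUnit e x y * n ∈ h.levelSubgroup hk) :
    v x ≤ v ϖ ^ (k - k / 2) := by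
  have hA0 : h.normVal (n : D) ≠ 0 := (Valuation.ne_zero_iff _).2 n.ne_zero
  have hA : h.normVal (n : D) = max (v n₀ ^ 2) (v ϖ * v n₃ ^ 2) := by
    rw [normVal_eq, hn]
    simp
  set A := h.normVal (n : D) with hAdef
  have hN : max (v (n₀ - ϖ * ε * y * n₃) ^ 2) (v ϖ * v (n₃ + y * n₀) ^ 2) = A := by
    have h1 : h.normVal ((baseUnit e 0 y : D) * n) = A := by
      rw [map_mul, h.normVal_baseUnit (by simp) hy, one_mul]
    rw [normVal_eq, map_mul, map_baseUnit, hn] at h1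
    rw [← h1]
    simp [mul_assoc]
  rw [mem_levelSubgroup, normVal_kPart, normVal_jPart, Units.val_mul, map_mul, map_baseUnit, hn]
    at hmem
  simp only [QuaternionAlgebra.re_mul, QuaternionAlgebra.imI_mul, QuaternionAlgebra.imJ_mul,
    QuaternionAlgebra.imK_mul, max_le_iff] at hmem
  obtain ⟨hm1, hm2⟩ := hmem
  have hpk := h.pow_lt_one hk
  have hbound : max (v (n₀ - ϖ * ε * y * n₃) ^ 2) (v ϖ * v (-(ε * x * n₃)) ^ 2) ≤ A := by
    refine max_le ((le_max_left _ _).trans hN.le) ?_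
    rw [Valuation.map_neg, map_mul, map_mul, h.unit, one_mul]
    calc v ϖ * (v x * v n₃) ^ 2 ≤ v ϖ * (1 * v n₃) ^ 2 := by gcongr
      _ ≤ A := by
          rw [one_mul, hA]
          exact le_max_right _ _
  have hm1' : (v x * v n₀) ^ 2 ≤ v ϖ ^ k * A := by
    refine le_trans (le_of_eq ?_) (hm1.trans (mul_le_mul_right (le_trans (le_of_eq ?_) hbound) _))
    · rw [← map_mul]
      congr 2
      ring
    · congr 4 <;> ring
  have hm2' : v ϖ * v (n₃ + y * n₀) ^ 2 ≤ v ϖ ^ k * A := by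
    refine le_trans (le_of_eq ?_) (hm2.trans (mul_le_mul_right (le_trans (le_of_eq ?_) hbound) _))
    · congr 3
      ring
    · congr 4 <;> ring
  have hlt : v ϖ * v (n₃ + y * n₀) ^ 2 < A := hm2'.trans_lt (mul_lt_self_of_lt_one hpk hA0)
  have hN0 : v (n₀ - ϖ * ε * y * n₃) ^ 2 = A := by
    rcases max_choice (v (n₀ - ϖ * ε * y * n₃) ^ 2) (v ϖ * v (n₃ + y * n₀) ^ 2) with h1 | h1
    · rw [← h1, hN]
    · rw [h1] at hN
      exact (hlt.ne hN).elim
  have hn0 : v n₀ ^ 2 = A := by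
    rcases max_choice (v n₀ ^ 2) (v ϖ * v n₃ ^ 2) with h1 | h1
    · rw [← h1, hA]
    · rw [h1] at hA
      have h2 := h.eq_zero_of_mul_sq_eq (hA.symm.trans hN0.symm)
      rw [h2] at hA
      simp [hA] at hA0
  rw [mul_pow, hn0, mul_le_mul_iff_left₀ (zero_lt_iff.2 hA0), h.sq_le_iff] at hm1'
  exact hm1'

end IsFrame

namespace IsDatum

variable {v : Valuation F Γ₀} {e : D ≃ₐ[F] ℍ[F,ϖ,0,ε]} {K : Subalgebra F D} {ϖK : Kˣ}
  {ψ : Kˣ →* ℂˣ} {ψ₀ : AddChar F ℂ} {c : K} {k : ℕ} (d : IsDatum v e K ϖK ψ ψ₀ c k)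
  {M : Subgroup Dˣ} (hM : IsTorus M (jUnit e : D) F)
include hM

theorem mem_unramified_iff {t : Dˣ} :
    t ∈ M ↔ (e (t : D)).imI = 0 ∧ (e (t : D)).imK = 0 := by
  rw [hM]
  constructor
  · rintro ⟨a, b, hab⟩
    rw [hab, map_add, map_smul, map_jUnit, AlgEquiv.commutes]
    simp [QuaternionAlgebra.algebraMap_eq]
  · rintro ⟨h1, h2⟩
    refine ⟨(e (t : D)).re, (e (t : D)).imJ, e.injective ?_⟩
    rw [map_add, map_smul, map_jUnit, AlgEquiv.commutes]
    ext <;> simp [QuaternionAlgebra.algebraMap_eq, h1, h2]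

theorem jUnit_mem : jUnit e ∈ M := by
  rw [mem_unramified_iff hM, map_jUnit]
  exact ⟨rfl, rfl⟩

theorem baseUnit_zero_mem (x : F) : baseUnit e x 0 ∈ M := by
  rw [mem_unramified_iff hM, map_baseUnit]
  exact ⟨rfl, rfl⟩

theorem ite_jUnit_mem (b : Bool) : (if b then jUnit e else 1) ∈ M := by
  cases b
  · exact M.one_mem
  · exact jUnit_mem hM

include d

theorem repUnit_eq_iff {S₁ S₂ : Finset F} (hS₁ : IsResidueSystem v ϖ (k - k / 2) S₁)
    (hS₂ : IsResidueSystem v ϖ (k / 2) S₂) {p : (F × Bool) × F}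
    (hp : p ∈ d.frame.chartFinset S₁ ×ˢ S₂) :
    (∃ h ∈ d.group, ∃ t ∈ M, repUnit e p = h * t) ↔ p.2 = 0 := by
  rw [Finset.mem_product, d.frame.mem_chartFinset] at hp
  constructor
  · rintro ⟨h, hh, t, ht, hp'⟩
    have hm : (if p.1.2 then jUnit e else 1) * t⁻¹ ∈ M :=
      M.mul_mem (ite_jUnit_mem hM _) (M.inv_mem ht)
    rw [mem_unramified_iff hM] at hm
    refine hS₂.eq_of_le _ hp.2 _ hS₂.zero_mem ?_
    rw [sub_zero]
    refine d.frame.val_le_of_mul_mem_of_imI_eq_zero d.one_le (hS₁.le_one _ hp.1.1)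
      (hS₂.le_one _ hp.2) (n := (if p.1.2 then jUnit e else 1) * t⁻¹)
      (n₀ := (e (((if p.1.2 then jUnit e else 1) * t⁻¹ : Dˣ) : D)).re)
      (n₂ := (e (((if p.1.2 then jUnit e else 1) * t⁻¹ : Dˣ) : D)).imJ) ?_ ?_
    · ext
      · rfl
      · exact hm.1
      · rfl
      · exact hm.2
    · rw [← mul_assoc]
      have : baseUnit e p.1.1 p.2 * (if p.1.2 then jUnit e else 1) = h * t := hp'
      rwa [this, mul_inv_cancel_right]
  · intro h0
    refine ⟨1, d.group.one_mem, _, M.mul_mem (baseUnit_zero_mem hM p.1.1)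
      (ite_jUnit_mem hM p.1.2), ?_⟩
    rw [one_mul, repUnit, h0]

omit hM

variable {T : Subgroup Dˣ} {X : D} (hT : IsTorus T X F) {w₀ : F} (hw₀ : w₀ ≠ 0) {g₀ : Dˣ}
  (hg₀ : g₀ * X = e.symm ⟨0, 0, 0, w₀⟩ * g₀)
include hT hw₀ hg₀

omit [LinearOrderedCommGroupWithZero Γ₀] d in
theorem conj_mem_iff {t : Dˣ} : g₀⁻¹ * t * g₀ ∈ T ↔
    (e (t : D)).imI = 0 ∧ (e (t : D)).imJ = 0 := by
  have hX : ∀ a b : F, (g₀ : D) * (algebraMap F D a + b • X) =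
      (algebraMap F D a + b • e.symm ⟨0, 0, 0, w₀⟩) * g₀ := by
    intro a b
    rw [mul_add, add_mul, Algebra.commutes, mul_smul_comm, hg₀, smul_mul_assoc]
  have hX' : (g₀⁻¹ * t * g₀ ∈ T) ↔
      ∃ a b : F, (t : D) = algebraMap F D a + b • e.symm ⟨0, 0, 0, w₀⟩ := by
    rw [hT]
    refine exists_congr fun a => exists_congr fun b => ?_
    rw [Units.val_mul, Units.val_mul, mul_assoc, Units.inv_mul_eq_iff_eq_mul, hX,
      Units.mul_left_inj]
  rw [hX']
  constructor
  · rintro ⟨a, b, hab⟩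
    rw [hab, map_add, map_smul, AlgEquiv.apply_symm_apply, AlgEquiv.commutes]
    simp [QuaternionAlgebra.algebraMap_eq]
  · rintro ⟨h1, h2⟩
    refine ⟨(e (t : D)).re, (e (t : D)).imK / w₀, e.injective ?_⟩
    rw [map_add, map_smul, AlgEquiv.apply_symm_apply, AlgEquiv.commutes]
    ext <;> simp [QuaternionAlgebra.algebraMap_eq, h1, h2, hw₀]

theorem repUnit_mul_eq_iff {S₁ S₂ : Finset F} (hS₁ : IsResidueSystem v ϖ (k - k / 2) S₁)
    (hS₂ : IsResidueSystem v ϖ (k / 2) S₂) {p : (F × Bool) × F}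
    (hp : p ∈ d.frame.chartFinset S₁ ×ˢ S₂) :
    (∃ h ∈ d.group, ∃ t ∈ T, repUnit e p * g₀ = h * g₀ * t) ↔ p.1.1 = 0 := by
  rw [Finset.mem_product, d.frame.mem_chartFinset] at hp
  set u : Dˣ := unitsIncl K ϖK with hu
  have huD : e (u : D) = ⟨0, 1, 0, 0⟩ := d.map_unif
  have huH : u ∈ d.group := d.frame.mem_levelSubgroup_of_jPart_eq_zero d.one_le (d.jPart_coe _)
  constructor
  · rintro ⟨h, hh, t, ht, hp'⟩
    refine hS₁.eq_of_le _ hp.1.1 _ hS₁.zero_mem ?_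
    rw [sub_zero]
    have key : ∀ n : Dˣ, (e (n : D)).imI = 0 ∧ (e (n : D)).imJ = 0 →
        baseUnit e p.1.1 p.2 * n ∈ d.group → v p.1.1 ≤ v ϖ ^ (k - k / 2) := by
      intro n hn hmem
      refine d.frame.val_le_of_mul_mem_of_imJ_eq_zero d.one_le (hS₁.le_one _ hp.1.1)
        (hS₂.le_one _ hp.2) (n := n) (n₀ := (e (n : D)).re) (n₃ := (e (n : D)).imK) ?_ hmem
      ext <;> simp [hn]
    have hm : (e ((g₀ * t⁻¹ * g₀⁻¹ : Dˣ) : D)).imI = 0 ∧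
        (e ((g₀ * t⁻¹ * g₀⁻¹ : Dˣ) : D)).imJ = 0 := by
      rw [← conj_mem_iff hT hw₀ hg₀]
      have : g₀⁻¹ * (g₀ * t⁻¹ * g₀⁻¹) * g₀ = t⁻¹ := by group
      rw [this]
      exact T.inv_mem ht
    have hp2 : baseUnit e p.1.1 p.2 * ((if p.1.2 then jUnit e else 1) * (g₀ * t⁻¹ * g₀⁻¹)) = h := by
      have h1 : repUnit e p = h * g₀ * t * g₀⁻¹ := by rw [← hp', mul_inv_cancel_right]
      rw [← mul_assoc]
      change repUnit e p * _ = h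
      rw [h1]
      group
    cases hb : p.1.2
    · refine key _ hm ?_
      rw [hb] at hp2
      simp only [Bool.false_eq_true, if_false, one_mul] at hp2
      rwa [hp2]
    · rw [hb, if_pos rfl] at hp2
      -- In the second chart the extra `j` leaves `F(i j)`; multiplying by `i` on the right returns
      -- there, since `j i` and `j (i j) i` lie in `F(i j)`, and it preserves the inducing group.
      refine key (jUnit e * (g₀ * t⁻¹ * g₀⁻¹) * u) ?_ ?_
      · rw [Units.val_mul, Units.val_mul, map_mul, map_mul, huD, map_jUnit]
        simp only [QuaternionAlgebra.re_mul, QuaternionAlgebra.imI_mul, QuaternionAlgebra.imJ_mul,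
          QuaternionAlgebra.imK_mul, hm]
        constructor <;> ring
      · rw [← mul_assoc, hp2]
        exact d.group.mul_mem hh huH
  · intro h0
    cases hb : p.1.2
    · refine ⟨1, d.group.one_mem, g₀⁻¹ * repUnit e p * g₀, ?_, by group⟩
      rw [conj_mem_iff hT hw₀ hg₀, repUnit, hb, h0]
      simp [map_baseUnit]
    · refine ⟨u⁻¹, d.group.inv_mem huH, g₀⁻¹ * (u * repUnit e p) * g₀, ?_, by group⟩
      rw [conj_mem_iff hT hw₀ hg₀, repUnit, hb, h0, if_pos rfl, Units.val_mul, Units.val_mul,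
        map_mul, map_mul, huD, map_baseUnit, map_jUnit]
      simp

end IsDatum

end Intersections

section Coefficient

variable {F Γ₀ D : Type*} [Field F] [LinearOrderedCommGroupWithZero Γ₀] [DivisionRing D]
  [Algebra F D] {ϖ ε : F}

namespace IsDatum

variable {v : Valuation F Γ₀} {e : D ≃ₐ[F] ℍ[F,ϖ,0,ε]} {K : Subalgebra F D} {ϖK : Kˣ}
  {ψ : Kˣ →* ℂˣ} {ψ₀ : AddChar F ℂ} {c : K} {k : ℕ} (d : IsDatum v e K ϖK ψ ψ₀ c k)
  {V : Type*} [AddCommGroup V] [Module ℂ V] {π : Representation ℂ Dˣ V}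
  {ι : V →ₗ[ℂ] (Dˣ → ℂ)} (hι : IsInducedModel π d.group d.char ι)
  {M : Subgroup Dˣ} (hM : IsTorus M (jUnit e : D) F)
include d hι hM

/-- Here `X = Y = j` and `g₀ = 1`. As `j` is a unit, the testing level `n` has to be the ceiling of
`k / 2`. -/
theorem exists_unramified_generator :
    ∃ v₀ ∈ fixedVectors π M, (∀ h ∈ d.group, ∀ t ∈ M, ι v₀ (h * 1 * t) = d.char h) ∧
      (∀ g, ι v₀ g ≠ 0 → ∃ h ∈ d.group, ∃ t ∈ M, g = h * 1 * t) ∧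
      ∀ w ∈ fixedVectors π M, ∃ a : ℂ, w = a • v₀ := by
  have hjj : (jUnit e : D) * jUnit e = algebraMap F D ε := by
    apply e.injective
    rw [map_mul, map_jUnit, AlgEquiv.commutes]
    ext <;> simp [QuaternionAlgebra.algebraMap_eq]
  exact d.exists_fixed_generator hι hM (by rw [map_jUnit]) d.frame.eps_ne_zero hjj
    (j := 0) (n := k - k / 2) (by rw [d.frame.normVal_jUnit, pow_zero]) (by lia) (by lia)
    (kPart_jUnit e) hjj (by simp) (by lia)

end IsDatum

end Coefficient

end

section

open scoped Quaternion

theorem IsInducedModel.conj_mul_self_eq_ite {G V : Type*} [Group G] [AddCommGroup V] [Module ℂ V]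
    {π : Representation ℂ G V} {H : Subgroup G} {χ : G → ℂ} {ι : V →ₗ[ℂ] (G → ℂ)}
    (hι : IsInducedModel π H χ ι) {T : Subgroup G} {g₀ : G} {w : V}
    (hval : ∀ h ∈ H, ∀ t ∈ T, ι w (h * g₀ * t) = χ h)
    (hsupp : ∀ g, ι w g ≠ 0 → ∃ h ∈ H, ∃ t ∈ T, g = h * g₀ * t) {p : Prop} [Decidable p] {g : G}
    (hp : (∃ h ∈ H, ∃ t ∈ T, g = h * g₀ * t) ↔ p) :
    (starRingEnd ℂ) (ι w g) * ι w g = if p then 1 else 0 := by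
  split_ifs with h0
  · obtain ⟨h, hh, t, ht, rfl⟩ := hp.2 h0
    rw [hval h hh t ht, hι.conj_mul_self hh]
  · have : ι w g = 0 := by
      by_contra h
      exact h0 (hp.1 (hsupp g h))
    rw [this, mul_zero]

/-! ### Norms and inner product of the two fixed vectors -/

section Coefficient

variable {F Γ₀ D : Type*} [Field F] [LinearOrderedCommGroupWithZero Γ₀] [DivisionRing D]
  [Algebra F D] {ϖ ε : F}

theorem IsFrame.sum_chartFinset_ite {v : Valuation F Γ₀} {e : D ≃ₐ[F] ℍ[F,ϖ,0,ε]}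
    (h : IsFrame v e) {S₁ : Finset F} (h0 : (0 : F) ∈ S₁) (f : F × Bool → ℂ)
    (hf : ∀ a ∈ h.chartFinset S₁, a.1 ≠ 0 → f a = 0) :
    ∑ a ∈ h.chartFinset S₁, f a = f (0, true) + f (0, false) := by
  classical
  have hsub : ({(0, true), (0, false)} : Finset (F × Bool)) ⊆ h.chartFinset S₁ := by
    intro a ha
    rw [Finset.mem_insert, Finset.mem_singleton] at ha
    rw [h.mem_chartFinset]
    rcases ha with rfl | rfl <;> simp [h0]
  rw [← Finset.sum_subset hsub, Finset.sum_pair (by simp)]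
  rintro ⟨x, b⟩ ha hn
  refine hf _ ha ?_
  rintro rfl
  cases b <;> simp at hn

namespace IsDatum

variable {v : Valuation F Γ₀} {e : D ≃ₐ[F] ℍ[F,ϖ,0,ε]} {K : Subalgebra F D} {ϖK : Kˣ}
  {ψ : Kˣ →* ℂˣ} {ψ₀ : AddChar F ℂ} {c : K} {k : ℕ} (d : IsDatum v e K ϖK ψ ψ₀ c k)
  {V : Type*} [AddCommGroup V] [Module ℂ V] {π : Representation ℂ Dˣ V}
  {ι : V →ₗ[ℂ] (Dˣ → ℂ)} (hι : IsInducedModel π d.group d.char ι)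
  {M : Subgroup Dˣ} (hM : IsTorus M (jUnit e : D) F)
  {S₁ S₂ : Finset F} (hS₁ : IsResidueSystem v ϖ (k - k / 2) S₁)
  (hS₂ : IsResidueSystem v ϖ (k / 2) S₂)
include d hι hM hS₁ hS₂

omit hM in
theorem exists_isInvariantInner : ∃ B, IsInvariantInner π B :=
  ⟨_, hι.isInvariantInner_stdInner (d.frame.isRepresentativeFamily d.one_le hS₁ hS₂)⟩

theorem isCorrelationCoefficient_eq_zero {T : Subgroup Dˣ}
    (hT : ∀ w ∈ fixedVectors π T, w = 0) : IsCorrelationCoefficient π M T 0 := by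
  obtain ⟨v₀, -, -, -, h⟩ := d.exists_unramified_generator hι hM
  exact isCorrelationCoefficient_zero (d.exists_isInvariantInner hι hS₁ hS₂) h hT

/-- The condition `g₀ ∈ M` makes the `M`-fixed vector invariant under translation by `g₀`, so both
supports can be compared on the translated representatives `repUnit e p * g₀`. -/
theorem isCorrelationCoefficient {T : Subgroup Dˣ} {X : D} (hT : IsTorus T X F)
    (hX : (e X).re = 0) {w₀ s : F} (hw₀ : w₀ ≠ 0) (hs : s ≠ 0)
    (hnX : d.frame.normVal X = v ϖ) (hXX : X * X = algebraMap F D s)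
    (hYY : e.symm ⟨0, 0, 0, w₀⟩ * e.symm ⟨0, 0, 0, w₀⟩ = algebraMap F D s)
    {g₀ : Dˣ} (hg₀M : g₀ ∈ M) (hg₀ : g₀ * X = e.symm ⟨0, 0, 0, w₀⟩ * g₀) :
    IsCorrelationCoefficient π M T
      (‖1 + (ψ ϖK : ℂ)⁻¹‖ ^ 2 / (2 * Module.finrank ℂ V)) := by
  classical
  have hΦ := d.frame.isRepresentativeFamily d.one_le hS₁ hS₂
  obtain ⟨v₀, hv₀, hvval, hvsupp, hvgen⟩ := d.exists_unramified_generator hι hM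
  obtain ⟨w, hw, hwval, hwsupp, hwgen⟩ := d.exists_fixed_generator hι hT hX hs hXX
    (j := 1) (n := k / 2) (by rw [hnX, pow_one]) (by lia) (by lia)
    (Y := e.symm ⟨0, 0, 0, w₀⟩) (by rw [kPart, AlgEquiv.apply_symm_apply]; exact map_zero e.symm)
    hYY hg₀ (by have := d.one_le; lia)
  set C := d.frame.chartFinset S₁
  let Φ : (C ×ˢ S₂ : Finset ((F × Bool) × F)) → Dˣ := fun p => repUnit e p
  set B₀ := IsInducedModel.stdInner ι Φ with hB₀
  have hvg : ∀ g, ι v₀ (g * g₀) = ι v₀ g := fun g => by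
    rw [← hι.action, mem_fixedVectors.1 hv₀ _ hg₀M]
  have hvv : B₀ v₀ v₀ = (C.card : ℂ) := by
    rw [hB₀, IsInducedModel.stdInner_apply,
      Finset.sum_coe_sort (C ×ˢ S₂) (fun p => (starRingEnd ℂ) (ι v₀ (repUnit e p)) *
        ι v₀ (repUnit e p)),
      Finset.sum_congr rfl fun p hp => hι.conj_mul_self_eq_ite hvval hvsupp
        (p := p.2 = 0) (by simpa only [mul_one] using d.repUnit_eq_iff hM hS₁ hS₂ hp),
      Finset.sum_product]
    simp [hS₂.zero_mem]
  have hww : B₀ w w = 2 * (S₂.card : ℂ) := by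
    rw [hB₀, IsInducedModel.stdInner_apply,
      ← hΦ.sum_translate (F := fun x => (starRingEnd ℂ) (ι w x) * ι w x)
        (hι.conj_mul_invariant w w) g₀,
      Finset.sum_coe_sort (C ×ˢ S₂) (fun p => (starRingEnd ℂ) (ι w (repUnit e p * g₀)) *
        ι w (repUnit e p * g₀)),
      Finset.sum_congr rfl fun p hp => hι.conj_mul_self_eq_ite hwval hwsupp
        (p := p.1.1 = 0) (d.repUnit_mul_eq_iff hT hw₀ hg₀ hS₁ hS₂ hp),
      Finset.sum_product, d.frame.sum_chartFinset_ite hS₁.zero_mem]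
    · simp [two_mul]
    · intro a _ ha
      simp [ha]
  -- The supports `y = 0` and `x = 0` meet in two cosets only, one for each chart.
  have hvw : B₀ v₀ w = 1 + (ψ ϖK : ℂ)⁻¹ := by
    have hv1 : ∀ t ∈ M, ι v₀ t = 1 := fun t ht => by
      have := hvval 1 d.group.one_mem t ht
      rwa [one_mul, one_mul, hι.map_one] at this
    have hb1 : baseUnit e 0 0 = 1 := by
      apply Units.ext
      apply e.injective
      rw [map_baseUnit, Units.val_one, map_one]
      rfl
    have hw1 : ι w (repUnit e ((0, false), 0) * g₀) = 1 := by
      have := hwval 1 d.group.one_mem 1 T.one_mem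
      rw [one_mul, mul_one, hι.map_one] at this
      simpa [repUnit, hb1] using this
    -- Write `j = i⁻¹ (i j)`: the first factor is in the inducing group, and the second lies in `g₀
    -- T g₀⁻¹ = F(i j)ˣ`.
    have hw2 : ι w (repUnit e ((0, true), 0) * g₀) = (ψ ϖK : ℂ)⁻¹ := by
      set u : Dˣ := unitsIncl K ϖK with hu
      have huD : e (u : D) = ⟨0, 1, 0, 0⟩ := d.map_unif
      have huH : u ∈ d.group := d.frame.mem_levelSubgroup_of_jPart_eq_zero d.one_le (d.jPart_coe _)
      have h1 : g₀⁻¹ * (u * jUnit e) * g₀ ∈ T := by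
        rw [conj_mem_iff hT hw₀ hg₀, Units.val_mul, map_mul, huD, map_jUnit]
        simp
      have h2 := hwval u⁻¹ (d.group.inv_mem huH) _ h1
      have h3 : u⁻¹ * g₀ * (g₀⁻¹ * (u * jUnit e) * g₀) = jUnit e * g₀ := by group
      rw [h3, hu, ← map_inv, d.char_coe (y := ϖK⁻¹) rfl, map_inv, Units.val_inv_eq_inv_val] at h2
      simpa [repUnit, hb1] using h2
    rw [hB₀, IsInducedModel.stdInner_apply,
      ← hΦ.sum_translate (F := fun x => (starRingEnd ℂ) (ι v₀ x) * ι w x)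
        (hι.conj_mul_invariant v₀ w) g₀,
      Finset.sum_coe_sort (C ×ˢ S₂) (fun p => (starRingEnd ℂ) (ι v₀ (repUnit e p * g₀)) *
        ι w (repUnit e p * g₀)), Finset.sum_product, d.frame.sum_chartFinset_ite hS₁.zero_mem]
    · have hz : ∀ b : Bool, ∑ y ∈ S₂, (starRingEnd ℂ) (ι v₀ (repUnit e ((0, b), y) * g₀)) *
          ι w (repUnit e ((0, b), y) * g₀) = ι w (repUnit e ((0, b), 0) * g₀) := by
        intro b
        rw [Finset.sum_eq_single 0]
        · have hm : repUnit e ((0, b), 0) ∈ M :=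
            M.mul_mem (baseUnit_zero_mem hM 0) (ite_jUnit_mem hM b)
          rw [hvg, hv1 _ hm, map_one, one_mul]
        · intro y hy hy0
          have hmem : ((0, b), y) ∈ C ×ˢ S₂ := by
            rw [Finset.mem_product, d.frame.mem_chartFinset]
            exact ⟨⟨hS₁.zero_mem, by simp⟩, hy⟩
          have : ι v₀ (repUnit e ((0, b), y)) = 0 := by
            by_contra h0
            exact hy0 ((d.repUnit_eq_iff hM hS₁ hS₂ hmem).1
              (by simpa only [mul_one] using hvsupp _ h0))
          rw [hvg, this, map_zero, zero_mul]
        · exact fun h0 => (h0 hS₂.zero_mem).elim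
      rw [hz, hz, hw1, hw2, add_comm]
    · intro a ha ha0
      refine Finset.sum_eq_zero fun y hy => ?_
      have : ι w (repUnit e (a, y) * g₀) = 0 := by
        by_contra h0
        exact ha0 ((d.repUnit_mul_eq_iff hT hw₀ hg₀ hS₁ hS₂ (Finset.mk_mem_product ha hy)).1
          (hwsupp _ h0))
      rw [this, mul_zero]
  have hcard : Module.finrank ℂ V = C.card * S₂.card := by
    rw [hι.finrank_eq hΦ, Fintype.card_coe, Finset.card_product]
  have hC : (C.card : ℂ) ≠ 0 := by
    rw [Nat.cast_ne_zero, Finset.card_ne_zero]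
    exact ⟨(0, false), (d.frame.mem_chartFinset).2 ⟨hS₁.zero_mem, by simp⟩⟩
  have hS : (S₂.card : ℂ) ≠ 0 := by
    rw [Nat.cast_ne_zero, Finset.card_ne_zero]
    exact ⟨0, hS₂.zero_mem⟩
  have key := isCorrelationCoefficient_of_generators (hι.isInvariantInner_stdInner hΦ)
    (fun B hB => hι.eq_smul_stdInner hΦ (fun g hg => d.exists_char_conj_ne hg) hB) hv₀ hw
    (fun h0 => hC (by rw [← hvv, h0, map_zero]))
    (fun h0 => hS (by
      have := hww
      rw [h0, map_zero] at this
      simpa using this.symm)) hvgen hwgen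
  change IsCorrelationCoefficient π M T (‖B₀ v₀ w‖ ^ 2 / (‖B₀ v₀ v₀‖ * ‖B₀ w w‖)) at key
  rw [hvv, hww, hvw] at key
  convert key using 2
  rw [hcard, norm_mul, Complex.norm_natCast, Complex.norm_natCast]
  push_cast
  simp
  ring

end IsDatum

end Coefficient

end

section

open scoped Quaternion
open ValuativeRel

/-! ### Subfields, traces and ideals in coordinates -/

section Subalgebras

variable {F D : Type*} [Field F] [DivisionRing D] [Algebra F D]

theorem mem_adjoin_iff_of_mul_self {X : D} {s : F} (hX : X * X = algebraMap F D s) {x : D} :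
    x ∈ Algebra.adjoin F {X} ↔ ∃ a b : F, x = algebraMap F D a + b • X := by
  constructor
  · intro hx
    induction hx using Algebra.adjoin_induction with
    | mem x hx => exact ⟨0, 1, by rw [Set.mem_singleton_iff.1 hx]; simp⟩
    | algebraMap r => exact ⟨r, 0, by simp⟩
    | add x y _ _ hx hy =>
      obtain ⟨a, b, rfl⟩ := hx
      obtain ⟨a', b', rfl⟩ := hy
      refine ⟨a + a', b + b', ?_⟩
      rw [map_add, add_smul]
      abel
    | mul x y _ _ hx hy =>
      obtain ⟨a, b, rfl⟩ := hx
      obtain ⟨a', b', rfl⟩ := hy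
      refine ⟨a * a' + b * b' * s, a * b' + b * a', ?_⟩
      rw [map_add, map_mul _ (b * b'), ← hX, map_mul, ← Algebra.smul_def (b * b')]
      simp only [Algebra.algebraMap_eq_smul_one]
      simp only [mul_add, add_mul, smul_mul_assoc, mul_smul_comm, smul_smul, mul_one, one_mul,
        add_smul]
      module
  · rintro ⟨a, b, rfl⟩
    exact add_mem (algebraMap_mem _ a)
      ((Algebra.adjoin F {X}).smul_mem (Algebra.self_mem_adjoin_singleton F X) b)

variable {ϖ ε : F}

/-- A subalgebra is closed under inversion: `conj t = Trd(t) - t` lies in it, and `t⁻¹` is a scalar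
multiple of that. -/
theorem mem_torus_iff (e : D ≃ₐ[F] ℍ[F,ϖ,0,ε]) {E : Subalgebra F D} {t : Dˣ} :
    t ∈ torus E ↔ (t : D) ∈ E := by
  constructor
  · rintro ⟨y, rfl⟩
    exact (y : E).2
  · intro ht
    have hconj : conj e (t : D) ∈ E := by
      rw [conj_eq]
      exact sub_mem (algebraMap_mem _ _) ht
    have hmul := mul_conj e (t : D)
    have hn : nrd e (t : D) ≠ 0 := by
      intro h0
      rw [h0, map_zero, mul_eq_zero] at hmul
      have h1 := hmul.resolve_left t.ne_zero
      rw [conj, EmbeddingLike.map_eq_zero_iff, star_eq_zero, EmbeddingLike.map_eq_zero_iff] at h1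
      exact t.ne_zero h1
    have hinv : (t : D) * ((nrd e (t : D))⁻¹ • conj e (t : D)) = 1 := by
      rw [mul_smul_comm, hmul, Algebra.smul_def, ← map_mul, inv_mul_cancel₀ hn, map_one]
    have hinv' : ((t⁻¹ : Dˣ) : D) ∈ E := by
      rw [Units.mul_eq_one_iff_inv_eq.1 hinv]
      exact E.smul_mem hconj _
    exact ⟨⟨⟨t, ht⟩, ⟨_, hinv'⟩, Subtype.ext t.mul_inv, Subtype.ext t.inv_mul⟩, Units.ext rfl⟩

theorem isTorus_torus (e : D ≃ₐ[F] ℍ[F,ϖ,0,ε]) {E : Subalgebra F D} {X : D}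
    (hE : ∀ x, x ∈ E ↔ ∃ a b : F, x = algebraMap F D a + b • X) : IsTorus (torus E) X F :=
  fun _ => (mem_torus_iff e).trans (hE _)

theorem reducedTrace_eq (e : D ≃ₐ[F] ℍ[F,ϖ,0,ε]) (h2 : (2 : F) ≠ 0) (x : D) :
    reducedTrace F x = 2 * (e x).re := by
  have h1 : LinearMap.trace F D (LinearMap.mulLeft F x) = 4 * (e x).re := by
    set b := (QuaternionAlgebra.basisOneIJK ϖ 0 ε).map e.symm.toLinearEquiv with hb
    have hr : ∀ y, b.repr y = ![(e y).re, (e y).imI, (e y).imJ, (e y).imK] := fun y => rfl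
    have hb0 : ∀ i, e (b i) = ⟨if i = 0 then 1 else 0, if i = 1 then 1 else 0,
        if i = 2 then 1 else 0, if i = 3 then 1 else 0⟩ := by
      intro i
      have h3 := hr (b i)
      rw [b.repr_self, Finsupp.single_eq_pi_single] at h3
      have h4 := fun j => (congrFun h3 j).symm.trans (Pi.single_apply i (1 : F) j)
      ext
      · exact (h4 0).trans (by simp [eq_comm])
      · exact (h4 1).trans (by simp [eq_comm])
      · exact (h4 2).trans (by simp [eq_comm])
      · exact (h4 3).trans (by simp [eq_comm])
    rw [LinearMap.trace_eq_matrix_trace F b, Matrix.trace, Fin.sum_univ_four]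
    simp only [Matrix.diag_apply, LinearMap.toMatrix_apply, hr, LinearMap.mulLeft_apply, map_mul,
      hb0]
    simp
    ring
  rw [reducedTrace, h1]
  field_simp
  norm_num

variable {e : D ≃ₐ[F] ℍ[F,ϖ,0,ε]} {K : Subalgebra F D} (hK : Module.finrank F K = 2) {t : K}
  (ht : e (t : D) = ⟨0, 1, 0, 0⟩)
include hK ht

theorem exists_basis : ∃ b : Module.Basis (Fin 2) F K, ∀ y : K, b.repr y 0 = (e (y : D)).re ∧
    b.repr y 1 = (e (y : D)).imI ∧ jPart e (y : D) = 0 := by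
  have : FiniteDimensional F K := Module.finite_of_finrank_eq_succ hK
  let f : (Fin 2 → F) →ₗ[F] K :=
    { toFun := fun a => algebraMap F K (a 0) + a 1 • t
      map_add' := fun a a' => by
        rw [Pi.add_apply, Pi.add_apply, map_add, add_smul]
        abel
      map_smul' := fun r a => by
        rw [Pi.smul_apply, Pi.smul_apply, smul_eq_mul, map_mul, smul_eq_mul, mul_smul, smul_add,
          RingHom.id_apply, Algebra.smul_def r (algebraMap F K (a 0))] }
  have hf : ∀ a, e (f a : D) = ⟨a 0, a 1, 0, 0⟩ := by
    intro a
    change e (algebraMap F D (a 0) + a 1 • (t : D)) = _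
    rw [map_add, map_smul, ht, AlgEquiv.commutes]
    ext <;> simp [QuaternionAlgebra.algebraMap_eq]
  have hinj : Function.Injective f := by
    intro a a' h
    have h1 := (hf a).symm.trans ((congrArg (fun y : K => e (y : D)) h).trans (hf a'))
    have h2 := congrArg QuaternionAlgebra.re h1
    have h3 := congrArg QuaternionAlgebra.imI h1
    ext i
    fin_cases i
    · exact h2
    · exact h3
  have hsurj : Function.Surjective f :=
    (LinearMap.injective_iff_surjective_of_finrank_eq_finrank (by simp [hK])).1 hinj
  let E := LinearEquiv.ofBijective f ⟨hinj, hsurj⟩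
  refine ⟨Module.Basis.ofEquivFun E.symm, fun y => ?_⟩
  obtain ⟨a, rfl⟩ := hsurj y
  have hE : E.symm (f a) = a := E.symm_apply_apply a
  rw [Module.Basis.ofEquivFun_repr_apply, Module.Basis.ofEquivFun_repr_apply, hE,
    jPart_eq_zero_iff, hf]
  simp

theorem mem_subfield_iff (x : D) : x ∈ K ↔ jPart e x = 0 := by
  constructor
  · intro hx
    obtain ⟨b, hb⟩ := exists_basis hK ht
    exact (hb ⟨x, hx⟩).2.2
  · intro hx
    have h1 : x = algebraMap F D (e x).re + (e x).imI • (t : D) := by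
      rw [jPart_eq_zero_iff] at hx
      apply e.injective
      rw [map_add, map_smul, ht, AlgEquiv.commutes]
      ext <;> simp [QuaternionAlgebra.algebraMap_eq, hx]
    rw [h1]
    exact add_mem (algebraMap_mem _ _) (K.smul_mem t.2 _)

theorem mem_subfield_iff_exists (x : D) :
    x ∈ K ↔ ∃ a b : F, x = algebraMap F D a + b • (t : D) := by
  constructor
  · intro hx
    rw [mem_subfield_iff hK ht, jPart_eq_zero_iff] at hx
    refine ⟨(e x).re, (e x).imI, e.injective ?_⟩
    rw [map_add, map_smul, ht, AlgEquiv.commutes]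
    ext <;> simp [QuaternionAlgebra.algebraMap_eq, hx]
  · rintro ⟨a, b, rfl⟩
    exact add_mem (algebraMap_mem _ _) (K.smul_mem t.2 _)

theorem subfieldTrace_eq (y : K) : subfieldTrace K y = 2 * (e (y : D)).re := by
  obtain ⟨b, hb⟩ := exists_basis hK ht
  have hb0 : ∀ i, e (b i : D) = ⟨if i = 0 then 1 else 0, if i = 1 then 1 else 0, 0, 0⟩ := by
    intro i
    obtain ⟨h1, h2, h3⟩ := hb (b i)
    rw [jPart_eq_zero_iff] at h3
    rw [b.repr_self] at h1 h2
    ext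
    · rw [← h1, Finsupp.single_apply]
    · rw [← h2, Finsupp.single_apply]
    · exact h3.1
    · exact h3.2
  have hy := (jPart_eq_zero_iff e).1 (hb y).2.2
  rw [subfieldTrace, LinearMap.trace_eq_matrix_trace F b, Matrix.trace, Fin.sum_univ_two,
    Matrix.diag_apply, Matrix.diag_apply, LinearMap.toMatrix_apply, LinearMap.toMatrix_apply,
    (hb _).1, (hb _).2.1, LinearMap.mulLeft_apply, LinearMap.mulLeft_apply]
  change (e ((y : D) * (b 0 : K))).re + (e ((y : D) * (b 1 : K))).imI = _
  rw [map_mul, map_mul, hb0, hb0]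
  simp [hy]
  ring

end Subalgebras

namespace IsFrame

section Integrality

variable {F D : Type*} [Field F] [ValuativeRel F] [DivisionRing D] [Algebra F D] {ϖ ε : F}
  {e : D ≃ₐ[F] ℍ[F,ϖ,0,ε]} (h : IsFrame (valuation F) e) {u : Dˣ}
  (hu : h.normVal (u : D) = valuation F ϖ)
include h

theorem mem_integers {x : D} : x ∈ integers F ↔ h.normVal x ≤ 1 := h.isIntegral_iff

include hu

theorem mem_idealPow {x : D} {n : ℤ} :
    x ∈ idealPow F u n ↔ h.normVal x ≤ valuation F ϖ ^ n := by
  change ((u ^ (-n) : Dˣ) : D) * x ∈ integers F ↔ _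
  rw [h.mem_integers, map_mul, Units.val_zpow_eq_zpow_val, map_zpow₀, hu, zpow_neg,
    inv_mul_le_iff₀ (zpow_pos h.pos n), mul_one]

theorem mem_higherUnits {y : Dˣ} {n : ℕ} (hn : 1 ≤ n) :
    y ∈ higherUnits F u n ↔ h.normVal ((y : D) - 1) ≤ valuation F ϖ ^ n := by
  change _ ∧ _ ∧ _ ↔ _
  rw [h.mem_integers, h.mem_integers, h.mem_idealPow hu, zpow_natCast]
  refine ⟨fun hy => hy.2.2, fun hy => ?_⟩
  have hlt : h.normVal ((y : D) - 1) < 1 := hy.trans_lt (h.pow_lt_one hn)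
  have h1 : h.normVal (y : D) = 1 := by
    have := Valuation.map_one_add_of_lt h.normVal hlt
    rwa [add_sub_cancel] at this
  refine ⟨h1.le, ?_, hy⟩
  rw [Units.val_inv_eq_inv_val, map_inv₀, h1, inv_one]

end Integrality

end IsFrame

end

section

open scoped Quaternion
open ValuativeRel

/-! ### Unitarity of `ψ` -/

section Unitary

variable {F Γ₀ D : Type*} [Field F] [LinearOrderedCommGroupWithZero Γ₀] [DivisionRing D]
  [Algebra F D] {ϖ ε : F}

namespace IsFrame

variable {v : Valuation F Γ₀} {e : D ≃ₐ[F] ℍ[F,ϖ,0,ε]} (h : IsFrame v e)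
include h

theorem normVal_eq_one_of_sub_one {x : D} (hx : h.normVal (x - 1) < 1) : h.normVal x = 1 := by
  have := Valuation.map_one_add_of_lt h.normVal hx
  rwa [add_sub_cancel] at this

theorem normVal_pow_sub_one_le {x : D} (hx : h.normVal (x - 1) < 1) (n : ℕ) :
    h.normVal (x ^ n - 1) ≤ h.normVal (x - 1) := by
  rw [← geom_sum_mul, map_mul]
  refine mul_le_of_le_one_left' (h.normVal.map_sum_le fun i _ => ?_)
  rw [map_pow, h.normVal_eq_one_of_sub_one hx, one_pow]

/-- In `y ^ q - 1 = (∑ y ^ i) (y - 1)` the sum is congruent to `q`, hence to `0`; so each `q`-th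
power gains a level. -/
theorem normVal_pow_pow_sub_one_le {q : ℕ} (hq : v (q : F) < 1) {x : D}
    (hx : h.normVal (x - 1) < 1) (n : ℕ) : h.normVal (x ^ q ^ n - 1) ≤ v ϖ ^ (n + 1) := by
  induction n with
  | zero => simpa using h.normVal_le_of_lt_one hx
  | succ n ih =>
    have hlt : h.normVal (x ^ q ^ n - 1) < 1 := ih.trans_lt (h.pow_lt_one (by lia))
    set y := x ^ q ^ n
    have h1 : h.normVal (∑ i ∈ Finset.range q, y ^ i) < 1 := by
      have h2 : ∑ i ∈ Finset.range q, y ^ i = ∑ i ∈ Finset.range q, (y ^ i - 1) + (q : D) := by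
        simp
      rw [h2]
      refine h.normVal.map_add_lt (h.normVal.map_sum_lt one_ne_zero fun i _ =>
        (h.normVal_pow_sub_one_le hlt i).trans_lt hlt) ?_
      rw [← map_natCast (algebraMap F D), h.normVal_algebraMap]
      exact pow_lt_one₀ zero_le hq _root_.two_ne_zero
    rw [pow_succ, pow_mul, ← geom_sum_mul, map_mul, pow_succ' (v ϖ)]
    exact mul_le_mul' (h.normVal_le_of_lt_one h1) ih

/-- The fourth power of an element `y` of `K` is congruent to the square of its norm. -/
theorem normVal_pow_four_sub_lt {y : D} (hy0 : y ≠ 0) (hy : jPart e y = 0) :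
    h.normVal ((nrd e y ^ 2)⁻¹ • y ^ 4 - 1) < 1 := by
  rw [jPart_eq_zero_iff] at hy
  have hn := h.nrd_ne_zero hy0
  have hn2 : nrd e y ^ 2 ≠ 0 := pow_ne_zero 2 hn
  have h1 : (nrd e y ^ 2)⁻¹ • y ^ 4 - 1 =
      (nrd e y ^ 2)⁻¹ • (y ^ 4 - algebraMap F D (nrd e y ^ 2)) := by
    rw [smul_sub, Algebra.algebraMap_eq_smul_one, smul_smul, inv_mul_cancel₀ hn2, one_smul]
  set a := (e y).re with ha
  set b := (e y).imI with hb
  have hy' : e y = ⟨a, b, 0, 0⟩ := by ext <;> simp [ha, hb, hy]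
  have hN : nrd e y = a ^ 2 - ϖ * b ^ 2 := by
    rw [nrd, hy']
    simp
  -- The norm squared is `y ^ 2 (conj y) ^ 2`, and for `y = a + b i` one has `y ^ 2 - (conj y) ^ 2 =
  -- 4 a b i`.
  have h4 : y ^ 4 - algebraMap F D (nrd e y ^ 2) = y * y * e.symm ⟨0, 4 * a * b, 0, 0⟩ := by
    apply e.injective
    rw [map_sub, map_pow, map_mul, map_mul, AlgEquiv.apply_symm_apply, AlgEquiv.commutes, hy', hN]
    ext <;> simp [pow_succ, QuaternionAlgebra.algebraMap_eq] <;> ring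
  have hyn : h.normVal y = max (v a ^ 2) (v ϖ * v b ^ 2) := by
    rw [h.normVal_eq, hy']
    simp
  have hyn0 : h.normVal y ≠ 0 := (Valuation.ne_zero_iff _).2 hy0
  have hlt : v a ^ 2 * (v ϖ * v b ^ 2) < h.normVal y ^ 2 := by
    have hne : v a ^ 2 ≠ v ϖ * v b ^ 2 := by
      intro hab
      have hb0 := h.eq_zero_of_mul_sq_eq hab.symm
      rw [hab, hb0] at hyn
      simp [hyn] at hyn0
    rw [hyn] at hyn0 ⊢
    rw [sq (max _ _)]
    rcases lt_or_gt_of_ne hne with hlt | hlt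
    · rw [max_eq_right hlt.le] at hyn0 ⊢
      exact mul_lt_mul_of_pos_right hlt (zero_lt_iff.2 hyn0)
    · rw [max_eq_left hlt.le] at hyn0 ⊢
      exact mul_lt_mul_of_pos_left hlt (zero_lt_iff.2 hyn0)
  have h5 : h.normVal (e.symm ⟨0, 4 * a * b, 0, 0⟩) = v a ^ 2 * (v ϖ * v b ^ 2) := by
    have h6 : (4 : F) = 2 * 2 := by norm_num
    rw [h.normVal_eq, AlgEquiv.apply_symm_apply, h6]
    simp only [map_mul, h.two, map_zero]
    simp [mul_pow, mul_left_comm]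
  have h7 : v (nrd e y) = h.normVal y := rfl
  rw [h1, h4, h.normVal_smul, map_mul, map_mul, h5, map_inv₀, map_pow, h7, ← sq]
  have h8 : (h.normVal y ^ 2)⁻¹ ^ 2 * (h.normVal y ^ 2 * h.normVal y ^ 2) = 1 := by
    rw [← sq, ← mul_pow, inv_mul_cancel₀ (pow_ne_zero 2 hyn0), one_pow]
  rw [← h8]
  exact mul_lt_mul_of_pos_left (mul_lt_mul_of_pos_left hlt (zero_lt_iff.2 (pow_ne_zero 2 hyn0)))
    (zero_lt_iff.2 (pow_ne_zero 2 (inv_ne_zero (pow_ne_zero 2 hyn0))))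

/-- A character of `Kˣ` which is trivial on `Fˣ` and on an open subgroup has finite order. -/
theorem norm_map_eq_one {q : ℕ} (hq0 : q ≠ 0) (hq : v (q : F) < 1) {K : Subalgebra F D}
    (hK : ∀ y : K, jPart e (y : D) = 0) {ψ : Kˣ →* ℂˣ} (hψ : ∀ a : Fˣ, ψ (scalarUnits K a) = 1)
    {n : ℕ} (hn : ∀ y : Kˣ, h.normVal ((y : K) - 1 : D) ≤ v ϖ ^ n → ψ y = 1) (y : Kˣ) :
    ‖(ψ y : ℂ)‖ = 1 := by
  have hy0 : ((y : K) : D) ≠ 0 := fun h0 => y.ne_zero (Subtype.ext h0)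
  set r : Fˣ := Units.mk0 ((nrd e ((y : K) : D) ^ 2)⁻¹)
    (inv_ne_zero (pow_ne_zero 2 (h.nrd_ne_zero hy0))) with hr
  -- Up to a scalar, `y ^ 4` lies in `1 + 𝒫_K`, and its `q ^ n`-th power falls into the subgroup
  -- where `ψ` is trivial; so `ψ y` is a root of unity.
  set z : Kˣ := scalarUnits K r * y ^ 4 with hz
  have hzD : ((z : K) : D) = (nrd e ((y : K) : D) ^ 2)⁻¹ • ((y : K) : D) ^ 4 := by
    rw [Algebra.smul_def]
    rfl
  have h1 : ψ (z ^ q ^ n) = 1 := by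
    apply hn
    have h2 : (((z ^ q ^ n : Kˣ) : K) : D) = ((z : K) : D) ^ q ^ n := rfl
    rw [h2]
    refine (h.normVal_pow_pow_sub_one_le hq ?_ n).trans (h.pow_le_pow.2 (Nat.le_succ n))
    rw [hzD]
    exact h.normVal_pow_four_sub_lt hy0 (hK _)
  have h2 : ψ y ^ (4 * q ^ n) = 1 := by
    rw [← h1, map_pow, hz, map_mul, hψ, one_mul, map_pow, pow_mul]
  refine Complex.norm_eq_one_of_pow_eq_one (n := 4 * q ^ n) ?_ (by positivity)
  rw [← Units.val_pow_eq_pow_val, h2, Units.val_one]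

end IsFrame

end Unitary

end

section

open scoped Quaternion
open ValuativeRel

theorem IsUniformizer.le_zpow_of_sq_le {F Γ₀ : Type*} [Field F] [LinearOrderedCommGroupWithZero Γ₀]
    {v : Valuation F Γ₀} {ϖ : F} (h : IsUniformizer v ϖ) {x : F} {n : ℤ}
    (hx : v x ^ 2 ≤ v ϖ ^ n) : v x ≤ v ϖ ^ ((n + 1) / 2) := by
  rcases eq_or_ne x 0 with rfl | hx0
  · simp
  · obtain ⟨m, hm⟩ := h.exists_zpow x hx0
    rw [hm, ← zpow_natCast, ← zpow_mul, h.zpow_le_zpow] at hx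
    rw [hm, h.zpow_le_zpow]
    lia

theorem IsUniformizer.le_zpow_of_mul_sq_le {F Γ₀ : Type*} [Field F]
    [LinearOrderedCommGroupWithZero Γ₀] {v : Valuation F Γ₀} {ϖ : F} (h : IsUniformizer v ϖ) {x : F}
    {n : ℤ} (hx : v ϖ * v x ^ 2 ≤ v ϖ ^ n) : v x ≤ v ϖ ^ (n / 2) := by
  rcases eq_or_ne x 0 with rfl | hx0
  · simp
  · obtain ⟨m, hm⟩ := h.exists_zpow x hx0
    rw [hm, ← zpow_natCast, ← zpow_mul, ← zpow_one_add₀ h.pos.ne', h.zpow_le_zpow] at hx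
    rw [hm, h.zpow_le_zpow]
    lia

/-! ### From the associated representation to an induced model -/

section Datum

variable {F D : Type*} [Field F] [ValuativeRel F] [DivisionRing D] [Algebra F D] {ϖ ε : F}
  {e : D ≃ₐ[F] ℍ[F,ϖ,0,ε]} {K : Subalgebra F D} {ϖK : Kˣ} {ψ : Kˣ →* ℂˣ} {ψ₀ : AddChar F ℂ}
  {c : K} {k : ℕ}

theorem normVal_unitsIncl (h : IsFrame (valuation F) e) (ht : e ((ϖK : K) : D) = ⟨0, 1, 0, 0⟩) :
    h.normVal (unitsIncl K ϖK : D) = valuation F ϖ := by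
  change h.normVal ((ϖK : K) : D) = _
  rw [h.normVal_eq, ht]
  simp

/-- The imaginary part of the coefficient `c` has the smallest valuation allowed by the conductor
of `ψ`. -/
theorem valuation_coeff_eq (h : IsFrame (valuation F) e)
    (hk : 1 ≤ k) (hK : ∀ y : K, jPart e (y : D) = 0)
    (hψ₀ : ∀ x, valuation F x ≤ 1 → ψ₀ x = 1)
    (hc : h.normVal (c : D) ≤ valuation F ϖ ^ (-(2 * k : ℕ) - 1 : ℤ))
    (hmap : ∀ y : Kˣ, h.normVal (((y : K) : D) - 1) ≤ valuation F ϖ ^ k →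
      (ψ y : ℂ) = ψ₀ (2 * (e ((c : D) * (((y : K) : D) - 1))).re))
    (hne : ¬ ∀ y : Kˣ, h.normVal (((y : K) : D) - 1) ≤ valuation F ϖ ^ (2 * k - 1) → ψ y = 1) :
    valuation F (e (c : D)).imI = valuation F ϖ ^ (-(k : ℤ) - 1) := by
  set p := valuation F ϖ with hp
  have hp0 : p ≠ 0 := h.pos.ne'
  have hcJ := (jPart_eq_zero_iff e).1 (hK c)
  rw [h.normVal_eq_max, hK, map_zero, max_eq_left zero_le, h.normVal_kPart, max_le_iff] at hc
  have hc0 : valuation F (e (c : D)).re ≤ p ^ (-k : ℤ) := by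
    have := h.le_zpow_of_sq_le hc.1
    rwa [show (-(2 * k : ℕ) - 1 + 1 : ℤ) / 2 = -k by lia] at this
  have hc1 : valuation F (e (c : D)).imI ≤ p ^ (-(k : ℤ) - 1) := by
    have := h.le_zpow_of_mul_sq_le hc.2
    rwa [show (-(2 * k : ℕ) - 1 : ℤ) / 2 = -k - 1 by lia] at this
  refine le_antisymm hc1 ?_
  -- Were the `i`-coordinate of `c` one step smaller, both terms of the trace would be integral on
  -- `1 + 𝒫_K ^ (2 k - 1)`, and `ψ` would already be trivial there.
  refine h.zpow_succ_le_of_lt (n := -k) fun hlt => hne fun y hy => ?_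
  have hy' := hy
  rw [h.normVal_eq_max, jPart_sub, hK, jPart_one, sub_zero, map_zero, max_eq_left zero_le,
    h.normVal_kPart, max_le_iff, h.sq_le_iff, h.mul_sq_le_iff] at hy'
  apply Units.ext
  rw [hmap y (hy.trans (h.pow_le_pow.2 (by lia))), Units.val_one]
  apply hψ₀
  set x := e (((y : K) : D) - 1)
  have hre : (e (c : D) * x).re = (e (c : D)).re * x.re + ϖ * ((e (c : D)).imI * x.imI) := by
    rw [QuaternionAlgebra.re_mul, hcJ.1, hcJ.2]
    ring
  rw [map_mul, h.two, one_mul, map_mul, hre]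
  refine (Valuation.map_add _ _ _).trans (max_le ?_ ?_)
  · rw [map_mul]
    refine (mul_le_mul' hc0 hy'.1).trans_eq ?_
    rw [← zpow_natCast, ← zpow_add₀ hp0, ← zpow_zero p]
    congr 1
    lia
  · rw [map_mul, map_mul]
    refine (mul_le_mul_right (mul_le_mul' hlt hy'.2) _).trans_eq ?_
    rw [← zpow_natCast, ← zpow_add₀ hp0, ← zpow_one_add₀ hp0, ← zpow_zero p]
    congr 1
    lia

theorem isDatum {ϖF : 𝒪[F]} {ε : F} {e : D ≃ₐ[F] ℍ[F,(ϖF : F),0,ε]}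
    (h : IsFrame (valuation F) e) (hq : valuation F (residueCard F : F) < 1)
    (hq0 : residueCard F ≠ 0) (hfin : Module.finrank F K = 2)
    (ht : e ((ϖK : K) : D) = ⟨0, 1, 0, 0⟩) (hψ : ∀ a : Fˣ, ψ (scalarUnits K a) = 1) (hk : 1 ≤ k)
    (hcond : HasConductor K ϖK ψ (2 * k)) (hψ₀ : AddConductorZero ϖF ψ₀)
    (hc : (c : D) ∈ idealPow F (unitsIncl K ϖK) (-(2 * k : ℕ) - 1))
    (hmap : ∀ y : Kˣ, unitsIncl K y ∈ higherUnits F (unitsIncl K ϖK) k →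
      (ψ y : ℂ) = ψ₀ (subfieldTrace K (c * ((y : K) - 1)))) :
    IsDatum (valuation F) e K ϖK ψ ψ₀ c k := by
  have hu := normVal_unitsIncl h ht
  have hK : ∀ y : K, jPart e (y : D) = 0 := fun y => (mem_subfield_iff hfin ht y).1 y.2
  have hunits : ∀ {n : ℕ}, 1 ≤ n → ∀ y : Kˣ, unitsIncl K y ∈ higherUnits F (unitsIncl K ϖK) n ↔
      h.normVal (((y : K) : D) - 1) ≤ valuation F (ϖF : F) ^ n :=
    fun hn y => h.mem_higherUnits hu hn
  have hone : ∀ y : Kˣ, h.normVal (((y : K) : D) - 1) ≤ valuation F (ϖF : F) ^ (2 * k) →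
      ψ y = 1 := fun y hy => hcond.1 y ((hunits (by lia) y).2 hy)
  have hmap' : ∀ y : Kˣ, h.normVal (((y : K) : D) - 1) ≤ valuation F (ϖF : F) ^ k →
      (ψ y : ℂ) = ψ₀ (2 * (e ((c : D) * (((y : K) : D) - 1))).re) := fun y hy => by
    rw [hmap y ((hunits hk y).2 hy), subfieldTrace_eq hfin ht]
    rfl
  have hint : ∀ x, valuation F x ≤ 1 → ψ₀ x = 1 := fun x hx => hψ₀.1 ⟨x, hx⟩
  exact {
    frame := h
    one_le := hk
    map_unif := ht
    mem_iff := mem_subfield_iff hfin ht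
    map_scalar := hψ
    map_eq_one := hone
    map_eq := hmap'
    norm_map := h.norm_map_eq_one hq0 hq hK hψ hone
    exists_ne_one := let ⟨x, hx⟩ := hψ₀.2; ⟨x, x.2, hx⟩
    val_coeff := valuation_coeff_eq h hk hK hint ((h.mem_idealPow hu).1 hc) hmap' fun hn => by
      have h1 : TrivialOnLevel K ϖK ψ (2 * k - 1) :=
        fun y hy => hn y ((hunits (by lia) y).1 hy)
      have h2 : 2 * k ≤ 2 * k - 1 := hcond.2 h1
      lia }

/-- Each `h` in the level subgroup factors as `y u` with `y` its `K`-part and `u ∈ 1 + 𝒫_D ^ k`. The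
rule defining `inducedSpace` is thus equivariance under the single function `d.char`. -/
theorem isInducedModel (d : IsDatum (valuation F) e K ϖK ψ ψ₀ c k) {V : Type*} [AddCommGroup V]
    [Module ℂ V] {π : Representation ℂ Dˣ V}
    (E : Representation.Equiv π (inducedRep K ϖK ψ ψ₀ c k)) :
    IsInducedModel π d.group d.char
      ((inducedSpace K ϖK ψ ψ₀ c k).subtype ∘ₗ (E.toLinearEquiv : V →ₗ[ℂ] _)) := by
  have hu := normVal_unitsIncl d.frame d.map_unif
  have hψ₀ : ∀ u : Dˣ, d.frame.normVal ((u : D) - 1) ≤ valuation F ϖ ^ k →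
      ψ₀ (reducedTrace F ((c : D) * ((u : D) - 1))) = d.char u := fun u hu' => by
    rw [d.char_of_sub_one hu', reducedTrace_eq e d.frame.two_ne_zero]
  constructor
  · exact Subtype.val_injective.comp E.toLinearEquiv.injective
  · intro f hf
    refine ⟨E.toLinearEquiv.symm ⟨f, fun y u hu' g => ?_⟩, ?_⟩
    · rw [d.frame.mem_higherUnits hu d.one_le] at hu'
      have h1 : unitsIncl K y ∈ d.group :=
        d.frame.mem_levelSubgroup_of_jPart_eq_zero d.one_le (d.jPart_coe _)
      have h2 := d.mem_group_of_sub_one hu'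
      rw [hf _ (d.group.mul_mem h1 h2), d.char_mul h1 h2, hψ₀ u hu', d.char_coe (y := y) rfl]
    · exact congrArg Subtype.val (E.toLinearEquiv.apply_symm_apply _)
  · intro w h hh g
    obtain ⟨y, hy, hχ⟩ := d.exists_char_eq hh
    set u : Dˣ := (unitsIncl K y)⁻¹ * h with hudef
    have h1 : unitsIncl K y ∈ d.group :=
      d.frame.mem_levelSubgroup_of_jPart_eq_zero d.one_le (d.jPart_coe _)
    have hhu : unitsIncl K y * u = h := mul_inv_cancel_left _ _
    have huk : d.frame.normVal ((u : D) - 1) ≤ valuation F ϖ ^ k := by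
      have h3 : ((unitsIncl K y : Dˣ) : D) * ((u : D) - 1) = h - kPart e (h : D) := by
        rw [mul_sub, ← Units.val_mul, hhu, mul_one, ← hy]
        rfl
      have h4 : d.frame.normVal ((h : D) - kPart e (h : D)) = d.frame.normVal (jPart e (h : D)) := by
        rw [d.frame.normVal_eq_max, kPart_sub, jPart_sub, jPart_kPart, sub_zero,
          kPart_of_jPart_eq_zero e (jPart_kPart _ _), sub_self, map_zero, max_eq_right zero_le]
      have h5 := congrArg d.frame.normVal h3
      have h6 : d.frame.normVal (unitsIncl K y : D) = d.frame.normVal (kPart e (h : D)) := by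
        rw [← hy]
        rfl
      have h7 : 0 < d.frame.normVal (kPart e (h : D)) :=
        zero_lt_iff.2 ((Valuation.ne_zero_iff _).2 (d.frame.kPart_ne_zero_of_mem d.one_le hh))
      have h8 := (d.frame.mem_levelSubgroup d.one_le).1 hh
      rwa [← h4, ← h5, map_mul, h6, mul_comm, mul_le_mul_iff_left₀ h7] at h8
    have h2 := (E.toLinearEquiv w).2 y u ((d.frame.mem_higherUnits hu d.one_le).2 huk) g
    rw [hhu, hψ₀ u huk, ← d.char_coe (g := unitsIncl K y) rfl,
      ← d.char_mul h1 (d.mem_group_of_sub_one huk), hhu] at h2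
    exact h2
  · intro g w x
    have h1 := LinearMap.congr_fun (E.toIntertwiningMap.isIntertwining' g) w
    have h2 := congrFun (congrArg Subtype.val h1) x
    exact h2
  · exact fun h hh h' hh' => d.char_mul hh hh'
  · exact fun h hh => d.norm_char hh

end Datum

end

section

open scoped Quaternion
open ValuativeRel

/-! ### The ramified tori and the final values -/

section RamifiedTori

variable {F Γ₀ D : Type*} [Field F] [LinearOrderedCommGroupWithZero Γ₀] [DivisionRing D]
  [Algebra F D] {ϖ ε : F}

theorem mul_self_of_map_eq (e : D ≃ₐ[F] ℍ[F,ϖ,0,ε]) {X : D} {a b : F} (hX : e X = ⟨0, a, 0, b⟩) :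
    X * X = algebraMap F D (ϖ * (a ^ 2 - ε * b ^ 2)) := by
  apply e.injective
  rw [map_mul, hX, AlgEquiv.commutes]
  ext <;> simp [QuaternionAlgebra.algebraMap_eq] <;> ring

theorem IsFrame.normVal_eq_of_map_eq {v : Valuation F Γ₀} {e : D ≃ₐ[F] ℍ[F,ϖ,0,ε]}
    (h : IsFrame v e) {X : D} {a b : F} (hX : e X = ⟨0, a, 0, b⟩)
    (hab : v (a ^ 2 - ε * b ^ 2) = 1) : h.normVal X = v ϖ := by
  rw [h.aniso] at hab
  rw [h.normVal_eq, hX]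
  simp [← mul_max, hab]

namespace IsDatum

variable {v : Valuation F Γ₀} {e : D ≃ₐ[F] ℍ[F,ϖ,0,ε]} {K : Subalgebra F D} {ϖK : Kˣ}
  {ψ : Kˣ →* ℂˣ} {ψ₀ : AddChar F ℂ} {c : K} {k : ℕ} (d : IsDatum v e K ϖK ψ ψ₀ c k)
  {V : Type*} [AddCommGroup V] [Module ℂ V] {π : Representation ℂ Dˣ V}
  {ι : V →ₗ[ℂ] (Dˣ → ℂ)} (hι : IsInducedModel π d.group d.char ι)
  {M T : Subgroup Dˣ} (hM : IsTorus M (jUnit e : D) F)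
  {S₁ S₂ : Finset F} (hS₁ : IsResidueSystem v ϖ (k - k / 2) S₁)
  (hS₂ : IsResidueSystem v ϖ (k / 2) S₂)
  {X : D} (hT : IsTorus T X F) {a b : F} (hX : e X = ⟨0, a, 0, b⟩)
  (hab : v (a ^ 2 - ε * b ^ 2) = 1)
include hι hM hS₁ hS₂ hT hX hab

/-- The correlation coefficient of `M` and the ramified torus generated by `X`, if `X` is
conjugate to a multiple of `ij` under `m + nj`. -/
theorem isCorrelationCoefficient_of_conj {w₀ m n : F} (hm : m ≠ 0)
    (h1 : m * a - ε * n * b = ε * w₀ * n) (h2 : m * b - n * a = w₀ * m)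
    (hw₀ : a ^ 2 - ε * b ^ 2 = -(ε * w₀ ^ 2)) :
    IsCorrelationCoefficient π M T
      (‖1 + (ψ ϖK : ℂ)⁻¹‖ ^ 2 / (2 * Module.finrank ℂ V)) := by
  have hab0 : a ^ 2 - ε * b ^ 2 ≠ 0 := by
    intro h0
    simp [h0] at hab
  have hw₀0 : w₀ ≠ 0 := by
    rintro rfl
    simp [hw₀] at hab0
  have hg : e.symm ⟨m, 0, n, 0⟩ ≠ 0 := by
    intro h0
    rw [EmbeddingLike.map_eq_zero_iff] at h0
    exact hm (congrArg QuaternionAlgebra.re h0)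
  -- `h1` and `h2` are the `i`- and `i j`-coordinates of `g₀ X = (w₀ i j) g₀` for `g₀ = m + n j ∈
  -- M`; `hw₀` says that `X` and `w₀ i j` have the same square.
  refine d.isCorrelationCoefficient hι hM hS₁ hS₂ hT (by rw [hX]) hw₀0
    (mul_ne_zero d.frame.ne_zero hab0) (d.frame.normVal_eq_of_map_eq hX hab)
    (mul_self_of_map_eq e hX) ?_ (g₀ := Units.mk0 _ hg) ?_ ?_
  · rw [mul_self_of_map_eq e (e.apply_symm_apply _), hw₀]
    congr 1
    ring
  · rw [mem_unramified_iff hM, Units.val_mk0, AlgEquiv.apply_symm_apply]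
    exact ⟨rfl, rfl⟩
  · apply e.injective
    rw [map_mul, map_mul, Units.val_mk0, hX, AlgEquiv.apply_symm_apply, AlgEquiv.apply_symm_apply]
    ext
    · simp
    · simp only [QuaternionAlgebra.imI_mul]
      linear_combination h1
    · simp
    · simp only [QuaternionAlgebra.imK_mul]
      linear_combination h2

theorem isCorrelationCoefficient_eq_zero_of_val
    (hx : ∀ x, 1 ≤ v (a ^ 2 - ε * b ^ 2 + ε * x ^ 2)) : IsCorrelationCoefficient π M T 0 := by
  refine d.isCorrelationCoefficient_eq_zero hι hM hS₁ hS₂ fun w hw => ?_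
  have := d.one_le
  exact d.eq_zero_of_mem_fixedVectors hι hT (by rw [hX]) (mul_self_of_map_eq e hX) (j := 1)
    (n := k / 2) (by rw [d.frame.normVal_eq_of_map_eq hX hab, pow_one]) rfl (by lia) (by lia) rfl
    hx hw

end IsDatum

end RamifiedTori

theorem norm_one_add_inv_sq_div {z : ℂˣ} (hz : z = 1 ∨ z = -1) (n : ℕ) [Decidable (z = 1)] :
    ‖1 + (z : ℂ)⁻¹‖ ^ 2 / (2 * n) = if z = 1 then 2 / (n : ℝ) else 0 := by
  rcases hz with rfl | rfl
  · rw [if_pos rfl, Units.val_one, inv_one, one_add_one_eq_two, Complex.norm_two]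
    rcases eq_or_ne (n : ℝ) 0 with h0 | h0
    · simp [h0]
    · field_simp
  · have h1 : (-1 : ℂˣ) ≠ 1 := by
      intro h
      have := congrArg Units.val h
      norm_num at this
    rw [if_neg h1]
    norm_num

end

end ToricPeriods

end

theorem theorem1p3
    {F : Type*} [Field F] [ValuativeRel F] [TopologicalSpace F]
    [IsNonarchimedeanLocalField F] [CharZero F]
    (hodd : Odd (ToricPeriods.residueCard F))
    {D : Type*} [DivisionRing D] [Algebra F D] [Algebra.IsCentral F D]
    (hD : Module.finrank F D = 4)
    -- the ramified quadratic extension `K = F(ϖ)`, where `ϖ ^ 2 = ϖF` is a uniformizer of `F`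
    (K : Subalgebra F D) (hK : Module.finrank F K = 2)
    (ϖF : 𝒪[F]) (hϖF : Irreducible ϖF)
    (ϖ : Kˣ) (hϖ : (ϖ : K) ^ 2 = algebraMap F K (ϖF : F))
    -- a primitive `(q ^ 2 - 1)`-st root of unity with `ϖ ζ ϖ⁻¹ = ζ ^ q`
    (ζ : Dˣ) (hζ : orderOf ζ = ToricPeriods.residueCard F ^ 2 - 1)
    (hϖζ : ToricPeriods.unitsIncl K ϖ * ζ * (ToricPeriods.unitsIncl K ϖ)⁻¹ =
      ζ ^ ToricPeriods.residueCard F)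
    -- the unramified extension `M = F(ζ)` and the other ramified extension `L = F(ζ ϖ)`
    (M L : Subalgebra F D) (hM : M = Algebra.adjoin F {(ζ : D)})
    (hL : L = Algebra.adjoin F {(ζ : D) * ((ϖ : K) : D)})
    -- the representation `π`, associated to the character `ψ` of `Kˣ`, trivial on `Fˣ`
    (ψ : Kˣ →* ℂˣ) (hψ : ∀ a : Fˣ, ψ (ToricPeriods.scalarUnits K a) = 1)
    {V : Type*} [AddCommGroup V] [Module ℂ V] (π : Representation ℂ Dˣ V)
    (hπ : ToricPeriods.IsAssociated ϖF K ϖ ψ π) :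
    (ψ ϖ = 1 ∨ ψ ϖ = -1) ∧
    ToricPeriods.IsCorrelationCoefficient π (ToricPeriods.torus M) (ToricPeriods.torus K)
      (open Classical in
        if ToricPeriods.residueCard F ≡ 3 [MOD 4] ∧ ψ ϖ = 1 then
          2 / (Module.finrank ℂ V : ℝ) else 0) ∧
    ToricPeriods.IsCorrelationCoefficient π (ToricPeriods.torus M) (ToricPeriods.torus L)
      (open Classical in
        if ToricPeriods.residueCard F ≡ 1 [MOD 4] ∧ ψ ϖ = 1 then
          2 / (Module.finrank ℂ V : ℝ) else 0) := by
  open ValuativeRel ToricPeriods in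
  classical
  have htt : ((unitsIncl K ϖ : Dˣ) : D) * (unitsIncl K ϖ : Dˣ) = algebraMap F D (ϖF : F) := by
    have := congrArg Subtype.val hϖ
    rwa [sq] at this
  obtain ⟨ε, e, h, ht, hδ, ⟨z₀, z₂, heζ, hz₀, hz⟩, h1, h3⟩ :=
    exists_frame hodd hD hϖF htt hζ hϖζ
  obtain ⟨m, ψ₀, c, hm, hcond, -, hψ₀, hc, hmap, ⟨E⟩⟩ := hπ
  generalize hk : (m + 1) / 2 = k at hmap E
  obtain ⟨r, hr⟩ := hm
  have hk1 : 1 ≤ k := by lia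
  have hm1 : m + 1 = 2 * k := by lia
  have hm2 : -(m : ℤ) - 2 = -(2 * k : ℕ) - 1 := by lia
  rw [hm1] at hcond
  rw [hm2] at hc
  have d : IsDatum (valuation F) e K ϖ ψ ψ₀ c k :=
    isDatum h valuation_residueCard_lt_one hodd.pos.ne' hK ht hψ hk1 hcond hψ₀ hc hmap
  have hι := isInducedModel d E
  obtain ⟨S₁, hS₁⟩ := exists_isResidueSystem hϖF (k - k / 2)
  obtain ⟨S₂, hS₂⟩ := exists_isResidueSystem hϖF (k / 2)
  have hjj : (jUnit e : D) * jUnit e = algebraMap F D ε := by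
    apply e.injective
    rw [map_mul, map_jUnit, AlgEquiv.commutes]
    ext <;> simp [QuaternionAlgebra.algebraMap_eq]
  have hζj : (ζ : D) = algebraMap F D z₀ + z₂ • (jUnit e : D) := by
    apply e.injective
    rw [heζ, map_add, map_smul, map_jUnit, AlgEquiv.commutes]
    ext <;> simp [QuaternionAlgebra.algebraMap_eq]
  have hjζ : (jUnit e : D) = (ζ : D) ^ ((residueCard F + 1) / 2) := by
    apply e.injective
    rw [map_jUnit, ← hδ, Units.val_pow_eq_pow_val]
  have hM' : M = Algebra.adjoin F {(jUnit e : D)} := by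
    rw [hM]
    refine le_antisymm (Algebra.adjoin_le ?_) (Algebra.adjoin_le ?_)
    · rw [Set.singleton_subset_iff, SetLike.mem_coe, mem_adjoin_iff_of_mul_self hjj]
      exact ⟨z₀, z₂, hζj⟩
    · rw [Set.singleton_subset_iff, SetLike.mem_coe, hjζ]
      exact pow_mem (Algebra.self_mem_adjoin_singleton F (ζ : D)) _
  have hMT : IsTorus (torus M) (jUnit e : D) F := by
    rw [hM']
    exact isTorus_torus e fun x => mem_adjoin_iff_of_mul_self hjj
  have hKT : IsTorus (torus K) ((ϖ : K) : D) F :=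
    isTorus_torus e (mem_subfield_iff_exists hK ht)
  have htK : e ((ϖ : K) : D) = ⟨0, 1, 0, 0⟩ := ht
  -- `(z₀ + z₂ j) i = z₀ i - z₂ i j`; the sign comes from anticommutation.
  have hX : e ((ζ : D) * ((ϖ : K) : D)) = ⟨0, z₀, 0, -z₂⟩ := by
    rw [map_mul, heζ, htK]
    ext <;> simp
  have hLT : IsTorus (torus L) ((ζ : D) * ((ϖ : K) : D)) F := by
    rw [hL]
    exact isTorus_torus e fun x => mem_adjoin_iff_of_mul_self (mul_self_of_map_eq e hX)
  have hz' : z₀ ^ 2 - ε * (-z₂) ^ 2 = ε := by rw [neg_sq, hz]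
  have hvK : valuation F (1 ^ 2 - ε * 0 ^ 2) = 1 := by simp
  have hvL : valuation F (z₀ ^ 2 - ε * (-z₂) ^ 2) = 1 := by rw [hz', h.unit]
  have hψϖ : ψ ϖ = 1 ∨ ψ ϖ = -1 := by
    have h2 : ϖ * ϖ = scalarUnits K (Units.mk0 (ϖF : F) h.ne_zero) :=
      Units.ext (by rw [Units.val_mul, ← sq, hϖ]; rfl)
    have h4 : (ψ ϖ : ℂ) * ψ ϖ = 1 := by
      rw [← Units.val_mul, ← map_mul, h2, hψ, Units.val_one]
    exact (mul_self_eq_one_iff.1 h4).imp Units.ext Units.ext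
  have hnorm := norm_one_add_inv_sq_div hψϖ (Module.finrank ℂ V)
  have hq := Nat.odd_mod_four_iff.1 (Nat.odd_iff.1 hodd)
  refine ⟨hψϖ, ?_⟩
  rcases hq with hq | hq
  · obtain ⟨i, hi⟩ := h1 hq
    have hn3 : ¬ residueCard F ≡ 3 [MOD 4] := by
      rw [Nat.ModEq, hq]
      decide
    have hvi : valuation F i = 1 := by
      have := congrArg (valuation F) hi
      rw [map_pow, Valuation.map_neg, map_one] at this
      exact (pow_eq_one_iff_of_nonneg zero_le two_ne_zero).1 this
    constructor
    · rw [if_neg fun h0 => hn3 h0.1]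
      refine d.isCorrelationCoefficient_eq_zero_of_val hι hMT hS₁ hS₂ hKT htK hvK fun x => ?_
      -- As `-1 = i ^ 2`, the obstruction is the anisotropic norm form with a unit entry.
      have h2 : (1 : F) ^ 2 - ε * 0 ^ 2 + ε * x ^ 2 = -(i ^ 2 - ε * x ^ 2) := by rw [hi]; ring
      rw [h2, Valuation.map_neg, h.aniso, hvi, one_pow]
      exact le_max_left _ _
    · have h2 : residueCard F ≡ 1 [MOD 4] := hq
      simp only [h2, true_and]
      rw [← hnorm]
      -- Here `a ^ 2 - ε b ^ 2 = ε`, so `w₀` has to be a square root of `-1`. With `m = z₀`,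
      -- nonzero, the `i j`-coordinate equation gives `n`.
      refine d.isCorrelationCoefficient_of_conj hι hMT hS₁ hS₂ hLT hX hvL (w₀ := i) (m := z₀)
        (n := -(i + z₂)) hz₀ ?_ ?_ ?_
      · linear_combination hz + ε * hi
      · ring
      · rw [hz', hi]
        ring
  · obtain ⟨i, hi⟩ := h3 hq
    have hn1 : ¬ residueCard F ≡ 1 [MOD 4] := by
      rw [Nat.ModEq, hq]
      decide
    have hvi : valuation F i = 1 := by
      have := congrArg (valuation F) hi
      rw [map_mul, h.unit, one_mul, map_pow, Valuation.map_neg, map_one] at this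
      exact (pow_eq_one_iff_of_nonneg zero_le two_ne_zero).1 this
    constructor
    · have h2 : residueCard F ≡ 3 [MOD 4] := hq
      simp only [h2, true_and]
      rw [← hnorm]
      -- For `X = ϖ` the equation of squares is `ε w₀ ^ 2 = -1`, and `m = 1` gives `n = -w₀`.
      refine d.isCorrelationCoefficient_of_conj hι hMT hS₁ hS₂ hKT htK hvK (w₀ := -i) (m := 1)
        (n := i) one_ne_zero ?_ ?_ ?_
      · linear_combination hi
      · ring
      · linear_combination hi
    · rw [if_neg fun h0 => hn1 h0.1]
      refine d.isCorrelationCoefficient_eq_zero_of_val hι hMT hS₁ hS₂ hLT hX hvL fun x => ?_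
      have h2 : z₀ ^ 2 - ε * (-z₂) ^ 2 + ε * x ^ 2 = ε * (x ^ 2 - ε * i ^ 2) := by
        rw [hz']
        linear_combination ε * hi
      rw [h2, map_mul, h.unit, one_mul, h.aniso, hvi, one_pow]
      exact le_max_right _ _
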